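/- Let $H$ be a complex Hilbert space and let $D\subset H$ be a dense subspace which is a Banach space with continuous inclusion into $H$. For $t\in[0,1]$ let $P(t)$ be a self-adjoint operator in $H$ with domain $D$ such that $t\mapsto P(t)\in\mathcal L(D,H)$ is $C^\infty$ on $[0,1]$ and, for some $s\ge 1$ and $C_0>0$, $$\|P^{(k)}(t)\|_{\mathcal L(D,H)}\le C_0^{k+1}k!^s,\qquad k\in\mathbb N,\ t\in[0,1].$$ Let $\gamma_1<\gamma_2$ be continuous real functions on $[0,1]$ with $\gamma_1(t),\gamma_2(t)\notin\operatorname{Spec}P(t)$ for all $t$, and let $\Gamma_0(t)$ be the positively oriented circle, symmetric with respect to the real axis, through $\gamma_1(t)$ and $\gamma_2(t)$. For a smooth function $a:\mathbb R\to\mathbb R$ let $\Omega_a=\{(t,\tau,z)\in[0,1]\times\mathbb R\times\mathbb C:\ z-a(\tau)\notin\operatorname{Spec}P(t)\}$. For operator-valued formal symbols $p=\sum_k h^kp_k(t,\tau)$ and $q=\sum_k h^kq_k(t,\tau)$ put $p\sharp q=\sum_{\alpha\ge0}\frac{h^\alpha}{\alpha!}\,i^{-\alpha}\,\partial_\tau^\alpha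 p\,\partial_t^\alpha q$. A parametrix is a formal symbol $S=\sum_j h^jS_j(t,\tau,z)$ whose coefficients are smooth maps $\Omega_a\to\mathcal L(H,D)$, holomorphic in $z$, such that for each $z$, on $\Omega_a$, $$(z-a(\tau)-P(t))\sharp S=\mathrm{id}_H,\qquad S\sharp(z-a(\tau)-P(t))=\mathrm{id}_D .$$ Given a parametrix, put, for $t\in[0,1]$ and $\tau\in\mathbb R$, $$\Pi_j(t,\tau)=\frac1{2\pi i}\int_{a(\tau)+\Gamma_0(t)}S_j(t,\tau,z)\,dz\in\mathcal L(H,D),\qquad \Pi=\sum_j h^j\Pi_j .$$ (1) Let $\sigma>1$ and let $a:\mathbb R\to\mathbb R$ have compact support and belong to $G^\sigma(\mathbb R)$, i.e. $a\in C^\infty(\mathbb R)$ and for every compact $K\subset\mathbb R$ there are $C,R>0$ with $|a^{(k)}|\le CR^kk!^\sigma$ on $K$ for all $k$. Then a parametrix $S$ exists and is unique, and it is a formal $G^{s,\sigma}$ symbol: for every compact $K\subset\Omega_a$ there are $C,R>0$ such that $$\|\partial_t^\alpha\partial_\tau^\beta S_k(t,\tau,z)\|_{\mathcal L(H,D)}\le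 CR^{\alpha+\beta+k}\alpha!^s\beta!^\sigma k!^{s+\sigma-1},\qquad \alpha,\beta,k\in\mathbb N,\ (t,\tau,z)\in K.$$ The $\Pi_j$ are smooth on $[0,1]\times\mathbb R$, one has $\Pi\sharp\Pi=\Pi$ and $(a(\tau)+P(t))\sharp\Pi=\Pi\sharp(a(\tau)+P(t))$ on $D$, and there is $C>0$ such that $$\sup_{t\in[0,1],\,\tau\in\mathbb R}\|\Pi_j(t,\tau)\|_{\mathcal L(H,D)}\le C^{j+1}j!^{\,s+\sigma-1},\qquad j\in\mathbb N.$$ (2) The same statements hold for $a(\tau)=\tau$ with $\sigma=1$. In this case, moreover, $\Pi_j(t,\tau)=\Pi_j(t)$ does not depend on $\tau$, and there is $C>0$ such that $$\sup_{t\in[0,1]}\|\Pi_j(t)\|_{\mathcal L(H,D)}\le C^{j+1}j!^{\,s},\qquad j\in\mathbb N.$$ -/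

import Mathlib

open Set MeasureTheory
open scoped ContDiff Nat

noncomputable section

/-- A function `a : ℝ → ℝ` of Gevrey class `G^σ(ℝ)`. -/
def IsGevrey (σ : ℝ) (a : ℝ → ℝ) : Prop :=
  ContDiff ℝ ∞ a ∧
    ∀ K : Set ℝ, IsCompact K → ∃ C > 0, ∃ R > 0, ∀ k : ℕ, ∀ x ∈ K,
      |iteratedDeriv k a x| ≤ C * R ^ k * (k ! : ℝ) ^ σ

/-- A family `P(t)`, `t ∈ [0,1]`, of elements of a normed space, smooth up to the end points
(one-sided derivatives there), with uniform Gevrey-`s` bounds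
`‖P^{(k)}(t)‖ ≤ C^{k+1} k!^s` on `[0,1]`. -/
def IsGevreyFamily {F : Type*} [NormedAddCommGroup F] [NormedSpace ℝ F]
    (s : ℝ) (P : ℝ → F) : Prop :=
  ContDiffOn ℝ ∞ P (Icc 0 1) ∧
    ∃ C > 0, ∀ k : ℕ, ∀ t ∈ Icc (0 : ℝ) 1,
      ‖iteratedDerivWithin k P (Icc 0 1) t‖ ≤ C ^ (k + 1) * (k ! : ℝ) ^ s

section Calculus

variable {E F G : Type*} [NormedAddCommGroup E] [NormedSpace ℂ E]
  [NormedAddCommGroup F] [NormedSpace ℂ F] [NormedAddCommGroup G] [NormedSpace ℂ G]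

/-- The symbol product `p ♯ q = ∑_α h^α / α! · i^{-α} (∂_τ^α p) (∂_t^α q)` of two
operator-valued formal symbols `p = ∑ h^k p_k(t,τ)`, `q = ∑ h^l q_l(t,τ)`:
this is the coefficient of `h^m`, the sum being over `α + k + l = m`. -/
def symbolProd (p : ℕ → ℝ → ℝ → F →L[ℂ] G) (q : ℕ → ℝ → ℝ → E →L[ℂ] F)
    (m : ℕ) (t τ : ℝ) : E →L[ℂ] G :=
  ∑ x ∈ Finset.HasAntidiagonal.antidiagonal m, ∑ y ∈ Finset.HasAntidiagonal.antidiagonal x.2,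
    (((x.1 ! : ℕ) : ℂ)⁻¹ * (Complex.I⁻¹) ^ x.1) •
      (iteratedDeriv x.1 (fun τ' => p y.1 t τ') τ).comp
        (iteratedDerivWithin x.1 (fun t' => q y.2 t' τ) (Icc 0 1) t)

/-- A symbol `p(t,τ)` as a formal symbol: `p_0 = p` and `p_k = 0` for `k ≥ 1`. -/
def principalSymbol (p : ℝ → ℝ → E →L[ℂ] F) (k : ℕ) (t τ : ℝ) : E →L[ℂ] F :=
  if k = 0 then p t τ else 0

/-- The symbol `∑ h^k S_k(t,τ,z)` on `Ω ⊆ [0,1] × ℝ × ℂ` satisfies the `G^{s,σ}` estimates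
in `(t,τ)`, locally uniformly in `(t,τ,z) ∈ Ω`. -/
def IsFormalGevrey (s σ : ℝ) (Ω : Set (ℝ × ℝ × ℂ)) (S : ℕ → ℝ → ℝ → ℂ → E →L[ℂ] F) : Prop :=
  ∀ K ⊆ Ω, IsCompact K → ∃ C > 0, ∃ R > 0, ∀ α β k : ℕ, ∀ t τ : ℝ, ∀ z : ℂ, (t, τ, z) ∈ K →
    ‖iteratedDerivWithin α (fun t' => iteratedDeriv β (fun τ' => S k t' τ' z) τ) (Icc 0 1) t‖
      ≤ C * R ^ (α + β + k) * (α ! : ℝ) ^ s * (β ! : ℝ) ^ σ * (k ! : ℝ) ^ (s + σ - 1)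

end Calculus

section Operators

variable {H D : Type*} [NormedAddCommGroup H] [InnerProductSpace ℂ H]
  [NormedAddCommGroup D] [NormedSpace ℂ D]

/-- The (in general unbounded) operator in `H` with domain `ι(D) ⊆ H` given by `ι u ↦ T u`. -/
def operatorWithDomain (ι : D →L[ℂ] H) (hι : Function.Injective ι) (T : D →L[ℂ] H) :
    H →ₗ.[ℂ] H where
  domain := LinearMap.range (ι : D →ₗ[ℂ] H)
  toFun := (T : D →ₗ[ℂ] H).comp
    (LinearEquiv.ofInjective (ι : D →ₗ[ℂ] H) hι).symm.toLinearMap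

/-- The spectrum of the closed operator `ι u ↦ T u` with domain `ι(D)`: the set of `z` for which
`z - T` is not a bijection of the domain onto `H`. -/
def operatorSpectrum (ι T : D →L[ℂ] H) : Set ℂ :=
  {z | ¬ Function.Bijective (z • ι - T)}

/-- The set of `(t,τ,z)`, `t ∈ [0,1]`, `z - a(τ) ∉ Spec(P(t))`, on which `z - a(τ) - P(t)`
is elliptic. -/
def ellipticSet (ι : D →L[ℂ] H) (a : ℝ → ℝ) (P : ℝ → D →L[ℂ] H) : Set (ℝ × ℝ × ℂ) :=
  {x | x.1 ∈ Icc (0 : ℝ) 1 ∧ x.2.2 - (a x.2.1 : ℂ) ∉ operatorSpectrum ι (P x.1)}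

/-- The symbol `a(τ) + P(t)` of `a(hD_t) + P(t)`, with values in `L(D,H)`. -/
def hamiltonSymbol (ι : D →L[ℂ] H) (a : ℝ → ℝ) (P : ℝ → D →L[ℂ] H) (t τ : ℝ) : D →L[ℂ] H :=
  (a τ : ℂ) • ι + P t

/-- `S = ∑ h^j S_j(t,τ,z)`, with values in `L(H,D)`, is a formal classical symbol on the elliptic
set, holomorphic in `z`, and is a two-sided inverse of `z - a(τ) - P(t)` for the symbol product. -/
structure IsParametrix (ι : D →L[ℂ] H) (a : ℝ → ℝ) (P : ℝ → D →L[ℂ] H)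
    (S : ℕ → ℝ → ℝ → ℂ → H →L[ℂ] D) : Prop where
  contDiffOn : ∀ j, ContDiffOn ℝ ∞ (fun x : ℝ × ℝ × ℂ => S j x.1 x.2.1 x.2.2)
    (ellipticSet ι a P)
  holomorphic : ∀ j t τ, DifferentiableOn ℂ (fun z => S j t τ z)
    {z | (t, τ, z) ∈ ellipticSet ι a P}
  right_inverse : ∀ t τ z, (t, τ, z) ∈ ellipticSet ι a P → ∀ m,
    symbolProd (principalSymbol fun t' τ' => z • ι - hamiltonSymbol ι a P t' τ')
      (fun j t' τ' => S j t' τ' z) m t τ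
      = if m = 0 then ContinuousLinearMap.id ℂ H else 0
  left_inverse : ∀ t τ z, (t, τ, z) ∈ ellipticSet ι a P → ∀ m,
    symbolProd (fun j t' τ' => S j t' τ' z)
      (principalSymbol fun t' τ' => z • ι - hamiltonSymbol ι a P t' τ') m t τ
      = if m = 0 then ContinuousLinearMap.id ℂ D else 0

/-- The coefficient `Π_j(t,τ) = (2πi)⁻¹ ∮ S_j(t,τ,z) dz`, the integral being over the positively
oriented circle `a(τ) + Γ_0(t)`, where `Γ_0(t)` is the circle symmetric with respect to the real
axis which passes through `γ₁(t)` and `γ₂(t)`. -/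
def projectorCoeff (a γ₁ γ₂ : ℝ → ℝ) (S : ℕ → ℝ → ℝ → ℂ → H →L[ℂ] D)
    (j : ℕ) (t τ : ℝ) : H →L[ℂ] D :=
  (2 * (Real.pi : ℂ) * Complex.I)⁻¹ •
    ∮ z in C(((a τ + (γ₁ t + γ₂ t) / 2 : ℝ) : ℂ), (γ₂ t - γ₁ t) / 2), S j t τ z

/-- `Π ♯ Π = Π` on `[0,1] × ℝ` for a formal symbol with values in `L(H,D)`, where `D` is
embedded in `H` by `ι`. -/
def IsFormalProjector (ι : D →L[ℂ] H) (Q : ℕ → ℝ → ℝ → H →L[ℂ] D) : Prop :=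
  ∀ m, ∀ t ∈ Icc (0 : ℝ) 1, ∀ τ,
    symbolProd Q (fun j t' τ' => ι.comp (Q j t' τ')) m t τ = Q m t τ

/-- `[a(hD_t) + P(t), Π] = 0` at the level of formal symbols on `[0,1] × ℝ`, as an identity
of operators from `D` to `H`. -/
def FormallyCommutes (ι : D →L[ℂ] H) (a : ℝ → ℝ) (P : ℝ → D →L[ℂ] H)
    (Q : ℕ → ℝ → ℝ → H →L[ℂ] D) : Prop :=
  ∀ m, ∀ t ∈ Icc (0 : ℝ) 1, ∀ τ,
    (symbolProd (principalSymbol (hamiltonSymbol ι a P)) Q m t τ).comp ι =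
      ι.comp (symbolProd Q (principalSymbol (hamiltonSymbol ι a P)) m t τ)

end Operators

end

open Topology

noncomputable section

set_option linter.unusedSectionVars false

/-! A formal symbol is recorded at each point by its jet, the numbers `m! ∂_t^j ∂_τ^β p_m`. In these
coordinates the symbol product is the unique product for which `dt` and `dτ` are derivations, `dh (p
* q) = dh p * q + p * dh q + i⁻¹ dτ p * dt q`, and the entries `0 0 0` multiply. These rules alone
make the jets an associative algebra. A jet whose entry `0 0 0` is a unit is inverted by a Neumann
series, finite in each entry. The entries of the inverse are therefore polynomials in those of the
symbol and one resolvent, which makes them smooth in `(t, τ, z)` and holomorphic in `z`; applying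
the derivations to `p * q = 1` shows that they are the derivatives of one another.

Operators `D → H` are turned into elements of the Banach algebra `B = L(H)` by composing with the
inverse of an isomorphism `Λ : D ≃ H`. The inclusion `ι` becomes an element `e`, and the spectral
parameter enters as `z e`.

The estimates come from `norm_le_of_mul_eq_one`. The symbol is the sum of a function of `τ` and a
function of `t`, so `(u + v) X = 1` expresses each entry of `X` through entries of smaller weight
`2m + j + β`. Induction gives `(j+m)!^s (β+m)!^σ ρ^(2m+j+β)`, and division by `m!` leaves
`m!^(s+σ-1)`. The constants involve only a resolvent bound and the derivatives of `a` of positive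
order. Around the moving circle both are uniform in `τ`, because the shift by `a(τ)` cancels in the
resolvent.

For the projector, the resolvent identity holds in the jet algebra (`sol_sub_sol`), and the
classical argument with two concentric contours gives idempotence (`proj_mul_const_mul_proj`);
commutation already holds under the integral. Self-adjointness makes nonreal `z` harmless, so the
circles only have to avoid the spectrum at their two real points. This gives room to freeze the
contour locally, which is how smoothness is obtained although `γ₁`, `γ₂` are only continuous. For
`a(τ) = τ` the symbol depends on `z - τ` only, so translating the contour removes `τ`. -/

/-- Jets of formal symbols with values in `B`: the entry `p m j β` stands for
`m! ∂_t^j ∂_τ^β p_m` at a given point. -/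
def Jet (B : Type*) := ℕ → ℕ → ℕ → B

/-! ### The algebra of jets -/

namespace Jet

open Finset

section Ring

variable {B : Type*} [Ring B] [Algebra ℂ B]

instance : AddCommGroup (Jet B) := inferInstanceAs (AddCommGroup (ℕ → ℕ → ℕ → B))
instance : Module ℂ (Jet B) := inferInstanceAs (Module ℂ (ℕ → ℕ → ℕ → B))

@[ext] theorem ext {p q : Jet B} (h : ∀ m j β, p m j β = q m j β) : p = q :=
  funext fun m => funext fun j => funext fun β => h m j β

@[simp] theorem add_apply (p q : Jet B) (m j β : ℕ) : (p + q) m j β = p m j β + q m j β := rfl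
@[simp] theorem sub_apply (p q : Jet B) (m j β : ℕ) : (p - q) m j β = p m j β - q m j β := rfl
@[simp] theorem neg_apply (p : Jet B) (m j β : ℕ) : (-p) m j β = -p m j β := rfl
@[simp] theorem zero_apply (m j β : ℕ) : (0 : Jet B) m j β = 0 := rfl
@[simp] theorem smul_apply (c : ℂ) (p : Jet B) (m j β : ℕ) : (c • p) m j β = c • p m j β := rfl

/-- The derivation `∂_t`. -/
def dt (p : Jet B) : Jet B := fun m j β => p m (j + 1) β
/-- The derivation `∂_τ`. -/
def dτ (p : Jet B) : Jet B := fun m j β => p m j (β + 1)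
/-- The shift `∂_h`. -/
def dh (p : Jet B) : Jet B := fun m j β => p (m + 1) j β

@[simp] theorem dt_apply (p : Jet B) (m j β : ℕ) : dt p m j β = p m (j + 1) β := rfl
@[simp] theorem dτ_apply (p : Jet B) (m j β : ℕ) : dτ p m j β = p m j (β + 1) := rfl
@[simp] theorem dh_apply (p : Jet B) (m j β : ℕ) : dh p m j β = p (m + 1) j β := rfl

/-- The entries of the symbol product of two jets. -/
def mulCoeff : ℕ → ℕ → ℕ → Jet B → Jet B → B
  | 0, 0, 0, p, q => p 0 0 0 * q 0 0 0
  | 0, 0, β + 1, p, q => mulCoeff 0 0 β (dτ p) q + mulCoeff 0 0 β p (dτ q)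
  | 0, j + 1, β, p, q => mulCoeff 0 j β (dt p) q + mulCoeff 0 j β p (dt q)
  | m + 1, j, β, p, q => mulCoeff m j β (dh p) q + mulCoeff m j β p (dh q)
      + Complex.I⁻¹ • mulCoeff m j β (dτ p) (dt q)

instance : Mul (Jet B) := ⟨fun p q m j β => mulCoeff m j β p q⟩

theorem mul_apply_zero (p q : Jet B) : (p * q) 0 0 0 = p 0 0 0 * q 0 0 0 := by
  change mulCoeff 0 0 0 p q = _
  rw [mulCoeff]

/-- The factor `m!` in the entries makes the shift in `m` act as `∂_h`. The last term is what `∂_h`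
produces on `exp(h i⁻¹ ∂_τ ⊗ ∂_t)`. -/
theorem dh_mul (p q : Jet B) :
    dh (p * q) = dh p * q + p * dh q + Complex.I⁻¹ • (dτ p * dt q) := by
  ext m j β
  change mulCoeff (m + 1) j β p q = _
  rw [mulCoeff]; rfl

/-- To prove a statement about all entries of jets, it is enough to treat the entry `0 0 0`
and each of the three shifts. -/
theorem entry_induction {Q : ℕ → ℕ → ℕ → Prop} (h0 : Q 0 0 0)
    (hτ : ∀ β, Q 0 0 β → Q 0 0 (β + 1)) (ht : ∀ j, (∀ β, Q 0 j β) → ∀ β, Q 0 (j + 1) β)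
    (hh : ∀ m, (∀ j β, Q m j β) → ∀ j β, Q (m + 1) j β) (m j β : ℕ) : Q m j β := by
  induction m generalizing j β with
  | zero =>
    induction j generalizing β with
    | zero =>
      induction β with
      | zero => exact h0
      | succ β ih => exact hτ β ih
    | succ j ih => exact ht j ih β
  | succ m ih => exact hh m ih j β

/-- The recursion for the product treats `h` first, then `t`, then `τ`. The rule persists when `m >
0` because the three shifts commute. -/
theorem dt_mul (p q : Jet B) : dt (p * q) = dt p * q + p * dt q := by
  suffices h : ∀ m j β, ∀ p q : Jet B, mulCoeff m (j + 1) β p q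
      = mulCoeff m j β (dt p) q + mulCoeff m j β p (dt q) from ext fun m j β => h m j β p q
  intro m
  induction m with
  | zero => intro j β p q; rw [mulCoeff]
  | succ m ih =>
    intro j β p q
    rw [mulCoeff, mulCoeff, mulCoeff, ih, ih, ih, smul_add]
    have : ∀ p : Jet B, dh (dt p) = dt (dh p) := fun _ => rfl
    have h2 : ∀ p : Jet B, dτ (dt p) = dt (dτ p) := fun _ => rfl
    simp only [this, h2]
    abel

theorem dτ_mul (p q : Jet B) : dτ (p * q) = dτ p * q + p * dτ q := by
  suffices h : ∀ m j β, ∀ p q : Jet B, mulCoeff m j (β + 1) p q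
      = mulCoeff m j β (dτ p) q + mulCoeff m j β p (dτ q) from ext fun m j β => h m j β p q
  intro m
  induction m with
  | zero =>
    intro j
    induction j with
    | zero => intro β p q; rw [mulCoeff]
    | succ j ih =>
      intro β p q
      rw [mulCoeff, mulCoeff, mulCoeff, ih, ih]
      have h2 : ∀ p : Jet B, dτ (dt p) = dt (dτ p) := fun _ => rfl
      simp only [h2]
      abel
  | succ m ih =>
    intro j β p q
    rw [mulCoeff, mulCoeff, mulCoeff, ih, ih, ih, smul_add]
    have : ∀ p : Jet B, dh (dτ p) = dτ (dh p) := fun _ => rfl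
    have h2 : ∀ p : Jet B, dτ (dt p) = dt (dτ p) := fun _ => rfl
    simp only [this, h2]
    abel

theorem mul_apply_dh (p q : Jet B) (m j β : ℕ) : (p * q) (m + 1) j β
    = (dh p * q) m j β + (p * dh q) m j β + Complex.I⁻¹ • (dτ p * dt q) m j β :=
  congrArg (fun r : Jet B => r m j β) (dh_mul p q)
theorem mul_apply_dt (p q : Jet B) (m j β : ℕ) : (p * q) m (j + 1) β
    = (dt p * q) m j β + (p * dt q) m j β :=
  congrArg (fun r : Jet B => r m j β) (dt_mul p q)
theorem mul_apply_dτ (p q : Jet B) (m j β : ℕ) : (p * q) m j (β + 1)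
    = (dτ p * q) m j β + (p * dτ q) m j β :=
  congrArg (fun r : Jet B => r m j β) (dτ_mul p q)


/-- The jet of a constant. -/
def const (b : B) : Jet B := fun m j β => if m = 0 ∧ j = 0 ∧ β = 0 then b else 0

@[simp] theorem const_apply_zero (b : B) : const b 0 0 0 = b := by simp [const]
@[simp] theorem dt_add (p q : Jet B) : dt (p + q) = dt p + dt q := rfl
@[simp] theorem dτ_add (p q : Jet B) : dτ (p + q) = dτ p + dτ q := rfl
@[simp] theorem dh_add (p q : Jet B) : dh (p + q) = dh p + dh q := rfl
@[simp] theorem dt_smul (c : ℂ) (p : Jet B) : dt (c • p) = c • dt p := rfl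
@[simp] theorem dτ_smul (c : ℂ) (p : Jet B) : dτ (c • p) = c • dτ p := rfl
@[simp] theorem dh_smul (c : ℂ) (p : Jet B) : dh (c • p) = c • dh p := rfl
@[simp] theorem dt_const (b : B) : dt (const b) = 0 := by ext; simp [const]
@[simp] theorem dτ_const (b : B) : dτ (const b) = 0 := by ext; simp [const]
@[simp] theorem dh_const (b : B) : dh (const b) = 0 := by ext; simp [const]

instance : One (Jet B) := ⟨const 1⟩

theorem one_def : (1 : Jet B) = const 1 := rfl

theorem add_mul_apply (m j β : ℕ) : ∀ p q r : Jet B,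
    ((p + q) * r) m j β = (p * r) m j β + (q * r) m j β := by
  induction m, j, β using entry_induction with
  | h0 => intro p q r; simp [mul_apply_zero, add_mul]
  | hτ β ih => intro p q r; simp only [mul_apply_dτ, dτ_add, ih]; abel
  | ht j ih => intro p q r; simp only [mul_apply_dt, dt_add, ih]; abel
  | hh m ih => intro p q r; simp only [mul_apply_dh, dτ_add, dh_add, ih, smul_add]; abel

theorem mul_add_apply (m j β : ℕ) : ∀ p q r : Jet B,
    (p * (q + r)) m j β = (p * q) m j β + (p * r) m j β := by
  induction m, j, β using entry_induction with
  | h0 => intro p q r; simp [mul_apply_zero, mul_add]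
  | hτ β ih => intro p q r; simp only [mul_apply_dτ, dτ_add, ih]; abel
  | ht j ih => intro p q r; simp only [mul_apply_dt, dt_add, ih]; abel
  | hh m ih => intro p q r; simp only [mul_apply_dh, dt_add, dh_add, ih, smul_add]; abel

theorem smul_mul_apply (m j β : ℕ) : ∀ (c : ℂ) (p q : Jet B),
    ((c • p) * q) m j β = c • (p * q) m j β := by
  induction m, j, β using entry_induction with
  | h0 => intro c p q; simp [mul_apply_zero]
  | hτ β ih => intro c p q; simp only [mul_apply_dτ, dτ_smul, ih, smul_add]
  | ht j ih => intro c p q; simp only [mul_apply_dt, dt_smul, ih, smul_add]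
  | hh m ih =>
    intro c p q
    simp only [mul_apply_dh, dτ_smul, dh_smul, ih, smul_add, smul_comm c Complex.I⁻¹]

theorem mul_smul_apply (m j β : ℕ) : ∀ (c : ℂ) (p q : Jet B),
    (p * (c • q)) m j β = c • (p * q) m j β := by
  induction m, j, β using entry_induction with
  | h0 => intro c p q; simp [mul_apply_zero]
  | hτ β ih => intro c p q; simp only [mul_apply_dτ, dτ_smul, ih, smul_add]
  | ht j ih => intro c p q; simp only [mul_apply_dt, dt_smul, ih, smul_add]
  | hh m ih =>
    intro c p q
    simp only [mul_apply_dh, dt_smul, dh_smul, ih, smul_add, smul_comm c Complex.I⁻¹]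

theorem smul_mul' (c : ℂ) (p q : Jet B) : (c • p) * q = c • (p * q) :=
  ext fun m j β => smul_mul_apply m j β c p q
theorem mul_smul' (c : ℂ) (p q : Jet B) : p * (c • q) = c • (p * q) :=
  ext fun m j β => mul_smul_apply m j β c p q

theorem const_mul_apply (m j β : ℕ) : ∀ (b : B) (q : Jet B),
    (const b * q) m j β = b * q m j β := by
  have h0 : ∀ (m j β : ℕ) (q : Jet B), (0 * q) m j β = 0 := fun m j β q => by
    simpa using smul_mul_apply m j β 0 0 q
  induction m, j, β using entry_induction with
  | h0 => intro b q; simp [mul_apply_zero]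
  | hτ β ih => intro b q; simp [mul_apply_dτ, ih, h0]
  | ht j ih => intro b q; simp [mul_apply_dt, ih, h0]
  | hh m ih => intro b q; simp [mul_apply_dh, ih, h0]

theorem mul_const_apply (m j β : ℕ) : ∀ (b : B) (q : Jet B),
    (q * const b) m j β = q m j β * b := by
  have h0 : ∀ (m j β : ℕ) (q : Jet B), (q * 0) m j β = 0 := fun m j β q => by
    simpa using mul_smul_apply m j β 0 q 0
  induction m, j, β using entry_induction with
  | h0 => intro b q; simp [mul_apply_zero]
  | hτ β ih => intro b q; simp [mul_apply_dτ, ih, h0]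
  | ht j ih => intro b q; simp [mul_apply_dt, ih, h0]
  | hh m ih => intro b q; simp [mul_apply_dh, ih, h0]

/-- Both bracketings obey the same recursion. In the `h` step each yields the three `dh` terms and
`i⁻¹` times `dτ p · dt q · r`, `dτ p · q · dt r`, `p · dτ q · dt r`. -/
theorem mul_assoc_apply (m j β : ℕ) : ∀ p q r : Jet B,
    (p * q * r) m j β = (p * (q * r)) m j β := by
  induction m, j, β using entry_induction with
  | h0 => intro p q r; simp [mul_apply_zero, mul_assoc]
  | hτ β ih =>
    intro p q r
    simp only [mul_apply_dτ, dτ_mul, add_mul_apply, mul_add_apply, ih]; abel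
  | ht j ih =>
    intro p q r
    simp only [mul_apply_dt, dt_mul, add_mul_apply, mul_add_apply, ih]; abel
  | hh m ih =>
    intro p q r
    simp only [mul_apply_dh, dt_mul, dτ_mul, dh_mul, add_mul_apply, mul_add_apply,
      smul_mul_apply, mul_smul_apply, ih, smul_add]
    abel

instance : Ring (Jet B) :=
  { (inferInstance : AddCommGroup (Jet B)) with
    mul := (· * ·)
    one := 1
    mul_assoc := fun p q r => ext fun m j β => mul_assoc_apply m j β p q r
    one_mul := fun p => ext fun m j β => by rw [one_def, const_mul_apply, one_mul]
    mul_one := fun p => ext fun m j β => by rw [one_def, mul_const_apply, mul_one]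
    left_distrib := fun p q r => ext fun m j β => mul_add_apply m j β p q r
    right_distrib := fun p q r => ext fun m j β => add_mul_apply m j β p q r
    zero_mul := fun p => ext fun m j β => by simpa using smul_mul_apply m j β 0 0 p
    mul_zero := fun p => ext fun m j β => by simpa using mul_smul_apply m j β 0 p 0 }

instance : Algebra ℂ (Jet B) := Algebra.ofModule smul_mul' fun c p q => mul_smul' c p q

@[simp] theorem dt_one : dt (1 : Jet B) = 0 := dt_const 1
@[simp] theorem dτ_one : dτ (1 : Jet B) = 0 := dτ_const 1

@[simp] theorem finsum_apply {ι : Type*} (s : Finset ι) (f : ι → Jet B) (m j β : ℕ) :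
    (∑ i ∈ s, f i) m j β = ∑ i ∈ s, f i m j β := by
  classical
  induction s using Finset.induction_on with
  | empty => simp
  | insert a s ha ih => simp [Finset.sum_insert ha, ih]

theorem const_mul_const (b c : B) : const b * const c = const (b * c) := by
  ext m j β
  rw [const_mul_apply]
  simp only [const]
  split_ifs <;> simp

end Ring

end Jet

/-! ### Closed product formulas and inversion by Neumann series -/

namespace Jet

open Finset

section Formulas

variable {B : Type*} [Ring B] [Algebra ℂ B]

theorem sum_choose_succ {M : Type*} [AddCommMonoid M] (f : ℕ → ℕ → M) (n : ℕ) :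
    (∑ x ∈ antidiagonal (n + 1), (n + 1).choose x.1 • f x.1 x.2) =
      (∑ x ∈ antidiagonal n, n.choose x.1 • f x.1 (x.2 + 1)) +
        ∑ x ∈ antidiagonal n, n.choose x.1 • f (x.1 + 1) x.2 := by
  rw [sum_antidiagonal_choose_succ_nsmul]
  congr 1
  refine sum_congr rfl fun x hx => ?_
  rw [← mem_antidiagonal.1 hx, Nat.choose_symm_add]

/-- This is the formula defining `symbolProd`, up to the factorials built into the entries; it links
the recursive product to the symbol calculus. -/
theorem mul_apply_entry_zero (m : ℕ) : ∀ p q : Jet B, (p * q) m 0 0 =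
    ∑ x ∈ antidiagonal m, m.choose x.1 • ∑ y ∈ antidiagonal x.2, x.2.choose y.1 •
      (Complex.I⁻¹ ^ x.1 • (p y.1 0 x.1 * q y.2 x.1 0)) := by
  induction m with
  | zero => intro p q; simp [mul_apply_zero]
  | succ m ih =>
    intro p q
    rw [mul_apply_dh, ih, ih, ih,
      sum_choose_succ (fun α r => ∑ y ∈ antidiagonal r, r.choose y.1 •
        (Complex.I⁻¹ ^ α • (p y.1 0 α * q y.2 α 0)))]
    congr 1
    · rw [← sum_add_distrib]
      refine sum_congr rfl fun x _ => ?_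
      rw [sum_choose_succ (fun k l => Complex.I⁻¹ ^ x.1 • (p k 0 x.1 * q l x.1 0)), ← smul_add,
        add_comm]
      rfl
    · rw [smul_sum]
      refine sum_congr rfl fun x _ => ?_
      rw [smul_comm, smul_sum]
      congr 1
      refine sum_congr rfl fun y _ => ?_
      rw [smul_comm, pow_succ', mul_smul]
      rfl

/-- The product formula when the left factor depends on `τ` only. -/
theorem mul_apply_of_dt_eq_zero (m j β : ℕ) : ∀ p q : Jet B, dt p = 0 → dh p = 0 →
    (p * q) m j β = ∑ x ∈ antidiagonal m, m.choose x.1 • ∑ y ∈ antidiagonal β, β.choose y.1 •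
      (Complex.I⁻¹ ^ x.1 • (p 0 0 (x.1 + y.1) * q x.2 (j + x.1) y.2)) := by
  induction m, j, β using entry_induction with
  | h0 => intro p q _ _; simp [mul_apply_zero]
  | hτ β ih =>
    intro p q h1 h2
    have h3 : dt (dτ p) = 0 := congrArg dτ h1
    have h4 : dh (dτ p) = 0 := congrArg dτ h2
    rw [mul_apply_dτ, ih _ _ h3 h4, ih _ _ h1 h2]
    simp only [Finset.Nat.antidiagonal_zero, sum_singleton]
    rw [sum_choose_succ (fun k l => Complex.I⁻¹ ^ 0 • (p 0 0 (0 + k) * q 0 (0 + 0) l)),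
      ← smul_add, add_comm]
    rfl
  | ht j ih β =>
    intro p q h1 h2
    rw [mul_apply_dt, h1, zero_mul, ih _ _ _ h1 h2]
    simp
  | hh m ih j β =>
    intro p q h1 h2
    have h3 : dt (dτ p) = 0 := congrArg dτ h1
    have h4 : dh (dτ p) = 0 := congrArg dτ h2
    rw [mul_apply_dh, h2, zero_mul, ih _ _ _ _ h1 h2, ih _ _ _ _ h3 h4,
      sum_choose_succ (fun α r => ∑ y ∈ antidiagonal β, β.choose y.1 •
        (Complex.I⁻¹ ^ α • (p 0 0 (α + y.1) * q r (j + α) y.2)))]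
    congr 1
    · simp
    · rw [smul_sum]
      refine sum_congr rfl fun x _ => ?_
      rw [smul_comm, smul_sum]
      congr 1
      refine sum_congr rfl fun y _ => ?_
      rw [smul_comm, pow_succ', mul_smul, dτ_apply, dt_apply, add_right_comm x.1 1 y.1, add_assoc j]

/-- The product formula when the left factor depends on `t` only. -/
theorem mul_apply_of_dτ_eq_zero (m j β : ℕ) : ∀ p q : Jet B, dτ p = 0 → dh p = 0 →
    (p * q) m j β = ∑ x ∈ antidiagonal j, j.choose x.1 • (p 0 x.1 0 * q m x.2 β) := by
  induction m, j, β using entry_induction with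
  | h0 => intro p q _ _; simp [mul_apply_zero]
  | hτ β ih =>
    intro p q h1 h2
    rw [mul_apply_dτ, h1, zero_mul, ih _ _ h1 h2]
    simp
  | ht j ih β =>
    intro p q h1 h2
    have h3 : dτ (dt p) = 0 := congrArg dt h1
    have h4 : dh (dt p) = 0 := congrArg dt h2
    rw [mul_apply_dt, ih _ _ _ h3 h4, ih _ _ _ h1 h2,
      sum_choose_succ (fun k l => p 0 k 0 * q 0 l β), add_comm]
    rfl
  | hh m ih j β =>
    intro p q h1 h2
    rw [mul_apply_dh, h2, zero_mul, h1, zero_mul, ih _ _ _ _ h1 h2]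
    simp

/-- `VanishBelow K p`: all entries of weight `2m + j + β < K` vanish. -/
def VanishBelow (K : ℕ) (p : Jet B) : Prop := ∀ m j β, 2 * m + j + β < K → p m j β = 0

/-- An order in `h` counts twice because the twisted term of `dh_mul` spends one `dτ` and one `dt`.
With this weight the filtration is multiplicative. -/
theorem VanishBelow.mul_apply (m j β : ℕ) : ∀ (K L : ℕ) (p q : Jet B), VanishBelow K p →
    VanishBelow L q → 2 * m + j + β < K + L → (p * q) m j β = 0 := by
  have h1 : ∀ (K : ℕ) (p : Jet B), VanishBelow K p → VanishBelow (K - 1) (dt p) :=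
    fun K p h m j β hm => h _ _ _ (by omega)
  have h2 : ∀ (K : ℕ) (p : Jet B), VanishBelow K p → VanishBelow (K - 1) (dτ p) :=
    fun K p h m j β hm => h _ _ _ (by omega)
  have h3 : ∀ (K : ℕ) (p : Jet B), VanishBelow K p → VanishBelow (K - 2) (dh p) :=
    fun K p h m j β hm => h _ _ _ (by omega)
  induction m, j, β using entry_induction with
  | h0 =>
    intro K L p q hp hq hK
    rw [mul_apply_zero]
    rcases Nat.eq_zero_or_pos K with rfl | hK'
    · rw [hq 0 0 0 (by omega), mul_zero]
    · rw [hp 0 0 0 (by omega), zero_mul]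
  | hτ β ih =>
    intro K L p q hp hq hK
    rw [mul_apply_dτ, ih _ _ _ _ (h2 _ _ hp) hq (by omega), ih _ _ _ _ hp (h2 _ _ hq) (by omega),
      add_zero]
  | ht j ih β =>
    intro K L p q hp hq hK
    rw [mul_apply_dt, ih _ _ _ _ _ (h1 _ _ hp) hq (by omega),
      ih _ _ _ _ _ hp (h1 _ _ hq) (by omega), add_zero]
  | hh m ih j β =>
    intro K L p q hp hq hK
    rw [mul_apply_dh, ih _ _ _ _ _ _ (h3 _ _ hp) hq (by omega),
      ih _ _ _ _ _ _ hp (h3 _ _ hq) (by omega),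
      ih _ _ _ _ _ _ (h2 _ _ hp) (h1 _ _ hq) (by omega), smul_zero, add_zero, add_zero]

theorem VanishBelow.mul {K L : ℕ} {p q : Jet B} (hp : VanishBelow K p) (hq : VanishBelow L q) :
    VanishBelow (K + L) (p * q) :=
  fun m j β h => VanishBelow.mul_apply m j β K L p q hp hq h

theorem VanishBelow.pow {p : Jet B} (hp : VanishBelow 1 p) (n : ℕ) : VanishBelow n (p ^ n) := by
  induction n with
  | zero => intro m j β h; omega
  | succ n ih => rw [pow_succ]; exact ih.mul hp

/-- The geometric series `∑ N^n` of a jet without constant term. -/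
def geom (N : Jet B) : Jet B := fun m j β => ∑ n ∈ range (2 * m + j + β + 1), (N ^ n) m j β

theorem geom_sub_sum {N : Jet B} (hN : VanishBelow 1 N) (K : ℕ) :
    VanishBelow K (geom N - ∑ n ∈ range K, N ^ n) := by
  intro m j β h
  rw [sub_apply, finsum_apply, geom, sub_eq_zero]
  refine sum_subset (fun n hn => ?_) fun n hn hn' => ?_
  · rw [Finset.mem_range] at *; omega
  · rw [Finset.mem_range] at hn hn'
    exact hN.pow n m j β (by omega)

theorem eq_of_forall_vanishBelow {p q : Jet B} (h : ∀ K, VanishBelow K (p - q)) : p = q := by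
  ext m j β
  exact sub_eq_zero.1 (h (2 * m + j + β + 1) m j β (by omega))

theorem VanishBelow.add {K : ℕ} {p q : Jet B} (hp : VanishBelow K p) (hq : VanishBelow K q) :
    VanishBelow K (p + q) := fun m j β h => by rw [add_apply, hp m j β h, hq m j β h, add_zero]

theorem VanishBelow.neg {K : ℕ} {p : Jet B} (hp : VanishBelow K p) :
    VanishBelow K (-p) := fun m j β h => by rw [neg_apply, hp m j β h, neg_zero]

theorem vanishBelow_zero (p : Jet B) : VanishBelow 0 p := fun _ _ _ h => absurd h (Nat.not_lt_zero _)

/-- Up to weight `K` the series equals its partial sum, for which the finite geometric identity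
leaves `-N ^ K`. Both errors vanish below `K`, and the filtration is separated. -/
theorem one_sub_mul_geom {N : Jet B} (hN : VanishBelow 1 N) : (1 - N) * geom N = 1 := by
  refine eq_of_forall_vanishBelow fun K => ?_
  have h1 : (1 - N) * geom N - 1 = (1 - N) * (geom N - ∑ n ∈ range K, N ^ n) + -N ^ K := by
    rw [mul_sub, mul_neg_geom_sum]; abel
  rw [h1]
  refine VanishBelow.add ?_ (hN.pow K).neg
  simpa using (vanishBelow_zero (1 - N)).mul (geom_sub_sum hN K)

theorem geom_mul_one_sub {N : Jet B} (hN : VanishBelow 1 N) : geom N * (1 - N) = 1 := by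
  refine eq_of_forall_vanishBelow fun K => ?_
  have h1 : geom N * (1 - N) - 1 = (geom N - ∑ n ∈ range K, N ^ n) * (1 - N) + -N ^ K := by
    rw [sub_mul, geom_sum_mul_neg]; abel
  rw [h1]
  refine VanishBelow.add ?_ (hN.pow K).neg
  simpa using (geom_sub_sum hN K).mul (vanishBelow_zero (1 - N))

/-- The inverse of a jet with invertible constant term. -/
def inv (p : Jet B) : Jet B :=
  geom (1 - const (Ring.inverse (p 0 0 0)) * p) * const (Ring.inverse (p 0 0 0))

theorem vanishBelow_one_sub {p : Jet B} (hp : IsUnit (p 0 0 0)) :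
    VanishBelow 1 (1 - const (Ring.inverse (p 0 0 0)) * p) := by
  intro m j β h
  obtain ⟨rfl, rfl, rfl⟩ : m = 0 ∧ j = 0 ∧ β = 0 := by omega
  rw [sub_apply, const_mul_apply, Ring.inverse_mul_cancel _ hp, one_def, const_apply_zero, sub_self]

theorem inv_mul {p : Jet B} (hp : IsUnit (p 0 0 0)) : inv p * p = 1 := by
  have h := geom_mul_one_sub (vanishBelow_one_sub hp)
  rwa [sub_sub_cancel, ← mul_assoc] at h

theorem mul_inv {p : Jet B} (hp : IsUnit (p 0 0 0)) : p * inv p = 1 := by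
  have h := one_sub_mul_geom (vanishBelow_one_sub hp)
  rw [sub_sub_cancel] at h
  set r := Ring.inverse (p 0 0 0)
  set G := geom (1 - const r * p)
  have h1 : const (p 0 0 0) * const r = 1 := by
    rw [const_mul_const, Ring.mul_inverse_cancel _ hp, one_def]
  -- The series inverts `r p`, giving `r p G = 1`; cancelling `r` on the left moves it to the other
  -- side of `G`.
  have h2 : p * G = const (p 0 0 0) := by
    calc p * G = const (p 0 0 0) * const r * p * G := by rw [h1, one_mul]
      _ = const (p 0 0 0) * (const r * p * G) := by simp only [mul_assoc]
      _ = _ := by rw [h, mul_one]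
  change p * (G * const r) = 1
  rw [← mul_assoc, h2, h1]

end Formulas

/-! ### Dependence of products and inverses on parameters -/

section Families

variable {B : Type*} [Ring B] [Algebra ℂ B] {X : Type*} (𝒮 : Subalgebra ℂ (X → B))

/-- An entry of a product is a finite combination of products of entries. Stating this for an
arbitrary subalgebra covers smooth and holomorphic dependence at once. -/
theorem mul_mem (m j β : ℕ) : ∀ p q : X → Jet B, (∀ m j β, (fun x => p x m j β) ∈ 𝒮) →
    (∀ m j β, (fun x => q x m j β) ∈ 𝒮) → (fun x => (p x * q x) m j β) ∈ 𝒮 := by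
  induction m, j, β using entry_induction with
  | h0 => intro p q hp hq; simp only [mul_apply_zero]; exact 𝒮.mul_mem (hp 0 0 0) (hq 0 0 0)
  | hτ β ih =>
    intro p q hp hq
    simp only [mul_apply_dτ]
    exact 𝒮.add_mem (ih _ _ (fun m j β => hp m j (β + 1)) hq)
      (ih _ _ hp (fun m j β => hq m j (β + 1)))
  | ht j ih β =>
    intro p q hp hq
    simp only [mul_apply_dt]
    exact 𝒮.add_mem (ih _ _ _ (fun m j β => hp m (j + 1) β) hq)
      (ih _ _ _ hp (fun m j β => hq m (j + 1) β))
  | hh m ih j β =>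
    intro p q hp hq
    simp only [mul_apply_dh]
    exact 𝒮.add_mem (𝒮.add_mem (ih _ _ _ _ (fun m j β => hp (m + 1) j β) hq)
      (ih _ _ _ _ hp (fun m j β => hq (m + 1) j β)))
      (𝒮.smul_mem (ih _ _ _ _ (fun m j β => hp m j (β + 1)) (fun m j β => hq m (j + 1) β)) _)

theorem const_mem (b : X → B) (hb : b ∈ 𝒮) (m j β : ℕ) : (fun x => const (b x) m j β) ∈ 𝒮 := by
  by_cases h : m = 0 ∧ j = 0 ∧ β = 0
  · simpa [const, h] using hb
  · simp only [const, h, if_false]; exact 𝒮.zero_mem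

theorem inv_mem (p : X → Jet B) (hp : ∀ m j β, (fun x => p x m j β) ∈ 𝒮)
    (hr : (fun x => Ring.inverse (p x 0 0 0)) ∈ 𝒮) (m j β : ℕ) :
    (fun x => inv (p x) m j β) ∈ 𝒮 := by
  have h1 : ∀ m j β, (fun x => (1 : Jet B) m j β) ∈ 𝒮 :=
    const_mem 𝒮 (fun _ => 1) 𝒮.one_mem
  have h2 := const_mem 𝒮 _ hr
  have h3 : ∀ m j β, (fun x => (1 - const (Ring.inverse (p x 0 0 0)) * p x) m j β) ∈ 𝒮 :=
    fun m j β => 𝒮.sub_mem (h1 m j β) (mul_mem 𝒮 m j β _ _ h2 hp)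
  have h4 : ∀ n m j β,
      (fun x => ((1 - const (Ring.inverse (p x 0 0 0)) * p x) ^ n : Jet B) m j β) ∈ 𝒮 := by
    intro n
    induction n with
    | zero => simpa using h1
    | succ n ih => intro m j β; simp only [pow_succ]; exact mul_mem 𝒮 m j β _ _ ih h3
  refine mul_mem 𝒮 m j β _ _ (fun m j β => ?_) h2
  have : (fun x => geom (1 - const (Ring.inverse (p x 0 0 0)) * p x) m j β)
      = ∑ n ∈ range (2 * m + j + β + 1),
        (fun x => ((1 - const (Ring.inverse (p x 0 0 0)) * p x) ^ n : Jet B) m j β) := by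
    ext x; rw [Finset.sum_apply]; rfl
  rw [this]
  exact 𝒮.sum_mem fun n _ => h4 n m j β

end Families

/-! ### Differentiation and contour integration of products -/

section Calculus

variable {B : Type*} [NormedRing B] [NormedAlgebra ℂ B]

/-- The parameter need not be `t` or `τ`, and `p'`, `q'` are not assumed to be shifts of `p`, `q`.
This is essential when the derivative of an inverse is still to be identified. -/
theorem hasDerivWithinAt_mul {s : Set ℝ} {x : ℝ} (m j β : ℕ) : ∀ (p q : ℝ → Jet B) (p' q' : Jet B),
    (∀ m j β, HasDerivWithinAt (fun y => p y m j β) (p' m j β) s x) →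
    (∀ m j β, HasDerivWithinAt (fun y => q y m j β) (q' m j β) s x) →
    HasDerivWithinAt (fun y => (p y * q y) m j β) ((p' * q x + p x * q') m j β) s x := by
  induction m, j, β using entry_induction with
  | h0 =>
    intro p q p' q' hp hq
    simp only [mul_apply_zero, add_apply]
    exact (hp 0 0 0).mul (hq 0 0 0)
  | hτ β ih =>
    intro p q p' q' hp hq
    simp only [mul_apply_dτ, add_apply]
    refine HasDerivWithinAt.congr_deriv ((ih (fun y => dτ (p y)) q (dτ p') q' (fun m j β => hp m j (β + 1)) hq).fun_add
      (ih p (fun y => dτ (q y)) p' (dτ q') hp (fun m j β => hq m j (β + 1)))) ?_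
    simp only [add_apply]
    abel
  | ht j ih β =>
    intro p q p' q' hp hq
    simp only [mul_apply_dt, add_apply]
    refine HasDerivWithinAt.congr_deriv ((ih β (fun y => dt (p y)) q (dt p') q'
      (fun m j β => hp m (j + 1) β) hq).fun_add
      (ih β p (fun y => dt (q y)) p' (dt q') hp (fun m j β => hq m (j + 1) β))) ?_
    simp only [add_apply]
    abel
  | hh m ih j β =>
    intro p q p' q' hp hq
    simp only [mul_apply_dh, add_apply]
    refine HasDerivWithinAt.congr_deriv (((ih j β (fun y => dh (p y)) q (dh p') q'
      (fun m j β => hp (m + 1) j β) hq).fun_add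
      (ih j β p (fun y => dh (q y)) p' (dh q') hp (fun m j β => hq (m + 1) j β))).fun_add
      ((ih j β (fun y => dτ (p y)) (fun y => dt (q y)) (dτ p') (dt q')
        (fun m j β => hp m j (β + 1))
        (fun m j β => hq m (j + 1) β)).fun_const_smul Complex.I⁻¹)) ?_
    simp only [add_apply, smul_add]
    abel

theorem _root_.CircleIntegrable.clm_comp {E F : Type*} [NormedAddCommGroup E] [NormedSpace ℂ E]
    [NormedAddCommGroup F] [NormedSpace ℂ F] (L : E →L[ℂ] F) {f : ℂ → E} {c : ℂ} {R : ℝ}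
    (hf : CircleIntegrable f c R) : CircleIntegrable (fun z => L (f z)) c R :=
  ⟨L.integrable_comp hf.1, L.integrable_comp hf.2⟩

theorem _root_.ContinuousLinearMap.circleIntegral_comp_comm {E F : Type*} [NormedAddCommGroup E]
    [NormedSpace ℂ E] [CompleteSpace E]
    [NormedAddCommGroup F] [NormedSpace ℂ F] [CompleteSpace F] (L : E →L[ℂ] F) {f : ℂ → E} {c : ℂ}
    {R : ℝ} (hf : CircleIntegrable f c R) : ∮ z in C(c, R), L (f z) = L (∮ z in C(c, R), f z) := by
  rw [circleIntegral, circleIntegral, ← ContinuousLinearMap.intervalIntegral_comp_comm L hf.out]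
  simp

theorem mul_circleIntegral [CompleteSpace B] (c : ℂ) (R : ℝ) (m j β : ℕ) :
    ∀ (p : Jet B) (q : ℂ → Jet B) (Q : Jet B),
    (∀ m j β, CircleIntegrable (fun z => q z m j β) c R) →
    (∀ m j β, Q m j β = ∮ z in C(c, R), q z m j β) →
    CircleIntegrable (fun z => (p * q z) m j β) c R ∧
      (p * Q) m j β = ∮ z in C(c, R), (p * q z) m j β := by
  induction m, j, β using entry_induction with
  | h0 =>
    intro p q Q hq hQ
    simp only [mul_apply_zero]
    exact ⟨(hq 0 0 0).clm_comp (ContinuousLinearMap.mul ℂ B (p 0 0 0)), by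
      rw [hQ]
      exact ((ContinuousLinearMap.mul ℂ B (p 0 0 0)).circleIntegral_comp_comm (hq 0 0 0)).symm⟩
  | hτ β ih =>
    intro p q Q hq hQ
    simp only [mul_apply_dτ]
    obtain ⟨a1, a2⟩ := ih (dτ p) q Q hq hQ
    obtain ⟨b1, b2⟩ := ih p (fun z => dτ (q z)) (dτ Q) (fun m j β => hq m j (β + 1))
      (fun m j β => hQ m j (β + 1))
    exact ⟨a1.add b1, by rw [a2, b2, circleIntegral.integral_add a1 b1]⟩
  | ht j ih β =>
    intro p q Q hq hQ
    simp only [mul_apply_dt]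
    obtain ⟨a1, a2⟩ := ih _ (dt p) q Q hq hQ
    obtain ⟨b1, b2⟩ := ih _ p (fun z => dt (q z)) (dt Q) (fun m j β => hq m (j + 1) β)
      (fun m j β => hQ m (j + 1) β)
    exact ⟨a1.add b1, by rw [a2, b2, circleIntegral.integral_add a1 b1]⟩
  | hh m ih j β =>
    intro p q Q hq hQ
    simp only [mul_apply_dh]
    obtain ⟨a1, a2⟩ := ih _ _ (dh p) q Q hq hQ
    obtain ⟨b1, b2⟩ := ih _ _ p (fun z => dh (q z)) (dh Q) (fun m j β => hq (m + 1) j β)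
      (fun m j β => hQ (m + 1) j β)
    obtain ⟨c1, c2⟩ := ih _ _ (dτ p) (fun z => dt (q z)) (dt Q) (fun m j β => hq m (j + 1) β)
      (fun m j β => hQ m (j + 1) β)
    have c3 := c1.clm_comp (Complex.I⁻¹ • ContinuousLinearMap.id ℂ B)
    exact ⟨(a1.add b1).add c3, by
      rw [a2, b2, c2, ← circleIntegral.integral_smul, ← circleIntegral.integral_add a1 b1]
      exact (circleIntegral.integral_add (a1.add b1) c3).symm⟩

theorem circleIntegral_mul [CompleteSpace B] (c : ℂ) (R : ℝ) (m j β : ℕ) :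
    ∀ (q : ℂ → Jet B) (Q p : Jet B),
    (∀ m j β, CircleIntegrable (fun z => q z m j β) c R) →
    (∀ m j β, Q m j β = ∮ z in C(c, R), q z m j β) →
    CircleIntegrable (fun z => (q z * p) m j β) c R ∧
      (Q * p) m j β = ∮ z in C(c, R), (q z * p) m j β := by
  induction m, j, β using entry_induction with
  | h0 =>
    intro q Q p hq hQ
    simp only [mul_apply_zero]
    exact ⟨(hq 0 0 0).clm_comp ((ContinuousLinearMap.mul ℂ B).flip (p 0 0 0)), by
      rw [hQ]
      exact (((ContinuousLinearMap.mul ℂ B).flip (p 0 0 0)).circleIntegral_comp_comm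
        (hq 0 0 0)).symm⟩
  | hτ β ih =>
    intro q Q p hq hQ
    simp only [mul_apply_dτ]
    obtain ⟨a1, a2⟩ := ih q Q (dτ p) hq hQ
    obtain ⟨b1, b2⟩ := ih (fun z => dτ (q z)) (dτ Q) p (fun m j β => hq m j (β + 1))
      (fun m j β => hQ m j (β + 1))
    exact ⟨b1.add a1, by rw [a2, b2, circleIntegral.integral_add b1 a1]⟩
  | ht j ih β =>
    intro q Q p hq hQ
    simp only [mul_apply_dt]
    obtain ⟨a1, a2⟩ := ih _ q Q (dt p) hq hQ
    obtain ⟨b1, b2⟩ := ih _ (fun z => dt (q z)) (dt Q) p (fun m j β => hq m (j + 1) β)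
      (fun m j β => hQ m (j + 1) β)
    exact ⟨b1.add a1, by rw [a2, b2, circleIntegral.integral_add b1 a1]⟩
  | hh m ih j β =>
    intro q Q p hq hQ
    simp only [mul_apply_dh]
    obtain ⟨a1, a2⟩ := ih _ _ q Q (dh p) hq hQ
    obtain ⟨b1, b2⟩ := ih _ _ (fun z => dh (q z)) (dh Q) p (fun m j β => hq (m + 1) j β)
      (fun m j β => hQ (m + 1) j β)
    obtain ⟨c1, c2⟩ := ih _ _ (fun z => dτ (q z)) (dτ Q) (dt p) (fun m j β => hq m j (β + 1))
      (fun m j β => hQ m j (β + 1))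
    have c3 := c1.clm_comp (Complex.I⁻¹ • ContinuousLinearMap.id ℂ B)
    exact ⟨(b1.add a1).add c3, by
      rw [a2, b2, c2, ← circleIntegral.integral_smul, ← circleIntegral.integral_add b1 a1]
      exact (circleIntegral.integral_add (b1.add a1) c3).symm⟩

end Calculus

end Jet

/-! ### Combinatorial inequalities and the Gevrey estimate for inverses -/

open Finset in
theorem mul_rpow_le_rpow {s : ℝ} (hs : 1 ≤ s) {c x y z : ℕ} (h : c * (x * y) ≤ z) :
    (c : ℝ) * ((x : ℝ) ^ s * (y : ℝ) ^ s) ≤ (z : ℝ) ^ s := by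
  -- Leibniz coefficients occur to the first power and factorials to the power `s`. Since `c` is `0`
  -- or at least `1`, the condition `s ≥ 1` lets `c` be absorbed.
  have hc : (c : ℝ) ≤ (c : ℝ) ^ s := by
    rcases Nat.eq_zero_or_pos c with rfl | hc
    · simpa using Real.rpow_nonneg le_rfl s
    · exact Real.self_le_rpow_of_one_le (by exact_mod_cast hc) hs
  calc (c : ℝ) * ((x : ℝ) ^ s * (y : ℝ) ^ s) ≤ (c : ℝ) ^ s * ((x : ℝ) ^ s * (y : ℝ) ^ s) := by
        gcongr
    _ = ((c * (x * y) : ℕ) : ℝ) ^ s := by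
        rw [← Real.mul_rpow (by positivity) (by positivity),
          ← Real.mul_rpow (by positivity) (by positivity)]
        push_cast; rfl
    _ ≤ (z : ℝ) ^ s := by gcongr; 

/-- A single term of the Vandermonde convolution. -/
theorem choose_mul_choose_le (m β k l : ℕ) :
    m.choose k * β.choose l ≤ (β + m).choose (k + l) := by
  rw [add_comm β m, Nat.add_choose_eq]
  exact Finset.single_le_sum (f := fun x : ℕ × ℕ => m.choose x.1 * β.choose x.2)
    (fun _ _ => Nat.zero_le _) (by simp : (k, l) ∈ Finset.HasAntidiagonal.antidiagonal (k + l))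

theorem sum_antidiagonal_pow_le {w : ℝ} (h0 : 0 ≤ w) (h1 : w ≤ 1 / 2) (n : ℕ) :
    ∑ x ∈ Finset.HasAntidiagonal.antidiagonal n, w ^ x.1 ≤ 1 + 2 * w := by
  rw [Finset.Nat.sum_antidiagonal_eq_sum_range_succ_mk]
  have h2 : ∀ k : ℕ, ∑ i ∈ Finset.range k, w ^ i ≤ 1 + 2 * w := by
    intro k
    have h3 := geom_sum_mul_neg w k
    have h4 : 0 ≤ w ^ k := by positivity
    have h5 : (∑ i ∈ Finset.range k, w ^ i) * (1 - w) ≤ (1 + 2 * w) * (1 - w) := by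
      rw [h3]; nlinarith
    exact le_of_mul_le_mul_right h5 (by linarith)
  exact h2 _

namespace Jet

open Finset

variable {B : Type*} [NormedRing B] [NormedAlgebra ℂ B]

/-- The majorant fits the recursion. A term with `k` powers of `h` moves `k` derivatives in `t` onto
`X` and lowers its order by `k`, so `j + m` is unchanged. On the `τ` side the `k + l` derivatives
taken by `u` and the remaining index add up to `β + m`, and the binomials complete the factorials.
Each derivative falling on `u` or `v` gains a factor `w`; for `w` small the sum of all these terms
does not exceed the bound. -/
theorem norm_le_of_mul_eq_one {s σ : ℝ} (hs : 1 ≤ s) (hσ : 1 ≤ σ) {u v X : Jet B}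
    (hut : dt u = 0) (huh : dh u = 0) (hvτ : dτ v = 0) (hvh : dh v = 0)
    (hX : (u + v) * X = 1) {r : B} (hr : r * (u 0 0 0 + v 0 0 0) = 1)
    {M C w ρ : ℝ} (hC : 0 ≤ C) (hrM : ‖r‖ ≤ M) (hw : 0 ≤ w) (hw1 : w ≤ 1 / 2) (hρ : 0 ≤ ρ)
    (hMC : M * C * (8 * w) ≤ 1)
    (hu : ∀ n, 1 ≤ n → ‖u 0 0 n‖ ≤ C * (w * ρ) ^ n * (n ! : ℝ) ^ σ)
    (hv : ∀ n, 1 ≤ n → ‖v 0 n 0‖ ≤ C * (w * ρ) ^ n * (n ! : ℝ) ^ s) (m j β : ℕ) :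
    ‖X m j β‖ ≤ M * (((j + m)! : ℝ) ^ s * ((β + m)! : ℝ) ^ σ * ρ ^ (2 * m + j + β)) := by
  have hM : 0 ≤ M := (norm_nonneg r).trans hrM
  induction hW : 2 * m + j + β using Nat.strong_induction_on generalizing m j β with
  | _ W ih =>
  subst hW
  rcases Nat.eq_zero_or_pos (2 * m + j + β) with h0 | hpos
  · obtain ⟨rfl, rfl, rfl⟩ : m = 0 ∧ j = 0 ∧ β = 0 := by omega
    have h1 : (u 0 0 0 + v 0 0 0) * X 0 0 0 = 1 := by
      have := congrArg (fun p : Jet B => p 0 0 0) hX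
      simpa [mul_apply_zero, one_def] using this
    have h2 : X 0 0 0 = r := (left_inv_eq_right_inv hr h1).symm
    simpa [h2] using hrM
  set Z : ℝ := ((j + m)! : ℝ) ^ s * ((β + m)! : ℝ) ^ σ * ρ ^ (2 * m + j + β) with hZ
  have hZ0 : 0 ≤ Z := by positivity
  -- the two families of terms
  set U : (ℕ × ℕ) × (ℕ × ℕ) → B := fun x => m.choose x.1.1 • (β.choose x.2.1 •
      (Complex.I⁻¹ ^ x.1.1 • (u 0 0 (x.1.1 + x.2.1) * X x.1.2 (j + x.1.1) x.2.2))) with hU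
  set V : ℕ × ℕ → B := fun x => j.choose x.1 • (v 0 x.1 0 * X m x.2 β) with hV
  have hmem1 : ((0, m), (0, β)) ∈ antidiagonal m ×ˢ antidiagonal β := by simp
  have hmem2 : (0, j) ∈ antidiagonal j := by simp
  have hone : (1 : Jet B) m j β = 0 := by
    rw [one_def, const, if_neg]; omega
  have key : (u 0 0 0 + v 0 0 0) * X m j β =
      -(∑ x ∈ (antidiagonal m ×ˢ antidiagonal β).erase ((0, m), (0, β)), U x
        + ∑ x ∈ (antidiagonal j).erase (0, j), V x) := by
    have h1 : ((u + v) * X) m j β = 0 := by rw [hX, hone]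
    rw [add_mul, add_apply, mul_apply_of_dt_eq_zero m j β u X hut huh,
      mul_apply_of_dτ_eq_zero m j β v X hvτ hvh] at h1
    have h2 : ∑ x ∈ antidiagonal m, m.choose x.1 • ∑ y ∈ antidiagonal β, β.choose y.1 •
        (Complex.I⁻¹ ^ x.1 • (u 0 0 (x.1 + y.1) * X x.2 (j + x.1) y.2))
        = ∑ x ∈ antidiagonal m ×ˢ antidiagonal β, U x := by
      rw [sum_product]
      exact sum_congr rfl fun x _ => by rw [smul_sum]
    rw [h2, ← add_sum_erase _ U hmem1, ← add_sum_erase _ _ hmem2] at h1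
    have h3 : U ((0, m), (0, β)) = u 0 0 0 * X m j β := by simp [hU]
    rw [h3] at h1
    simp only [Nat.choose_zero_right, one_smul] at h1
    rw [add_mul, eq_neg_iff_add_eq_zero, ← h1]
    abel
  have hI : ‖Complex.I⁻¹‖ = 1 := by simp
  have hUle : ∀ x ∈ (antidiagonal m ×ˢ antidiagonal β).erase ((0, m), (0, β)),
      ‖U x‖ ≤ C * M * Z * (w ^ x.1.1 * w ^ x.2.1) := by
    rintro ⟨⟨k, k'⟩, ⟨l, l'⟩⟩ hx
    simp only [mem_erase, mem_product, HasAntidiagonal.mem_antidiagonal, ne_eq, Prod.mk.injEq] at hx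
    obtain ⟨hne, hk, hl⟩ := hx
    have hkl : 1 ≤ k + l := by
      by_contra hcon
      have : k = 0 ∧ l = 0 := by omega
      apply hne; omega
    -- The weight has dropped by exactly `k + l ≥ 1`.
    have hX1 := ih (2 * k' + (j + k) + l') (by omega) k' (j + k) l' rfl
    have hfac : (m.choose k * β.choose l) * ((k + l)! * (l' + k')!) ≤ (β + m)! := by
      calc _ ≤ (β + m).choose (k + l) * ((k + l)! * (l' + k')!) := by
            gcongr; exact choose_mul_choose_le m β k l
        _ = (β + m)! := by
            have := Nat.choose_mul_factorial_mul_factorial (show k + l ≤ β + m by omega)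
            rw [show β + m - (k + l) = l' + k' by omega] at this
            rw [← this]; ring
    have hfac' := mul_rpow_le_rpow hσ hfac
    push_cast at hfac'
    calc ‖U ((k, k'), (l, l'))‖
        ≤ m.choose k * (β.choose l * (‖u 0 0 (k + l)‖ * ‖X k' (j + k) l'‖)) := by
          refine (norm_nsmul_le).trans ?_
          gcongr
          refine (norm_nsmul_le).trans ?_
          gcongr
          rw [norm_smul, norm_pow, hI, one_pow, one_mul]
          exact norm_mul_le _ _
      _ ≤ m.choose k * (β.choose l * ((C * (w * ρ) ^ (k + l) * ((k + l)! : ℝ) ^ σ) *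
          (M * (((j + k + k')! : ℝ) ^ s * ((l' + k')! : ℝ) ^ σ *
            ρ ^ (2 * k' + (j + k) + l'))))) := by
          gcongr
          exact hu _ hkl
      _ = C * M * ((j + m)! : ℝ) ^ s * ρ ^ (2 * m + j + β) * (w ^ k * w ^ l) *
          ((m.choose k * β.choose l) * (((k + l)! : ℝ) ^ σ * ((l' + k')! : ℝ) ^ σ)) := by
          rw [show j + k + k' = j + m by omega,
            show 2 * m + j + β = (2 * k' + (j + k) + l') + (k + l) by omega, mul_pow, pow_add ρ,
            pow_add w]
          ring
      _ ≤ C * M * ((j + m)! : ℝ) ^ s * ρ ^ (2 * m + j + β) * (w ^ k * w ^ l) *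
          ((β + m)! : ℝ) ^ σ := by gcongr
      _ = _ := by rw [hZ]; ring
  have hVle : ∀ x ∈ (antidiagonal j).erase (0, j), ‖V x‖ ≤ C * M * Z * w ^ x.1 := by
    rintro ⟨k, k'⟩ hx
    simp only [mem_erase, HasAntidiagonal.mem_antidiagonal, ne_eq, Prod.mk.injEq] at hx
    obtain ⟨hne, hk⟩ := hx
    have hk1 : 1 ≤ k := by
      by_contra hcon
      apply hne; omega
    have hX1 := ih (2 * m + k' + β) (by omega) m k' β rfl
    have hfac : j.choose k * (k ! * (k' + m)!) ≤ (j + m)! := by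
      calc _ ≤ (j + m).choose k * (k ! * (k' + m)!) := by
            gcongr; exact Nat.le_add_right _ _
        _ = (j + m)! := by
            have := Nat.choose_mul_factorial_mul_factorial (show k ≤ j + m by omega)
            rw [show j + m - k = k' + m by omega] at this
            rw [← this]; ring
    have hfac' := mul_rpow_le_rpow hs hfac
    calc ‖V (k, k')‖ ≤ j.choose k * (‖v 0 k 0‖ * ‖X m k' β‖) := by
          refine (norm_nsmul_le).trans ?_
          gcongr
          exact norm_mul_le _ _
      _ ≤ j.choose k * ((C * (w * ρ) ^ k * (k ! : ℝ) ^ s) *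
          (M * (((k' + m)! : ℝ) ^ s * ((β + m)! : ℝ) ^ σ * ρ ^ (2 * m + k' + β)))) := by
          gcongr
          exact hv _ hk1
      _ = C * M * ((β + m)! : ℝ) ^ σ * ρ ^ (2 * m + j + β) * w ^ k *
          (j.choose k * ((k ! : ℝ) ^ s * ((k' + m)! : ℝ) ^ s)) := by
          rw [show 2 * m + j + β = (2 * m + k' + β) + k by omega, mul_pow, pow_add ρ]
          ring
      _ ≤ C * M * ((β + m)! : ℝ) ^ σ * ρ ^ (2 * m + j + β) * w ^ k * ((j + m)! : ℝ) ^ s := by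
          gcongr
      _ = _ := by rw [hZ]; ring
  -- The product of the two geometric sums is at most `(1 + 2w)²`; removing the leading `1` leaves
  -- `4w + 4w² ≤ 6w`, as `w ≤ 1/2`.
  have hsumU : ∑ x ∈ (antidiagonal m ×ˢ antidiagonal β).erase ((0, m), (0, β)),
      w ^ x.1.1 * w ^ x.2.1 ≤ 6 * w := by
    have h1 := add_sum_erase _ (fun x : (ℕ × ℕ) × (ℕ × ℕ) => w ^ x.1.1 * w ^ x.2.1) hmem1
    rw [sum_product' (antidiagonal m) (antidiagonal β) (fun x y => w ^ x.1 * w ^ y.1),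
      ← sum_mul_sum] at h1
    have h2 := sum_antidiagonal_pow_le hw hw1 m
    have h3 := sum_antidiagonal_pow_le hw hw1 β
    have h4 : (∑ x ∈ antidiagonal m, w ^ x.1) * ∑ x ∈ antidiagonal β, w ^ x.1
        ≤ (1 + 2 * w) * (1 + 2 * w) := by gcongr
    simp only [pow_zero, mul_one] at h1
    nlinarith
  have hsumV : ∑ x ∈ (antidiagonal j).erase (0, j), w ^ x.1 ≤ 2 * w := by
    have h1 := add_sum_erase _ (fun x : ℕ × ℕ => w ^ x.1) hmem2
    have h2 := sum_antidiagonal_pow_le hw hw1 j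
    simp only [pow_zero] at h1
    linarith
  have hXeq : X m j β = r * ((u 0 0 0 + v 0 0 0) * X m j β) := by rw [← mul_assoc, hr, one_mul]
  rw [hXeq, key]
  calc _ ≤ ‖r‖ * ‖-(∑ x ∈ (antidiagonal m ×ˢ antidiagonal β).erase ((0, m), (0, β)), U x
        + ∑ x ∈ (antidiagonal j).erase (0, j), V x)‖ := norm_mul_le _ _
    _ ≤ M * (C * M * Z * (6 * w) + C * M * Z * (2 * w)) := by
        rw [norm_neg]
        gcongr
        refine (norm_add_le _ _).trans (add_le_add ?_ ?_)
        · refine (norm_sum_le_of_le _ hUle).trans ?_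
          rw [← mul_sum]
          gcongr
        · refine (norm_sum_le_of_le _ hVle).trans ?_
          rw [← mul_sum]
          gcongr
    _ = M * Z * (M * C * (8 * w)) := by ring
    _ ≤ M * Z * 1 := by gcongr
    _ = M * Z := mul_one _

end Jet

/-! ### Smooth families of jets and derivatives of inverses -/

theorem ContDiffOn.iteratedDerivWithin_infty {F : Type*} [NormedAddCommGroup F] [NormedSpace ℝ F]
    {f : ℝ → F} {s : Set ℝ} (hs : UniqueDiffOn ℝ s) (hf : ContDiffOn ℝ ∞ f s) (j : ℕ) :
    ContDiffOn ℝ ∞ (iteratedDerivWithin j f s) s := by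
  induction j with
  | zero => simpa using hf
  | succ j ih =>
    rw [iteratedDerivWithin_succ]
    exact ((contDiffOn_infty_iff_derivWithin hs).1 ih).2

theorem ContDiff.iteratedDeriv_infty {F : Type*} [NormedAddCommGroup F] [NormedSpace ℝ F]
    {f : ℝ → F} (hf : ContDiff ℝ ∞ f) (j : ℕ) : ContDiff ℝ ∞ (iteratedDeriv j f) := by
  rw [iteratedDeriv_eq_iterate]
  exact hf.iterate_deriv j

theorem ContDiffOn.hasDerivWithinAt_iteratedDerivWithin {F : Type*} [NormedAddCommGroup F]
    [NormedSpace ℝ F] {f : ℝ → F} {s : Set ℝ} (hs : UniqueDiffOn ℝ s) (hf : ContDiffOn ℝ ∞ f s)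
    (j : ℕ) {t : ℝ} (ht : t ∈ s) :
    HasDerivWithinAt (iteratedDerivWithin j f s) (iteratedDerivWithin (j + 1) f s t) s t := by
  rw [iteratedDerivWithin_succ]
  exact (((hf.iteratedDerivWithin_infty hs j).differentiableOn (by simp)) t ht).hasDerivWithinAt

theorem ContDiff.hasDerivAt_iteratedDeriv {F : Type*} [NormedAddCommGroup F]
    [NormedSpace ℝ F] {f : ℝ → F} (hf : ContDiff ℝ ∞ f) (j : ℕ) (t : ℝ) :
    HasDerivAt (iteratedDeriv j f) (iteratedDeriv (j + 1) f t) t := by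
  rw [iteratedDeriv_succ]
  exact (((hf.iteratedDeriv_infty j).differentiable (by simp)) t).hasDerivAt

section Subalgebras

variable (B : Type*) [NormedRing B] [NormedAlgebra ℂ B]

/-- The algebra of functions which are smooth on a given set. -/
def smoothSubalgebra {X : Type*} [NormedAddCommGroup X] [NormedSpace ℝ X] (Ω : Set X) :
    Subalgebra ℂ (X → B) where
  carrier := {f | ContDiffOn ℝ ∞ f Ω}
  mul_mem' hf hg := ContDiffOn.mul hf hg
  add_mem' hf hg := ContDiffOn.add hf hg
  algebraMap_mem' c := contDiffOn_const (c := algebraMap ℂ B c)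

/-- The algebra of functions which are holomorphic on a given set. -/
def holomorphicSubalgebra (U : Set ℂ) : Subalgebra ℂ (ℂ → B) where
  carrier := {f | DifferentiableOn ℂ f U}
  mul_mem' hf hg := DifferentiableOn.mul hf hg
  add_mem' hf hg := DifferentiableOn.add hf hg
  algebraMap_mem' c := differentiableOn_const (c := algebraMap ℂ B c)

end Subalgebras

namespace Jet

variable {B : Type*} [NormedRing B] [NormedAlgebra ℂ B]

/-- The analytic derivative `q'` and the formal one `D (q x)` solve the same equation, obtained by
differentiating `p q = 1` in the two senses. Left multiplication by `q x` cancels `p x`, so they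
coincide. -/
theorem hasDerivWithinAt_of_mul_eq_one {s : Set ℝ} {x : ℝ} (hs : UniqueDiffWithinAt ℝ s x)
    (hx : x ∈ s)
    {D : Jet B → Jet B} (hD : ∀ p q, D (p * q) = D p * q + p * D q) (hD1 : D 1 = 0)
    {p q : ℝ → Jet B}
    (hp : ∀ m j β, HasDerivWithinAt (fun y => p y m j β) (D (p x) m j β) s x)
    (hq : ∀ m j β, DifferentiableWithinAt ℝ (fun y => q y m j β) s x)
    (hpq : ∀ᶠ y in 𝓝[s] x, p y * q y = 1) (hqp : q x * p x = 1) (m j β : ℕ) :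
    HasDerivWithinAt (fun y => q y m j β) (D (q x) m j β) s x := by
  set q' : Jet B := fun m j β => derivWithin (fun y => q y m j β) s x with hq'
  have hq1 : ∀ m j β, HasDerivWithinAt (fun y => q y m j β) (q' m j β) s x :=
    fun m j β => (hq m j β).hasDerivWithinAt
  have hx1 : p x * q x = 1 := hpq.self_of_nhdsWithin hx
  have h1 : D (p x) * q x + p x * q' = 0 := by
    ext m j β
    have h2 := hasDerivWithinAt_mul m j β p q _ q' hp hq1
    have h3 : HasDerivWithinAt (fun y => (p y * q y) m j β) 0 s x :=
      (hasDerivWithinAt_const x s ((1 : Jet B) m j β)).congr_of_eventuallyEq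
        (hpq.mono fun y hy => by simp only [hy]) (by simp only [hx1])
    exact hs.eq_deriv _ h2 h3
  have h4 : D (p x) * q x + p x * D (q x) = 0 := by rw [← hD, hx1, hD1]
  have h5 : q' = D (q x) := by
    have h6 : p x * q' = p x * D (q x) := add_left_cancel (h1.trans h4.symm)
    calc q' = q x * p x * q' := by rw [hqp, one_mul]
      _ = q x * p x * D (q x) := by rw [mul_assoc, h6, mul_assoc]
      _ = D (q x) := by rw [hqp, one_mul]
  rw [← h5]
  exact hq1 m j β

end Jet

/-! ### The symbol `z - a(τ) - P(t)` and its inverse in the jet algebra -/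

section Symbols

open Jet

variable {B : Type*} [NormedRing B] [NormedAlgebra ℂ B]

/-- The jets of the multiple `a(τ) e` of `e`. -/
def tauJet (e : B) (a : ℝ → ℝ) (τ : ℝ) : Jet B :=
  fun m j β => if m = 0 ∧ j = 0 then iteratedDeriv β a τ • e else 0

/-- The jets of `P(t)`. -/
def timeJet (P : ℝ → B) (t : ℝ) : Jet B :=
  fun m j β => if m = 0 ∧ β = 0 then iteratedDerivWithin j P (Icc 0 1) t else 0

/-- The jets of the sum `a(τ) + P(t)`. -/
def hamJet (e : B) (a : ℝ → ℝ) (P : ℝ → B) (t τ : ℝ) : Jet B := tauJet e a τ + timeJet P t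

/-- The jets of `z - a(τ) - P(t)`. -/
def symJet (e : B) (a : ℝ → ℝ) (P : ℝ → B) (t τ : ℝ) (z : ℂ) : Jet B :=
  z • const e - hamJet e a P t τ

/-- The jets of the parametrix. -/
def solJet (e : B) (a : ℝ → ℝ) (P : ℝ → B) (t τ : ℝ) (z : ℂ) : Jet B := inv (symJet e a P t τ z)

/-- The set where `z - a(τ) - P(t)` is invertible. -/
def unitSet (e : B) (a : ℝ → ℝ) (P : ℝ → B) : Set (ℝ × ℝ × ℂ) :=
  {x | x.1 ∈ Icc (0 : ℝ) 1 ∧ IsUnit ((x.2.2 - (a x.2.1 : ℂ)) • e - P x.1)}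

variable {e : B} {a : ℝ → ℝ} {P : ℝ → B}

theorem symJet_zero (t τ : ℝ) (z : ℂ) :
    symJet e a P t τ z 0 0 0 = (z - (a τ : ℂ)) • e - P t := by
  simp [symJet, hamJet, tauJet, timeJet, sub_smul, sub_sub]

theorem mem_unitSet {t τ : ℝ} {z : ℂ} :
    (t, τ, z) ∈ unitSet e a P ↔ t ∈ Icc (0 : ℝ) 1 ∧ IsUnit (symJet e a P t τ z 0 0 0) := by
  rw [symJet_zero]; rfl

theorem sym_mul_sol {t τ : ℝ} {z : ℂ} (h : (t, τ, z) ∈ unitSet e a P) :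
    symJet e a P t τ z * solJet e a P t τ z = 1 := mul_inv (mem_unitSet.1 h).2

theorem sol_mul_sym {t τ : ℝ} {z : ℂ} (h : (t, τ, z) ∈ unitSet e a P) :
    solJet e a P t τ z * symJet e a P t τ z = 1 := inv_mul (mem_unitSet.1 h).2

theorem contDiffOn_symJet (ha : ContDiff ℝ ∞ a) (hP : ContDiffOn ℝ ∞ P (Icc 0 1)) (m j β : ℕ) :
    ContDiffOn ℝ ∞ (fun x : ℝ × ℝ × ℂ => symJet e a P x.1 x.2.1 x.2.2 m j β)
      {x | x.1 ∈ Icc (0 : ℝ) 1} := by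
  have h1 : ContDiffOn ℝ ∞ (fun x : ℝ × ℝ × ℂ => (x.2.2 • const e : Jet B) m j β)
      {x | x.1 ∈ Icc (0 : ℝ) 1} := by
    simp only [Jet.smul_apply]
    exact (contDiff_snd.comp contDiff_snd).contDiffOn.smul contDiffOn_const
  have h2 : ContDiffOn ℝ ∞ (fun x : ℝ × ℝ × ℂ => tauJet e a x.2.1 m j β)
      {x | x.1 ∈ Icc (0 : ℝ) 1} := by
    by_cases h : m = 0 ∧ j = 0
    · simp only [tauJet, h, and_self, if_true]
      exact (((ha.iteratedDeriv_infty β).comp (contDiff_fst.comp contDiff_snd)).smul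
        contDiff_const).contDiffOn
    · simp only [tauJet, h, if_false]
      exact contDiffOn_const
  have h3 : ContDiffOn ℝ ∞ (fun x : ℝ × ℝ × ℂ => timeJet P x.1 m j β)
      {x | x.1 ∈ Icc (0 : ℝ) 1} := by
    by_cases h : m = 0 ∧ β = 0
    · simp only [timeJet, h, and_self, if_true]
      exact (hP.iteratedDerivWithin_infty (uniqueDiffOn_Icc one_pos) j).comp
        contDiff_fst.contDiffOn (fun x hx => hx)
    · simp only [timeJet, h, if_false]
      exact contDiffOn_const
  exact h1.sub (h2.add h3)

theorem eventually_mem_unitSet [CompleteSpace B] (ha : ContDiff ℝ ∞ a)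
    (hP : ContDiffOn ℝ ∞ P (Icc 0 1))
    {x : ℝ × ℝ × ℂ} (hx : x ∈ unitSet e a P) :
    ∀ᶠ y in 𝓝[{x | x.1 ∈ Icc (0 : ℝ) 1}] x, y ∈ unitSet e a P := by
  have h1 := ((contDiffOn_symJet (e := e) ha hP 0 0 0).continuousOn x hx.1)
  have h2 : {b : B | IsUnit b} ∈ 𝓝 (symJet e a P x.1 x.2.1 x.2.2 0 0 0) :=
    Units.isOpen.mem_nhds (mem_unitSet.1 hx).2
  filter_upwards [h1 h2, self_mem_nhdsWithin] with y hy hy2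
  exact mem_unitSet.2 ⟨hy2, hy⟩

theorem contDiffOn_solJet [CompleteSpace B] (ha : ContDiff ℝ ∞ a)
    (hP : ContDiffOn ℝ ∞ P (Icc 0 1)) (m j β : ℕ) :
    ContDiffOn ℝ ∞ (fun x : ℝ × ℝ × ℂ => solJet e a P x.1 x.2.1 x.2.2 m j β) (unitSet e a P) := by
  have h0 : unitSet e a P ⊆ {x | x.1 ∈ Icc (0 : ℝ) 1} := fun x hx => hx.1
  refine inv_mem (smoothSubalgebra B (unitSet e a P))
    (fun x => symJet e a P x.1 x.2.1 x.2.2) (fun m j β => (contDiffOn_symJet ha hP m j β).mono h0)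
    ?_ m j β
  intro x hx
  obtain ⟨u, hu⟩ := (mem_unitSet.1 hx).2
  have h1 := contDiffAt_ringInverse ℝ (n := ∞) u
  rw [hu] at h1
  exact h1.comp_contDiffWithinAt x ((contDiffOn_symJet ha hP 0 0 0).mono h0 x hx)

theorem differentiableOn_solJet [CompleteSpace B] (t τ : ℝ) (m j β : ℕ) :
    DifferentiableOn ℂ (fun z => solJet e a P t τ z m j β) {z | (t, τ, z) ∈ unitSet e a P} := by
  have h0 : ∀ m j β, DifferentiableOn ℂ (fun z => symJet e a P t τ z m j β)
      {z | (t, τ, z) ∈ unitSet e a P} := fun m j β => by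
    simp only [symJet, Jet.sub_apply, Jet.smul_apply]
    exact ((differentiable_fun_id.smul_const (const e m j β)).sub_const _).differentiableOn
  refine inv_mem (holomorphicSubalgebra B {z | (t, τ, z) ∈ unitSet e a P})
    (fun z => symJet e a P t τ z) h0 ?_ m j β
  intro z hz
  obtain ⟨u, hu⟩ := (mem_unitSet.1 hz).2
  have h1 := (contDiffAt_ringInverse ℂ (n := 1) u).differentiableAt (by simp)
  rw [hu] at h1
  exact h1.comp_differentiableWithinAt z (h0 0 0 0 z hz)

theorem hasDerivWithinAt_symJet_time (hP : ContDiffOn ℝ ∞ P (Icc 0 1)) {t : ℝ}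
    (ht : t ∈ Icc (0 : ℝ) 1) (τ : ℝ) (z : ℂ) (m j β : ℕ) :
    HasDerivWithinAt (fun t' => symJet e a P t' τ z m j β) (dt (symJet e a P t τ z) m j β)
      (Icc 0 1) t := by
  have h1 : HasDerivWithinAt (fun t' => timeJet P t' m j β) (timeJet P t m (j + 1) β)
      (Icc 0 1) t := by
    by_cases h : m = 0 ∧ β = 0
    · simp only [timeJet, h, and_self, if_true]
      exact hP.hasDerivWithinAt_iteratedDerivWithin (uniqueDiffOn_Icc one_pos) j ht
    · simp only [timeJet, h, if_false]
      exact hasDerivWithinAt_const _ _ _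
  have h2 : dt (symJet e a P t τ z) m j β = -(timeJet P t m (j + 1) β) := by
    simp [symJet, hamJet, tauJet, const]
  rw [h2]
  simpa [symJet, hamJet] using (h1.const_add (tauJet e a τ m j β)).const_sub (z • const e m j β)

theorem hasDerivAt_symJet_freq (ha : ContDiff ℝ ∞ a) (t τ : ℝ) (z : ℂ) (m j β : ℕ) :
    HasDerivAt (fun τ' => symJet e a P t τ' z m j β) (dτ (symJet e a P t τ z) m j β) τ := by
  have h1 : HasDerivAt (fun τ' => tauJet e a τ' m j β) (tauJet e a τ m j (β + 1)) τ := by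
    by_cases h : m = 0 ∧ j = 0
    · simp only [tauJet, h, and_self, if_true]
      exact (ha.hasDerivAt_iteratedDeriv β τ).smul_const e
    · simp only [tauJet, h, if_false]
      exact hasDerivAt_const _ _
  have h2 : dτ (symJet e a P t τ z) m j β = -(tauJet e a τ m j (β + 1)) := by
    simp [symJet, hamJet, timeJet, const]
  rw [h2]
  simpa [symJet, hamJet] using (h1.add_const (timeJet P t m j β)).const_sub (z • const e m j β)

theorem hasDerivWithinAt_solJet_time [CompleteSpace B] (ha : ContDiff ℝ ∞ a)
    (hP : ContDiffOn ℝ ∞ P (Icc 0 1)) {t τ : ℝ} {z : ℂ} (h : (t, τ, z) ∈ unitSet e a P)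
    (m j β : ℕ) :
    HasDerivWithinAt (fun t' => solJet e a P t' τ z m j β) (solJet e a P t τ z m (j + 1) β)
      (Icc 0 1) t := by
  have ht : t ∈ Icc (0 : ℝ) 1 := h.1
  have htend : Filter.Tendsto (fun t' : ℝ => (t', τ, z)) (𝓝[Icc 0 1] t)
      (𝓝[{x | x.1 ∈ Icc (0 : ℝ) 1}] (t, τ, z)) :=
    ((Continuous.prodMk_left (τ, z)).continuousWithinAt).tendsto_nhdsWithin (fun y hy => hy)
  have hev : ∀ᶠ y in 𝓝[Icc 0 1] t, (y, τ, z) ∈ unitSet e a P :=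
    htend.eventually (eventually_mem_unitSet ha hP h)
  refine hasDerivWithinAt_of_mul_eq_one (D := dt) (uniqueDiffOn_Icc one_pos t ht) ht dt_mul dt_one
    (p := fun t' => symJet e a P t' τ z) (q := fun t' => solJet e a P t' τ z)
    (hasDerivWithinAt_symJet_time hP ht τ z) (fun m j β => ?_)
    (hev.mono fun y hy => sym_mul_sol hy) (sol_mul_sym h) m j β
  have h1 : DifferentiableWithinAt ℝ (fun x : ℝ × ℝ × ℂ => solJet e a P x.1 x.2.1 x.2.2 m j β)
      (unitSet e a P) (t, τ, z) :=
    ((contDiffOn_solJet ha hP m j β) _ h).differentiableWithinAt (by simp)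
  have h2 : DifferentiableWithinAt ℝ (fun x : ℝ × ℝ × ℂ => solJet e a P x.1 x.2.1 x.2.2 m j β)
      {x | x.1 ∈ Icc (0 : ℝ) 1} (t, τ, z) :=
    h1.mono_of_mem_nhdsWithin (eventually_mem_unitSet ha hP h)
  exact h2.comp t (f := fun t' : ℝ => (t', τ, z)) (by fun_prop) (fun y hy => hy)

theorem hasDerivAt_solJet_freq [CompleteSpace B] (ha : ContDiff ℝ ∞ a)
    (hP : ContDiffOn ℝ ∞ P (Icc 0 1)) {t τ : ℝ} {z : ℂ} (h : (t, τ, z) ∈ unitSet e a P)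
    (m j β : ℕ) :
    HasDerivAt (fun τ' => solJet e a P t τ' z m j β) (solJet e a P t τ z m j (β + 1)) τ := by
  have ht : t ∈ Icc (0 : ℝ) 1 := h.1
  have htend : Filter.Tendsto (fun τ' : ℝ => (t, τ', z)) (𝓝[univ] τ)
      (𝓝[{x | x.1 ∈ Icc (0 : ℝ) 1}] (t, τ, z)) :=
    (Continuous.continuousWithinAt (by fun_prop)).tendsto_nhdsWithin (fun y hy => ht)
  have hev : ∀ᶠ y in 𝓝[univ] τ, (t, y, z) ∈ unitSet e a P :=
    htend.eventually (eventually_mem_unitSet ha hP h)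
  rw [← hasDerivWithinAt_univ]
  refine hasDerivWithinAt_of_mul_eq_one (D := dτ) uniqueDiffWithinAt_univ (mem_univ τ) dτ_mul dτ_one
    (p := fun τ' => symJet e a P t τ' z) (q := fun τ' => solJet e a P t τ' z)
    (fun m j β => (hasDerivAt_symJet_freq ha t τ z m j β).hasDerivWithinAt) (fun m j β => ?_)
    (hev.mono fun y hy => sym_mul_sol hy) (sol_mul_sym h) m j β
  have h1 : DifferentiableWithinAt ℝ (fun x : ℝ × ℝ × ℂ => solJet e a P x.1 x.2.1 x.2.2 m j β)
      (unitSet e a P) (t, τ, z) :=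
    ((contDiffOn_solJet ha hP m j β) _ h).differentiableWithinAt (by simp)
  have h2 : DifferentiableWithinAt ℝ (fun x : ℝ × ℝ × ℂ => solJet e a P x.1 x.2.1 x.2.2 m j β)
      {x | x.1 ∈ Icc (0 : ℝ) 1} (t, τ, z) :=
    h1.mono_of_mem_nhdsWithin (eventually_mem_unitSet ha hP h)
  exact h2.comp τ (f := fun τ' : ℝ => (t, τ', z)) (by fun_prop) (fun y hy => ht)

/-- The resolvent identity: two symbols differ by `(w - z) e`, which is constant in `(t, τ)`. All
orders in `h` are treated at once. -/
theorem sol_sub_sol {t τ : ℝ} {z w : ℂ} (hz : (t, τ, z) ∈ unitSet e a P)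
    (hw : (t, τ, w) ∈ unitSet e a P) :
    solJet e a P t τ z - solJet e a P t τ w
      = (w - z) • (solJet e a P t τ z * const e * solJet e a P t τ w) := by
  have h1 : symJet e a P t τ w - symJet e a P t τ z = (w - z) • const e := by
    rw [symJet, symJet, sub_sub_sub_cancel_right, sub_smul]
  calc _ = solJet e a P t τ z * (symJet e a P t τ w - symJet e a P t τ z) * solJet e a P t τ w := by
        rw [mul_sub, sub_mul, sol_mul_sym hz, mul_assoc, sym_mul_sol hw, mul_one, one_mul]
    _ = _ := by rw [h1, mul_smul_comm, smul_mul_assoc]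

/-- Writing the Hamiltonian as `z e` minus the symbol turns both sides into `z e S e - e`. The
factors `e` stand for the inclusion of `D` into `H`. -/
theorem ham_mul_sol_mul_const {t τ : ℝ} {z : ℂ} (hz : (t, τ, z) ∈ unitSet e a P) :
    hamJet e a P t τ * solJet e a P t τ z * const e
      = const e * solJet e a P t τ z * hamJet e a P t τ := by
  have h1 : hamJet e a P t τ = z • const e - symJet e a P t τ z := by rw [symJet, sub_sub_cancel]
  rw [h1, sub_mul, sym_mul_sol hz, mul_sub, mul_assoc (const e) _ (symJet e a P t τ z),
    sol_mul_sym hz, sub_mul, mul_smul_comm, smul_mul_assoc, smul_mul_assoc, one_mul, mul_one]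

end Symbols

/-! ### Differentiation under the integral and smoothness from partial derivatives -/

section RealAnalysis

variable {E : Type*} [NormedAddCommGroup E] [NormedSpace ℝ E]

/-- The set `V` is only relatively open in `s`, since the symbols are controlled on the elliptic set
alone. -/
theorem iteratedDerivWithin_eq_of_chain {s V : Set ℝ} (hs : UniqueDiffOn ℝ s) (hVs : V ⊆ s)
    (hV : ∀ t ∈ V, V ∈ 𝓝[s] t) {f : ℝ → E} {F : ℕ → ℝ → E} (hf : ∀ t ∈ V, f t = F 0 t)
    (hF : ∀ j, ∀ t ∈ V, HasDerivWithinAt (F j) (F (j + 1) t) s t) (j : ℕ) {t : ℝ} (ht : t ∈ V) :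
    iteratedDerivWithin j f s t = F j t := by
  induction j generalizing t with
  | zero => simpa using hf t ht
  | succ j ih =>
    have h1 : iteratedDerivWithin j f s =ᶠ[𝓝[s] t] F j := by
      filter_upwards [hV t ht] with y hy using ih hy
    rw [iteratedDerivWithin_succ, h1.derivWithin_eq (ih ht)]
    exact (hF j t ht).derivWithin (hs t (hVs ht))

theorem iteratedDeriv_eq_of_chain {V : Set ℝ} (hV : ∀ t ∈ V, V ∈ 𝓝 t) {f : ℝ → E}
    {F : ℕ → ℝ → E} (hf : ∀ t ∈ V, f t = F 0 t)
    (hF : ∀ j, ∀ t ∈ V, HasDerivAt (F j) (F (j + 1) t) t) (j : ℕ) {t : ℝ} (ht : t ∈ V) :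
    iteratedDeriv j f t = F j t := by
  rw [← iteratedDerivWithin_univ]
  exact iteratedDerivWithin_eq_of_chain uniqueDiffOn_univ (subset_univ V)
    (fun y hy => by rw [nhdsWithin_univ]; exact hV y hy) hf
    (fun j y hy => (hF j y hy).hasDerivWithinAt) j ht

theorem eventually_norm_sub_le_of_continuousOn {X : Type*} [TopologicalSpace X] {s : Set X} {x₀ : X}
    (hx : x₀ ∈ s) {a b : ℝ} {g : X → ℝ → E}
    (hg : ContinuousOn (Function.uncurry g) (s ×ˢ Icc a b)) {ε : ℝ} (hε : 0 < ε) :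
    ∀ᶠ x in 𝓝[s] x₀, ∀ θ ∈ Icc a b, ‖g x θ - g x₀ θ‖ ≤ ε := by
  obtain ⟨v, hv, h⟩ := isCompact_Icc.mem_uniformity_of_prod hg hx (Metric.dist_mem_uniformity hε)
  filter_upwards [hv] with x hx θ hθ
  have := h x hx θ hθ
  rw [← dist_eq_norm]
  exact le_of_lt this

theorem continuousOn_intervalIntegral {X : Type*} [TopologicalSpace X] {s : Set X} {a b : ℝ}
    (hab : a ≤ b) {g : X → ℝ → E} (hg : ContinuousOn (Function.uncurry g) (s ×ˢ Icc a b)) :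
    ContinuousOn (fun x => ∫ θ in a..b, g x θ) s := by
  intro x₀ hx
  have hint : ∀ x ∈ s, IntervalIntegrable (g x) volume a b := fun x hx => by
    refine ContinuousOn.intervalIntegrable_of_Icc hab ?_
    exact hg.comp (f := fun θ => (x, θ)) (by fun_prop) (fun θ hθ => ⟨hx, hθ⟩)
  rw [ContinuousWithinAt, Metric.tendsto_nhds]
  intro ε hε
  -- The added `1` covers the degenerate interval `a = b` and makes the final inequality strict.
  have hba : 0 < b - a + 1 := by linarith
  filter_upwards [eventually_norm_sub_le_of_continuousOn hx hg (div_pos hε hba),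
    self_mem_nhdsWithin] with x h hxs
  rw [dist_eq_norm, ← intervalIntegral.integral_sub (hint x hxs) (hint x₀ hx)]
  refine (intervalIntegral.norm_integral_le_of_norm_le_const (C := ε / (b - a + 1))
    fun θ hθ => ?_).trans_lt ?_
  · rw [uIoc_of_le hab] at hθ
    exact h θ ⟨hθ.1.le, hθ.2⟩
  · rw [abs_of_nonneg (by linarith), div_mul_eq_mul_div, div_lt_iff₀ hba]
    nlinarith

/-- Differentiation under the integral sign, for a parameter in a convex set. -/
theorem hasDerivWithinAt_intervalIntegral {s : Set ℝ} (hs : Convex ℝ s) {x₀ : ℝ} (hx : x₀ ∈ s)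
    {a b : ℝ} (hab : a ≤ b) {g g' : ℝ → ℝ → E}
    (hg : ∀ x ∈ s, ContinuousOn (g x) (Icc a b))
    (hd : ∀ x ∈ s, ∀ θ ∈ Icc a b, HasDerivWithinAt (fun y => g y θ) (g' x θ) s x)
    (hg' : ContinuousOn (Function.uncurry g') (s ×ˢ Icc a b)) :
    HasDerivWithinAt (fun x => ∫ θ in a..b, g x θ) (∫ θ in a..b, g' x₀ θ) s x₀ := by
  have hint : ∀ x ∈ s, IntervalIntegrable (g x) volume a b := fun x hx =>
    (hg x hx).intervalIntegrable_of_Icc hab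
  have hint' : IntervalIntegrable (g' x₀) volume a b :=
    ContinuousOn.intervalIntegrable_of_Icc hab
      (hg'.comp (f := fun θ => (x₀, θ)) (by fun_prop) (fun θ hθ => ⟨hx, hθ⟩))
  rw [hasDerivWithinAt_iff_isLittleO, Asymptotics.isLittleO_iff]
  intro ε hε
  have hba : 0 < b - a + 1 := by linarith
  obtain ⟨δ, hδ, hball⟩ := Metric.mem_nhdsWithin_iff.1
    (eventually_norm_sub_le_of_continuousOn hx hg' (div_pos hε hba))
  filter_upwards [inter_mem_nhdsWithin s (Metric.ball_mem_nhds x₀ hδ)] with x hxs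
  have hconv : Convex ℝ (s ∩ Metric.ball x₀ δ) := hs.inter (convex_ball _ _)
  have hpt : ∀ θ ∈ Icc a b, ‖g x θ - g x₀ θ - (x - x₀) • g' x₀ θ‖ ≤ ε / (b - a + 1) * ‖x - x₀‖ := by
    intro θ hθ
    have h1 : ∀ y ∈ s ∩ Metric.ball x₀ δ, HasDerivWithinAt (fun y => g y θ - y • g' x₀ θ)
        (g' y θ - g' x₀ θ) (s ∩ Metric.ball x₀ δ) y := fun y hy => by
      have h2 := ((hasDerivWithinAt_id y s).smul_const (g' x₀ θ))
      rw [one_smul] at h2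
      exact ((hd y hy.1 θ hθ).sub h2).mono inter_subset_left
    have h3 := hconv.norm_image_sub_le_of_norm_hasDerivWithin_le h1
      (fun y hy => hball ⟨hy.2, hy.1⟩ θ hθ) ⟨hx, Metric.mem_ball_self hδ⟩ hxs
    convert h3 using 2
    rw [sub_smul]; abel
  have hint'' : IntervalIntegrable (fun θ => (x - x₀) • g' x₀ θ) volume a b := hint'.smul (x - x₀)
  have hsub : IntervalIntegrable (fun θ => g x θ - g x₀ θ) volume a b :=
    (hint x hxs.1).sub (hint x₀ hx)
  rw [← intervalIntegral.integral_sub (hint x hxs.1) (hint x₀ hx),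
    ← intervalIntegral.integral_smul, ← intervalIntegral.integral_sub hsub hint'']
  refine (intervalIntegral.norm_integral_le_of_norm_le_const (C := ε / (b - a + 1) * ‖x - x₀‖)
    fun θ hθ => ?_).trans ?_
  · rw [uIoc_of_le hab] at hθ
    exact hpt θ ⟨hθ.1.le, hθ.2⟩
  · rw [abs_of_nonneg (by linarith), div_mul_eq_mul_div, div_mul_eq_mul_div, div_le_iff₀ hba]
    have : 0 ≤ ε * ‖x - x₀‖ := by positivity
    nlinarith

-- The increment is split at `(u.1, v.2)`. The first piece needs the mean value inequality at
-- varying `τ`, hence continuity of `f₁`; the second is the mere derivative in `τ` at the fixed time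
-- `u.1`.
open Asymptotics Filter in
theorem hasFDerivWithinAt_of_partials {s : Set ℝ} (hs : Convex ℝ s) {f f₁ f₂ : ℝ → ℝ → E}
    (h₁ : ∀ t ∈ s, ∀ τ, HasDerivWithinAt (fun t' => f t' τ) (f₁ t τ) s t)
    (h₂ : ∀ t ∈ s, ∀ τ, HasDerivAt (fun τ' => f t τ') (f₂ t τ) τ)
    (hc : ContinuousOn (Function.uncurry f₁) (s ×ˢ univ)) {u : ℝ × ℝ} (hu : u.1 ∈ s) :
    HasFDerivWithinAt (Function.uncurry f)
      ((ContinuousLinearMap.fst ℝ ℝ ℝ).smulRight (f₁ u.1 u.2)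
        + (ContinuousLinearMap.snd ℝ ℝ ℝ).smulRight (f₂ u.1 u.2)) (s ×ˢ univ) u := by
  rw [hasFDerivWithinAt_iff_isLittleO]
  have hsnd : Tendsto Prod.snd (𝓝[s ×ˢ (univ : Set ℝ)] u) (𝓝 u.2) :=
    (continuous_snd.tendsto u).mono_left nhdsWithin_le_nhds
  have e1 : (fun v : ℝ × ℝ => f v.1 v.2 - f u.1 v.2 - (v.1 - u.1) • f₁ u.1 u.2)
      =o[𝓝[s ×ˢ (univ : Set ℝ)] u] (fun v => v.1 - u.1) := by
    rw [isLittleO_iff]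
    intro ε hε
    have h3 := (Metric.tendsto_nhds.1 (hc u ⟨hu, mem_univ _⟩)) ε hε
    obtain ⟨δ, hδ, hball⟩ := Metric.mem_nhdsWithin_iff.1 h3
    filter_upwards [inter_mem_nhdsWithin (s ×ˢ (univ : Set ℝ)) (Metric.ball_mem_nhds u hδ)]
      with v hv
    have hv2 : max (dist v.1 u.1) (dist v.2 u.2) < δ := hv.2
    have h4 : ∀ x ∈ s ∩ Metric.ball u.1 δ, HasDerivWithinAt (fun x => f x v.2 - x • f₁ u.1 u.2)
        (f₁ x v.2 - f₁ u.1 u.2) (s ∩ Metric.ball u.1 δ) x := fun x hx => by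
      have h5 := ((hasDerivWithinAt_id x s).smul_const (f₁ u.1 u.2))
      rw [one_smul] at h5
      exact ((h₁ x hx.1 v.2).sub h5).mono inter_subset_left
    have h6 : ∀ x ∈ s ∩ Metric.ball u.1 δ, ‖f₁ x v.2 - f₁ u.1 u.2‖ ≤ ε := fun x hx => by
      have h7 : (x, v.2) ∈ Metric.ball u δ ∩ s ×ˢ (univ : Set ℝ) :=
        ⟨max_lt hx.2 (lt_of_le_of_lt (le_max_right _ _) hv2), hx.1, mem_univ _⟩
      have h8 : dist (f₁ x v.2) (f₁ u.1 u.2) < ε := hball h7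
      rw [← dist_eq_norm]
      exact h8.le
    have h9 := (hs.inter (convex_ball u.1 δ)).norm_image_sub_le_of_norm_hasDerivWithin_le h4 h6
      ⟨hu, Metric.mem_ball_self hδ⟩ ⟨hv.1.1, lt_of_le_of_lt (le_max_left _ _) hv2⟩
    convert h9 using 2
    rw [sub_smul]; abel
  have e2 : (fun v : ℝ × ℝ => f u.1 v.2 - f u.1 u.2 - (v.2 - u.2) • f₂ u.1 u.2)
      =o[𝓝[s ×ˢ (univ : Set ℝ)] u] (fun v => v.2 - u.2) :=
    ((hasDerivAt_iff_isLittleO.1 (h₂ u.1 hu u.2)).comp_tendsto hsnd)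
  have e3 := (e1.trans_isBigO (k := fun v : ℝ × ℝ => v - u)
    (isBigO_of_le _ fun v : ℝ × ℝ => norm_fst_le (v - u))).add
    (e2.trans_isBigO (k := fun v : ℝ × ℝ => v - u)
      (isBigO_of_le _ fun v : ℝ × ℝ => norm_snd_le (v - u)))
  refine e3.congr_left fun v => ?_
  simp [Function.uncurry]
  abel

/-- Induction on the order, for all `(j, β)` together: the differential is assembled from two
members of the same family. -/
theorem contDiffOn_of_partials {s : Set ℝ} (hs : Convex ℝ s) (hu : UniqueDiffOn ℝ s)
    {F : ℕ → ℕ → ℝ → ℝ → E}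
    (h₁ : ∀ j β, ∀ t ∈ s, ∀ τ, HasDerivWithinAt (fun t' => F j β t' τ) (F (j + 1) β t τ) s t)
    (h₂ : ∀ j β, ∀ t ∈ s, ∀ τ, HasDerivAt (fun τ' => F j β t τ') (F j (β + 1) t τ) τ)
    (hc : ∀ j β, ContinuousOn (Function.uncurry (F j β)) (s ×ˢ univ)) (j β : ℕ) :
    ContDiffOn ℝ ∞ (Function.uncurry (F j β)) (s ×ˢ univ) := by
  have hU : UniqueDiffOn ℝ (s ×ˢ (univ : Set ℝ)) := hu.prod uniqueDiffOn_univ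
  have hD : ∀ j β, ∀ u ∈ s ×ˢ (univ : Set ℝ), HasFDerivWithinAt (Function.uncurry (F j β))
      ((ContinuousLinearMap.fst ℝ ℝ ℝ).smulRight (F (j + 1) β u.1 u.2)
        + (ContinuousLinearMap.snd ℝ ℝ ℝ).smulRight (F j (β + 1) u.1 u.2)) (s ×ˢ univ) u :=
    fun j β u hu => hasFDerivWithinAt_of_partials hs (h₁ j β) (h₂ j β) (hc _ _) hu.1
  rw [contDiffOn_infty]
  intro n
  induction n generalizing j β with
  | zero => exact contDiffOn_zero.2 (hc j β)
  | succ n ih =>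
    push_cast
    rw [contDiffOn_succ_iff_fderivWithin hU]
    refine ⟨fun u hu => (hD j β u hu).differentiableWithinAt, by simp, ?_⟩
    have h3 : ContDiffOn ℝ n (fun u : ℝ × ℝ =>
        (ContinuousLinearMap.fst ℝ ℝ ℝ).smulRight (Function.uncurry (F (j + 1) β) u)
        + (ContinuousLinearMap.snd ℝ ℝ ℝ).smulRight (Function.uncurry (F j (β + 1)) u))
        (s ×ˢ univ) :=
      (contDiffOn_const.smulRight (ih (j + 1) β)).add (contDiffOn_const.smulRight (ih j (β + 1)))
    exact h3.congr fun u hu' => (hD j β u hu').fderivWithin (hU u hu')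

end RealAnalysis

/-! ### Deformation of circular contours -/

section Contours

variable {E : Type*} [NormedAddCommGroup E] [NormedSpace ℂ E] [CompleteSpace E]

/-- Invariance of the integral of a holomorphic function under a linear deformation of circles. -/
theorem circleIntegral_eq_of_forall_mem {U : Set ℂ} (hU : IsOpen U) {f : ℂ → E}
    (hf : DifferentiableOn ℂ f U) {c₀ c₁ : ℂ} {r₀ r₁ : ℝ}
    (h : ∀ x ∈ Icc (0 : ℝ) 1, ∀ θ, circleMap (c₀ + x • (c₁ - c₀)) (r₀ + x * (r₁ - r₀)) θ ∈ U) :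
    ∮ z in C(c₀, r₀), f z = ∮ z in C(c₁, r₁), f z := by
  set pt : ℝ → ℝ → ℂ := fun x θ => circleMap (c₀ + x • (c₁ - c₀)) (r₀ + x * (r₁ - r₀)) θ with hpt
  set vel : ℝ → ℝ → ℂ := fun x θ => circleMap 0 (r₀ + x * (r₁ - r₀)) θ * Complex.I with hvel
  set dir : ℝ → ℂ := fun θ => circleMap (c₁ - c₀) (r₁ - r₀) θ with hdir
  set dir' : ℝ → ℂ := fun θ => circleMap 0 (r₁ - r₀) θ * Complex.I with hdir'
  have hptc : Continuous (Function.uncurry pt) := by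
    simp only [hpt, circleMap, Function.uncurry_def]; fun_prop
  have hvelc : Continuous (Function.uncurry vel) := by
    simp only [hvel, circleMap, Function.uncurry_def]; fun_prop
  have hdirc : Continuous dir := continuous_circleMap _ _
  have hdirc' : Continuous dir' := (continuous_circleMap _ _).mul continuous_const
  have hptx : ∀ x θ, HasDerivAt (fun y => pt y θ) (dir θ) x := by
    intro x θ
    have h1 : (fun y => pt y θ) = fun y : ℝ => pt 0 θ + y • dir θ := by
      ext y; simp only [hpt, hdir, circleMap, Complex.real_smul]; push_cast; ring
    rw [h1]
    simpa using ((hasDerivAt_id x).smul_const (dir θ)).const_add (pt 0 θ)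
  have hvelx : ∀ x θ, HasDerivAt (fun y => vel y θ) (dir' θ) x := by
    intro x θ
    have h1 : (fun y => vel y θ) = fun y : ℝ => vel 0 θ + y • dir' θ := by
      ext y; simp only [hvel, hdir', circleMap, Complex.real_smul]; push_cast; ring
    rw [h1]
    simpa using ((hasDerivAt_id x).smul_const (dir' θ)).const_add (vel 0 θ)
  have hptθ : ∀ x θ, HasDerivAt (fun η => pt x η) (vel x θ) θ := fun x θ => hasDerivAt_circleMap _ _ _
  have hdirθ : ∀ θ, HasDerivAt dir (dir' θ) θ := fun θ => hasDerivAt_circleMap _ _ _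
  have hfd : ∀ z ∈ U, HasDerivAt f (deriv f z) z := fun z hz =>
    (hf.differentiableAt (hU.mem_nhds hz)).hasDerivAt
  have hfc : ContinuousOn f U := hf.continuousOn
  have hfc' : ContinuousOn (deriv f) U := (hf.deriv hU).continuousOn
  have hmaps : MapsTo (Function.uncurry pt) (Icc (0 : ℝ) 1 ×ˢ Icc 0 (2 * Real.pi)) U :=
    fun x hx => h x.1 hx.1 x.2
  set g : ℝ → ℝ → E := fun x θ => vel x θ • f (pt x θ) with hg
  set g' : ℝ → ℝ → E := fun x θ => vel x θ • (dir θ • deriv f (pt x θ)) + dir' θ • f (pt x θ) with hg'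
  have hgd : ∀ x ∈ Icc (0 : ℝ) 1, ∀ θ ∈ Icc 0 (2 * Real.pi),
      HasDerivWithinAt (fun y => g y θ) (g' x θ) (Icc 0 1) x := by
    intro x hx θ _
    exact ((hvelx x θ).smul ((hfd _ (h x hx θ)).scomp x (hptx x θ))).hasDerivWithinAt
  have hg'c : ContinuousOn (Function.uncurry g') (Icc (0 : ℝ) 1 ×ˢ Icc 0 (2 * Real.pi)) := by
    refine ContinuousOn.add (hvelc.continuousOn.smul ((hdirc.comp continuous_snd).continuousOn.smul
      (hfc'.comp hptc.continuousOn hmaps))) ((hdirc'.comp continuous_snd).continuousOn.smul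
      (hfc.comp hptc.continuousOn hmaps))
  have hgc : ∀ x ∈ Icc (0 : ℝ) 1, ContinuousOn (g x) (Icc 0 (2 * Real.pi)) := fun x hx =>
    (hvelc.comp (Continuous.prodMk_right x)).continuousOn.smul
      (hfc.comp (hptc.comp (Continuous.prodMk_right x)).continuousOn fun θ _ => h x hx θ)
  have hpi : (0 : ℝ) ≤ 2 * Real.pi := by positivity
  -- The `x`-derivative of the integrand `∂_θ γ · f(γ)` equals `∂_θ (∂_x γ · f(γ))`, the
  -- `θ`-derivative of a `2π`-periodic function.
  have hzero : ∀ x ∈ Icc (0 : ℝ) 1, ∫ θ in (0 : ℝ)..(2 * Real.pi), g' x θ = 0 := by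
    intro x hx
    have h1 : ∀ θ ∈ uIcc 0 (2 * Real.pi),
        HasDerivAt (fun θ => dir θ • f (pt x θ)) (g' x θ) θ := by
      intro θ _
      have h2 := (hdirθ θ).smul ((hfd _ (h x hx θ)).scomp θ (hptθ x θ))
      refine h2.congr_deriv ?_
      simp only [hg', Function.comp]
      rw [smul_comm]
    rw [intervalIntegral.integral_eq_sub_of_hasDerivAt h1]
    · have h3 : dir (2 * Real.pi) = dir 0 := by simpa using (periodic_circleMap (c₁ - c₀) (r₁ - r₀)) 0
      have h4 : pt x (2 * Real.pi) = pt x 0 := by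
        have h5 := (periodic_circleMap (c₀ + x • (c₁ - c₀)) (r₀ + x * (r₁ - r₀))) 0
        rwa [zero_add] at h5
      rw [h3, h4, sub_self]
    · exact ContinuousOn.intervalIntegrable_of_Icc hpi
        (hg'c.comp (f := fun θ => (x, θ)) (by fun_prop) (fun θ hθ => ⟨hx, hθ⟩))
  have hder : ∀ x ∈ Icc (0 : ℝ) 1,
      HasDerivWithinAt (fun x => ∫ θ in (0 : ℝ)..(2 * Real.pi), g x θ) 0 (Icc 0 1) x := by
    intro x hx
    rw [← hzero x hx]
    exact hasDerivWithinAt_intervalIntegral (convex_Icc 0 1) hx hpi hgc hgd hg'c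
  have hconst := (convex_Icc (0 : ℝ) 1).norm_image_sub_le_of_norm_hasDerivWithin_le (C := 0) hder
    (by simp) (left_mem_Icc.2 zero_le_one) (right_mem_Icc.2 zero_le_one)
  rw [zero_mul, norm_le_zero_iff, sub_eq_zero] at hconst
  simp only [circleIntegral, deriv_circleMap]
  have e0 : c₀ + (0 : ℝ) • (c₁ - c₀) = c₀ := by simp
  have e1 : c₀ + (1 : ℝ) • (c₁ - c₀) = c₁ := by simp
  have e2 : r₀ + (1 : ℝ) * (r₁ - r₀) = r₁ := by ring
  have e3 : r₀ + (0 : ℝ) * (r₁ - r₀) = r₀ := by ring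
  simp only [hg, hvel, hpt, e0, e1, e2, e3] at hconst
  exact hconst.symm

end Contours

/-! ### Uniform Gevrey bounds for the inverse symbol -/

section Estimates

open Jet

variable {B : Type*} [NormedRing B] [NormedAlgebra ℂ B]

/-- The radius `ρ` is fixed before the point. Neither `z` nor `a(τ)` itself enters except through
the resolvent bound `M`, so unbounded `a` is admissible. -/
theorem exists_norm_solJet_le {e : B} {a : ℝ → ℝ} {P : ℝ → B} {s σ C₀ C₁ R M : ℝ} (hs : 1 ≤ s)
    (hσ : 1 ≤ σ) (hC₀ : 0 < C₀) (hC₁ : 0 < C₁) (hR : 0 < R) (hM : 0 ≤ M)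
    (hP : ∀ k : ℕ, ∀ t ∈ Icc (0 : ℝ) 1,
      ‖iteratedDerivWithin k P (Icc 0 1) t‖ ≤ C₀ ^ (k + 1) * (k ! : ℝ) ^ s) :
    ∃ ρ > 0, ∀ t τ z, (t, τ, z) ∈ unitSet e a P →
      ‖Ring.inverse (symJet e a P t τ z 0 0 0)‖ ≤ M →
      (∀ n : ℕ, 1 ≤ n → |iteratedDeriv n a τ| ≤ C₁ * R ^ n * (n ! : ℝ) ^ σ) → ∀ m j β : ℕ,
      ‖solJet e a P t τ z m j β‖
        ≤ M * (((j + m)! : ℝ) ^ s * ((β + m)! : ℝ) ^ σ * ρ ^ (2 * m + j + β)) := by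
  set C : ℝ := C₀ + C₁ * ‖e‖ with hC
  set w : ℝ := 1 / (16 * (M * C + 1)) with hw
  have hCnn : 0 ≤ C := by positivity
  have hw0 : 0 < w := by positivity
  have hw1 : w ≤ 1 / 2 := by
    rw [hw]
    apply one_div_le_one_div_of_le (by norm_num)
    nlinarith [mul_nonneg hM hCnn]
  have hMC : M * C * (8 * w) ≤ 1 := by
    rw [hw, mul_one_div, mul_div_assoc', div_le_one (by positivity)]
    nlinarith [mul_nonneg hM hCnn]
  have hwρ : w * ((C₀ + R) / w) = C₀ + R := by field_simp
  refine ⟨(C₀ + R) / w, by positivity, fun t τ z h hr ha m j β => ?_⟩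
  have hdec : symJet e a P t τ z = (z • const e - tauJet e a τ) + -timeJet P t := by
    rw [symJet, hamJet]; abel
  have hmul := sym_mul_sol h
  rw [hdec] at hmul
  have hr1 : Ring.inverse (symJet e a P t τ z 0 0 0) *
      ((z • const e - tauJet e a τ : Jet B) 0 0 0 + (-timeJet P t) 0 0 0) = 1 := by
    have h1 : (z • const e - tauJet e a τ : Jet B) 0 0 0 + (-timeJet P t) 0 0 0
        = symJet e a P t τ z 0 0 0 := by rw [hdec]; rfl
    rw [h1]
    exact Ring.inverse_mul_cancel _ (mem_unitSet.1 h).2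
  refine norm_le_of_mul_eq_one hs hσ (u := z • const e - tauJet e a τ) (v := -timeJet P t)
    ?_ ?_ ?_ ?_ hmul hr1 hCnn hr hw0.le hw1 (by positivity) hMC ?_ ?_ m j β
  · ext m j β; simp [tauJet, const]
  · ext m j β; simp [tauJet, const]
  · ext m j β; simp [timeJet]
  · ext m j β; simp [timeJet]
  · intro n hn
    have h1 : (z • const e - tauJet e a τ : Jet B) 0 0 n = -(iteratedDeriv n a τ • e) := by
      simp [tauJet, const, Nat.one_le_iff_ne_zero.1 hn]
    rw [h1, norm_neg, norm_smul, Real.norm_eq_abs, hwρ]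
    calc |iteratedDeriv n a τ| * ‖e‖ ≤ (C₁ * R ^ n * (n ! : ℝ) ^ σ) * ‖e‖ := by
          gcongr; exact ha n hn
      _ = (C₁ * ‖e‖) * R ^ n * (n ! : ℝ) ^ σ := by ring
      _ ≤ C * (C₀ + R) ^ n * (n ! : ℝ) ^ σ := by
          gcongr
          · rw [hC]; linarith
          · linarith
  · intro n hn
    have h1 : (-timeJet P t) 0 n 0 = -iteratedDerivWithin n P (Icc 0 1) t := by
      simp [timeJet]
    rw [h1, norm_neg, hwρ]
    calc ‖iteratedDerivWithin n P (Icc 0 1) t‖ ≤ C₀ ^ (n + 1) * (n ! : ℝ) ^ s := hP n t h.1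
      _ = C₀ * C₀ ^ n * (n ! : ℝ) ^ s := by ring
      _ ≤ C * (C₀ + R) ^ n * (n ! : ℝ) ^ s := by
          gcongr
          · rw [hC]; linarith [mul_nonneg hC₁.le (norm_nonneg e)]
          · linarith

theorem factorial_add_rpow_le {s : ℝ} (hs : 0 ≤ s) (j m : ℕ) :
    ((j + m)! : ℝ) ^ s ≤ ((2 : ℝ) ^ s) ^ (j + m) * ((j ! : ℝ) ^ s * (m ! : ℝ) ^ s) := by
  have h1 : (j + m)! ≤ 2 ^ (j + m) * (j ! * m !) := by
    have h2 := Nat.add_choose_mul_factorial_mul_factorial j m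
    rw [← h2, mul_assoc]
    gcongr
    exact Nat.choose_le_two_pow _ _
  calc ((j + m)! : ℝ) ^ s ≤ ((2 ^ (j + m) * (j ! * m !) : ℕ) : ℝ) ^ s := by
        gcongr
    _ = _ := by
        push_cast
        rw [Real.mul_rpow (by positivity) (by positivity),
          Real.mul_rpow (by positivity) (by positivity), ← Real.rpow_natCast, ← Real.rpow_natCast,
          ← Real.rpow_mul (by norm_num), ← Real.rpow_mul (by norm_num), mul_comm s]

/-- Splitting the factorials costs only geometric factors and produces `m!^(s+σ)`. The normalisation
`1/m!` of the entries accounts for the `-1` in the exponent. -/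
theorem exists_gevrey_bound {s σ ρ : ℝ} (hs : 1 ≤ s) (hσ : 1 ≤ σ) (hρ : 0 < ρ) :
    ∃ R ≥ 1, ∀ m j β : ℕ, (m ! : ℝ)⁻¹ *
      (((j + m)! : ℝ) ^ s * ((β + m)! : ℝ) ^ σ * ρ ^ (2 * m + j + β)) ≤
      R ^ (j + β + m) * (j ! : ℝ) ^ s * (β ! : ℝ) ^ σ * (m ! : ℝ) ^ (s + σ - 1) := by
  set r : ℝ := max ρ 1 with hr
  have hr1 : 1 ≤ r := le_max_right _ _
  have h2s : (1 : ℝ) ≤ 2 ^ s := Real.one_le_rpow (by norm_num) (by linarith)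
  have h2σ : (1 : ℝ) ≤ 2 ^ σ := Real.one_le_rpow (by norm_num) (by linarith)
  have h1R : (1 : ℝ) ≤ 2 ^ s * 2 ^ σ * r ^ 2 :=
    one_le_mul_of_one_le_of_one_le (one_le_mul_of_one_le_of_one_le h2s h2σ) (one_le_pow₀ hr1)
  refine ⟨2 ^ s * 2 ^ σ * r ^ 2, h1R, fun m j β => ?_⟩
  have hm : (0 : ℝ) < (m ! : ℝ) := by positivity
  have e1 : (m ! : ℝ)⁻¹ * ((m ! : ℝ) ^ s * (m ! : ℝ) ^ σ) = (m ! : ℝ) ^ (s + σ - 1) := by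
    rw [Real.rpow_sub hm, Real.rpow_add hm, Real.rpow_one]; field_simp
  have e2 : ρ ^ (2 * m + j + β) ≤ (r ^ 2) ^ (j + β + m) := by
    calc ρ ^ (2 * m + j + β) ≤ r ^ (2 * m + j + β) := by gcongr; exact le_max_left _ _
      _ ≤ r ^ (2 * (j + β + m)) := pow_le_pow_right₀ hr1 (by omega)
      _ = _ := by rw [pow_mul]
  calc (m ! : ℝ)⁻¹ * (((j + m)! : ℝ) ^ s * ((β + m)! : ℝ) ^ σ * ρ ^ (2 * m + j + β))
      ≤ (m ! : ℝ)⁻¹ * ((((2 : ℝ) ^ s) ^ (j + β + m) * ((j ! : ℝ) ^ s * (m ! : ℝ) ^ s)) *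
        (((2 : ℝ) ^ σ) ^ (j + β + m) * ((β ! : ℝ) ^ σ * (m ! : ℝ) ^ σ)) *
        (r ^ 2) ^ (j + β + m)) := by
        gcongr
        · refine (factorial_add_rpow_le (by linarith) j m).trans ?_
          gcongr
          omega
        · refine (factorial_add_rpow_le (by linarith) β m).trans ?_
          gcongr
          omega
    _ = (2 ^ s * 2 ^ σ * r ^ 2) ^ (j + β + m) * (j ! : ℝ) ^ s * (β ! : ℝ) ^ σ *
        ((m ! : ℝ)⁻¹ * ((m ! : ℝ) ^ s * (m ! : ℝ) ^ σ)) := by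
        rw [mul_pow, mul_pow]; ring
    _ = _ := by rw [e1]

end Estimates

/-! ### Contours in the resolvent set -/

section Projector

open Jet

variable {B : Type*} [NormedRing B] [NormedAlgebra ℂ B]

/-- The operators `P(t)` depend smoothly on `t`, have real spectrum relative to `e`, and
`γ₁(t) < γ₂(t)` lie in gaps of the spectrum. -/
structure SpectralGap (e : B) (P : ℝ → B) (γ₁ γ₂ : ℝ → ℝ) : Prop where
  smooth : ContDiffOn ℝ ∞ P (Icc 0 1)
  nonreal : ∀ t ∈ Icc (0 : ℝ) 1, ∀ z : ℂ, z.im ≠ 0 → IsUnit (z • e - P t)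
  cont₁ : ContinuousOn γ₁ (Icc 0 1)
  cont₂ : ContinuousOn γ₂ (Icc 0 1)
  lt : ∀ t ∈ Icc (0 : ℝ) 1, γ₁ t < γ₂ t
  gap₁ : ∀ t ∈ Icc (0 : ℝ) 1, IsUnit ((γ₁ t : ℂ) • e - P t)
  gap₂ : ∀ t ∈ Icc (0 : ℝ) 1, IsUnit ((γ₂ t : ℂ) • e - P t)

/-- The jets of the formal spectral projector. -/
def projJet (e : B) (a : ℝ → ℝ) (P : ℝ → B) (γ₁ γ₂ : ℝ → ℝ) (t τ : ℝ) : Jet B := fun m j β =>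
  (2 * (Real.pi : ℂ) * Complex.I)⁻¹ •
    ∮ z in C(((a τ + (γ₁ t + γ₂ t) / 2 : ℝ) : ℂ), (γ₂ t - γ₁ t) / 2), solJet e a P t τ z m j β

variable {e : B} {a : ℝ → ℝ} {P : ℝ → B} {γ₁ γ₂ : ℝ → ℝ}

theorem circleMap_real_of_im_eq_zero {c r θ : ℝ} (hr : r ≠ 0) (h : (circleMap (c : ℂ) r θ).im = 0) :
    circleMap (c : ℂ) r θ = ((c - r : ℝ) : ℂ) ∨ circleMap (c : ℂ) r θ = ((c + r : ℝ) : ℂ) := by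
  have h1 : (circleMap (c : ℂ) r θ).im = r * Real.sin θ := by
    simp [circleMap, Complex.exp_ofReal_mul_I_im]
  have h2 : (circleMap (c : ℂ) r θ).re = c + r * Real.cos θ := by
    simp [circleMap, Complex.exp_ofReal_mul_I_re]
  have h3 : Real.sin θ = 0 := by
    rw [h1] at h; exact (mul_eq_zero.1 h).resolve_left hr
  rcases Real.sin_eq_zero_iff_cos_eq.1 h3 with h4 | h4
  · right
    apply Complex.ext
    · rw [h2, h4, mul_one, Complex.ofReal_re]
    · rw [h, Complex.ofReal_im]
  · left
    apply Complex.ext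
    · rw [h2, h4, Complex.ofReal_re]; ring
    · rw [h, Complex.ofReal_im]

namespace SpectralGap

variable (G : SpectralGap e P γ₁ γ₂)
include G

theorem mem_of_im_ne_zero {t τ : ℝ} (ht : t ∈ Icc (0 : ℝ) 1) {z : ℂ} (hz : z.im ≠ 0) :
    (t, τ, z) ∈ unitSet e a P := ⟨ht, G.nonreal t ht _ (by simpa using hz)⟩

theorem left_mem {t τ : ℝ} (ht : t ∈ Icc (0 : ℝ) 1) :
    (t, τ, ((a τ + γ₁ t : ℝ) : ℂ)) ∈ unitSet e a P :=
  ⟨ht, by simpa using G.gap₁ t ht⟩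

theorem right_mem {t τ : ℝ} (ht : t ∈ Icc (0 : ℝ) 1) :
    (t, τ, ((a τ + γ₂ t : ℝ) : ℂ)) ∈ unitSet e a P :=
  ⟨ht, by simpa using G.gap₂ t ht⟩

variable [CompleteSpace B] (ha : ContDiff ℝ ∞ a)
include ha

theorem isOpen_slice {t τ : ℝ} (ht : t ∈ Icc (0 : ℝ) 1) :
    IsOpen {z : ℂ | (t, τ, z) ∈ unitSet e a P} := by
  rw [isOpen_iff_mem_nhds]
  intro z hz
  have htend : Filter.Tendsto (fun z : ℂ => (t, τ, z)) (𝓝 z)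
      (𝓝[{x | x.1 ∈ Icc (0 : ℝ) 1}] (t, τ, z)) := by
    rw [← nhdsWithin_univ z]
    exact (Continuous.continuousWithinAt (by fun_prop)).tendsto_nhdsWithin (fun y hy => ht)
  exact htend.eventually (eventually_mem_unitSet ha G.smooth hz)

theorem exists_delta_real {t₀ τ₀ : ℝ} (ht₀ : t₀ ∈ Icc (0 : ℝ) 1) : ∃ δ > 0, ∀ t ∈ Icc (0 : ℝ) 1,
    ∀ τ x : ℝ, |t - t₀| < δ → |τ - τ₀| < δ →
      |x - (a τ₀ + γ₁ t₀)| < δ ∨ |x - (a τ₀ + γ₂ t₀)| < δ → (t, τ, (x : ℂ)) ∈ unitSet e a P := by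
  obtain ⟨δ₁, hδ₁, h₁⟩ := Metric.mem_nhdsWithin_iff.1
    (eventually_mem_unitSet ha G.smooth (G.left_mem (a := a) (τ := τ₀) ht₀))
  obtain ⟨δ₂, hδ₂, h₂⟩ := Metric.mem_nhdsWithin_iff.1
    (eventually_mem_unitSet ha G.smooth (G.right_mem (a := a) (τ := τ₀) ht₀))
  have key : ∀ (x y : ℝ), dist (x : ℂ) (y : ℂ) = |x - y| := fun x y => by
    rw [Complex.dist_of_im_eq (by simp)]; simp [Real.dist_eq]
  refine ⟨min δ₁ δ₂, lt_min hδ₁ hδ₂, fun t ht τ x h3 h4 h5 => ?_⟩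
  rcases h5 with h5 | h5
  · refine h₁ ⟨?_, ht⟩
    change max (dist t t₀) (max (dist τ τ₀) (dist (x : ℂ) ((a τ₀ + γ₁ t₀ : ℝ) : ℂ))) < δ₁
    refine max_lt ?_ (max_lt ?_ ?_)
    · exact h3.trans_le (min_le_left _ _)
    · exact h4.trans_le (min_le_left _ _)
    · rw [key]
      exact h5.trans_le (min_le_left _ _)
  · refine h₂ ⟨?_, ht⟩
    change max (dist t t₀) (max (dist τ τ₀) (dist (x : ℂ) ((a τ₀ + γ₂ t₀ : ℝ) : ℂ))) < δ₂
    refine max_lt ?_ (max_lt ?_ ?_)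
    · exact h3.trans_le (min_le_right _ _)
    · exact h4.trans_le (min_le_right _ _)
    · rw [key]
      exact h5.trans_le (min_le_right _ _)

/-- Every circle of the linear homotopy is centred on the real axis, so its only real points are its
centre plus or minus its radius. These stay close to `a(τ₀) + γ₁(t₀)` and `a(τ₀) + γ₂(t₀)`, where
the symbol is still invertible; elsewhere the points are nonreal. -/
theorem exists_delta_circle {t₀ : ℝ} (τ₀ : ℝ) (ht₀ : t₀ ∈ Icc (0 : ℝ) 1) : ∃ δ > 0,
    ∀ t ∈ Icc (0 : ℝ) 1, ∀ τ : ℝ, |t - t₀| < δ → |τ - τ₀| < δ → ∀ x ∈ Icc (0 : ℝ) 1, ∀ θ,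
    (t, τ, circleMap (((a τ₀ + (γ₁ t₀ + γ₂ t₀) / 2 : ℝ) : ℂ)
      + x • (((a τ + (γ₁ t + γ₂ t) / 2 : ℝ) : ℂ) - ((a τ₀ + (γ₁ t₀ + γ₂ t₀) / 2 : ℝ) : ℂ)))
      ((γ₂ t₀ - γ₁ t₀) / 2 + x * ((γ₂ t - γ₁ t) / 2 - (γ₂ t₀ - γ₁ t₀) / 2)) θ)
      ∈ unitSet e a P := by
  obtain ⟨δ, hδ, h⟩ := G.exists_delta_real ha (τ₀ := τ₀) ht₀
  have hδ2 : 0 < δ / 2 := by positivity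
  obtain ⟨δ₁, hδ₁, h₁⟩ := Metric.continuousWithinAt_iff.1 (G.cont₁ t₀ ht₀) (δ / 2) hδ2
  obtain ⟨δ₂, hδ₂, h₂⟩ := Metric.continuousWithinAt_iff.1 (G.cont₂ t₀ ht₀) (δ / 2) hδ2
  obtain ⟨δ₃, hδ₃, h₃⟩ := Metric.continuous_iff.1 ha.continuous τ₀ (δ / 2) hδ2
  refine ⟨min δ (min δ₁ (min δ₂ δ₃)), by positivity, fun t ht τ ht' hτ' x hx θ => ?_⟩
  simp only [lt_min_iff] at ht' hτ'
  have b₁ := h₁ ht ht'.2.1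
  have b₂ := h₂ ht ht'.2.2.1
  have b₃ := h₃ τ hτ'.2.2.2
  rw [Real.dist_eq] at b₁ b₂ b₃
  -- The radius is a convex combination of two positive radii.
  have hr : 0 < (γ₂ t₀ - γ₁ t₀) / 2 + x * ((γ₂ t - γ₁ t) / 2 - (γ₂ t₀ - γ₁ t₀) / 2) := by
    have q1 := G.lt t ht
    have q2 := G.lt t₀ ht₀
    have q3 : 0 ≤ (1 - x) * ((γ₂ t₀ - γ₁ t₀) / 2) :=
      mul_nonneg (by linarith [hx.2]) (by linarith)
    have q4 : 0 ≤ x * ((γ₂ t - γ₁ t) / 2) := mul_nonneg hx.1 (by linarith)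
    rcases hx.1.eq_or_lt with rfl | hx0
    · linarith
    · have : 0 < x * ((γ₂ t - γ₁ t) / 2) := mul_pos hx0 (by linarith)
      linarith
  have hcc : ((a τ₀ + (γ₁ t₀ + γ₂ t₀) / 2 : ℝ) : ℂ)
      + x • (((a τ + (γ₁ t + γ₂ t) / 2 : ℝ) : ℂ) - ((a τ₀ + (γ₁ t₀ + γ₂ t₀) / 2 : ℝ) : ℂ))
      = ((a τ₀ + (γ₁ t₀ + γ₂ t₀) / 2
        + x * ((a τ + (γ₁ t + γ₂ t) / 2) - (a τ₀ + (γ₁ t₀ + γ₂ t₀) / 2)) : ℝ) : ℂ) := by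
    rw [Complex.real_smul]; push_cast; ring
  rw [hcc]
  have hxabs : ∀ y : ℝ, |y| < δ → |x * y| < δ := fun y hy => by
    rw [abs_mul, abs_of_nonneg hx.1]
    exact lt_of_le_of_lt (mul_le_of_le_one_left (abs_nonneg y) hx.2) hy
  by_cases him : (circleMap ((a τ₀ + (γ₁ t₀ + γ₂ t₀) / 2
        + x * ((a τ + (γ₁ t + γ₂ t) / 2) - (a τ₀ + (γ₁ t₀ + γ₂ t₀) / 2)) : ℝ) : ℂ)
        ((γ₂ t₀ - γ₁ t₀) / 2 + x * ((γ₂ t - γ₁ t) / 2 - (γ₂ t₀ - γ₁ t₀) / 2)) θ).im = 0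
  · rcases circleMap_real_of_im_eq_zero hr.ne' him with h6 | h6
    · rw [h6]
      refine h t ht τ _ ht'.1 hτ'.1 (Or.inl ?_)
      have h7 := hxabs ((a τ - a τ₀) + (γ₁ t - γ₁ t₀)) (by
        rw [abs_lt] at *; constructor <;> linarith [b₁.1, b₁.2, b₃.1, b₃.2])
      convert h7 using 2
      ring
    · rw [h6]
      refine h t ht τ _ ht'.1 hτ'.1 (Or.inr ?_)
      have h7 := hxabs ((a τ - a τ₀) + (γ₂ t - γ₂ t₀)) (by
        rw [abs_lt] at *; constructor <;> linarith [b₂.1, b₂.2, b₃.1, b₃.2])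
      convert h7 using 2
      ring
  · exact G.mem_of_im_ne_zero ht him

theorem sphere_subset {t : ℝ} (τ : ℝ) (ht : t ∈ Icc (0 : ℝ) 1) {z : ℂ}
    (hz : z ∈ Metric.sphere ((a τ + (γ₁ t + γ₂ t) / 2 : ℝ) : ℂ) ((γ₂ t - γ₁ t) / 2)) :
    (t, τ, z) ∈ unitSet e a P := by
  obtain ⟨δ, hδ, h⟩ := G.exists_delta_circle ha τ ht
  have hr : 0 ≤ (γ₂ t - γ₁ t) / 2 := by linarith [G.lt t ht]
  rw [← abs_of_nonneg hr, ← image_circleMap_Ioc] at hz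
  obtain ⟨θ, -, rfl⟩ := hz
  simpa using h t ht τ (by simpa) (by simpa) 0 (by simp) θ

theorem circleIntegrable_sol {t : ℝ} (τ : ℝ) (ht : t ∈ Icc (0 : ℝ) 1) (m j β : ℕ) :
    CircleIntegrable (fun z => solJet e a P t τ z m j β)
      ((a τ + (γ₁ t + γ₂ t) / 2 : ℝ) : ℂ) ((γ₂ t - γ₁ t) / 2) :=
  ((differentiableOn_solJet t τ m j β).continuousOn.mono
    fun z hz => G.sphere_subset ha τ ht hz).circleIntegrable (by linarith [G.lt t ht])

end SpectralGap

end Projector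

/-! ### Idempotence, commutation and smoothness of the projector -/

section Projector

open Jet

variable {B : Type*} [NormedRing B] [NormedAlgebra ℂ B] [CompleteSpace B]
variable {e : B} {a : ℝ → ℝ} {P : ℝ → B} {γ₁ γ₂ : ℝ → ℝ}

theorem differentiableOn_cauchyTransform {E : Type*} [NormedAddCommGroup E] [NormedSpace ℂ E]
    [CompleteSpace E] {f : ℂ → E} {c : ℂ} {r : ℝ} (hr : 0 < r) (hf : CircleIntegrable f c r) :
    DifferentiableOn ℂ (fun z => ∮ w in C(c, r), (w - z)⁻¹ • f w) (Metric.ball c r) := by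
  lift r to NNReal using hr.le
  have h1 := (hasFPowerSeriesOn_cauchy_integral hf (by exact_mod_cast hr)).differentiableOn
  rw [Metric.eball_coe] at h1
  refine (h1.const_smul (2 * (Real.pi : ℂ) * Complex.I)).congr fun z _ => ?_
  simp only [Pi.smul_apply]
  rw [smul_smul, mul_inv_cancel₀ Complex.two_pi_I_ne_zero, one_smul]

namespace SpectralGap

variable (G : SpectralGap e P γ₁ γ₂) (ha : ContDiff ℝ ∞ a)
include G ha

theorem ham_mul_proj_mul_const {t : ℝ} (τ : ℝ) (ht : t ∈ Icc (0 : ℝ) 1) :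
    hamJet e a P t τ * projJet e a P γ₁ γ₂ t τ * const e
      = const e * projJet e a P γ₁ γ₂ t τ * hamJet e a P t τ := by
  set c : ℂ := ((a τ + (γ₁ t + γ₂ t) / 2 : ℝ) : ℂ) with hc
  set r : ℝ := (γ₂ t - γ₁ t) / 2 with hr
  set Q : Jet B := fun m j β => ∮ z in C(c, r), solJet e a P t τ z m j β with hQ
  have hr0 : 0 ≤ r := by rw [hr]; linarith [G.lt t ht]
  have h1 : projJet e a P γ₁ γ₂ t τ = (2 * (Real.pi : ℂ) * Complex.I)⁻¹ • Q := rfl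
  have hi := G.circleIntegrable_sol ha τ ht
  suffices h : hamJet e a P t τ * Q * const e = const e * Q * hamJet e a P t τ by
    rw [h1, mul_smul_comm, mul_smul_comm, smul_mul_assoc, smul_mul_assoc, h]
  ext m j β
  have i1 := fun m j β => mul_circleIntegral c r m j β (hamJet e a P t τ)
    (fun z => solJet e a P t τ z) Q hi (fun _ _ _ => rfl)
  have i2 := circleIntegral_mul c r m j β (fun z => hamJet e a P t τ * solJet e a P t τ z)
    (hamJet e a P t τ * Q) (const e) (fun m j β => (i1 m j β).1) (fun m j β => (i1 m j β).2)
  have i3 := fun m j β => mul_circleIntegral c r m j β (const e)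
    (fun z => solJet e a P t τ z) Q hi (fun _ _ _ => rfl)
  have i4 := circleIntegral_mul c r m j β (fun z => const e * solJet e a P t τ z)
    (const e * Q) (hamJet e a P t τ) (fun m j β => (i3 m j β).1) (fun m j β => (i3 m j β).2)
  rw [i2.2, i4.2]
  refine circleIntegral.integral_congr hr0 fun z hz => ?_
  exact congrArg (fun p : Jet B => p m j β) (ham_mul_sol_mul_const (G.sphere_subset ha τ ht hz))

/-- The closed annulus meets the real axis only near the two gap points, so it lies in the resolvent
set. -/
theorem exists_larger_circle {t : ℝ} (τ : ℝ) (ht : t ∈ Icc (0 : ℝ) 1) :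
    ∃ r' > (γ₂ t - γ₁ t) / 2, ∀ z : ℂ,
      (γ₂ t - γ₁ t) / 2 ≤ ‖z - ((a τ + (γ₁ t + γ₂ t) / 2 : ℝ) : ℂ)‖ →
      ‖z - ((a τ + (γ₁ t + γ₂ t) / 2 : ℝ) : ℂ)‖ ≤ r' → (t, τ, z) ∈ unitSet e a P := by
  obtain ⟨δ, hδ, h⟩ := G.exists_delta_real ha (τ₀ := τ) ht
  refine ⟨(γ₂ t - γ₁ t) / 2 + δ / 2, by linarith, fun z h1 h2 => ?_⟩
  by_cases him : z.im = 0
  · have hz : z = ((z.re : ℝ) : ℂ) := Complex.ext (by simp) (by simp [him])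
    rw [hz, ← Complex.ofReal_sub, Complex.norm_real, Real.norm_eq_abs] at h1 h2
    rw [hz]
    refine h t ht τ _ (by simpa) (by simpa) ?_
    rcases le_total 0 (z.re - (a τ + (γ₁ t + γ₂ t) / 2)) with h3 | h3
    · rw [abs_of_nonneg h3] at h1 h2
      right
      rw [abs_lt]; constructor <;> linarith
    · rw [abs_of_nonpos h3] at h1 h2
      left
      rw [abs_lt]; constructor <;> linarith
  · exact G.mem_of_im_ne_zero ht him

/-- The two factors are integrated over concentric circles, `z` on the inner and `w` on the outer
one. By the resolvent identity `S(z) e S(w)` is `(S(z) - S(w)) / (w - z)`. The first part reproduces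
`2πi S(z)`; the second is holomorphic in `z` inside the outer circle and integrates to zero. -/
theorem proj_mul_const_mul_proj {t : ℝ} (τ : ℝ) (ht : t ∈ Icc (0 : ℝ) 1) :
    projJet e a P γ₁ γ₂ t τ * (const e * projJet e a P γ₁ γ₂ t τ) = projJet e a P γ₁ γ₂ t τ := by
  obtain ⟨r', hrr', hann⟩ := G.exists_larger_circle ha τ ht
  set c : ℂ := ((a τ + (γ₁ t + γ₂ t) / 2 : ℝ) : ℂ) with hc
  set r : ℝ := (γ₂ t - γ₁ t) / 2 with hr
  set S : ℂ → Jet B := fun z => solJet e a P t τ z with hS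
  set Q : Jet B := fun m j β => ∮ z in C(c, r), S z m j β with hQ
  have hr0 : 0 < r := by rw [hr]; linarith [G.lt t ht]
  have hr0' : 0 < r' := hr0.trans hrr'
  set U : Set ℂ := {z | (t, τ, z) ∈ unitSet e a P} with hU
  have hUo : IsOpen U := G.isOpen_slice ha ht
  have hSd : ∀ m j β, DifferentiableOn ℂ (fun z => S z m j β) U := differentiableOn_solJet t τ
  have hsph : ∀ z ∈ Metric.sphere c r, z ∈ U := fun z hz => by
    rw [mem_sphere_iff_norm] at hz
    exact hann z hz.ge (hz.le.trans hrr'.le)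
  have hsph' : ∀ z ∈ Metric.sphere c r', z ∈ U := fun z hz => by
    rw [mem_sphere_iff_norm] at hz
    exact hann z (hrr'.le.trans hz.ge) hz.le
  have hi : ∀ m j β, CircleIntegrable (fun z => S z m j β) c r := fun m j β =>
    ((hSd m j β).continuousOn.mono hsph).circleIntegrable hr0.le
  have hi' : ∀ m j β, CircleIntegrable (fun z => S z m j β) c r' := fun m j β =>
    ((hSd m j β).continuousOn.mono hsph').circleIntegrable hr0'.le
  -- The contour is enlarged across the annulus of holomorphy.
  have hQ' : ∀ m j β, Q m j β = ∮ z in C(c, r'), S z m j β := fun m j β => by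
    refine (Complex.circleIntegral_eq_of_differentiable_on_annulus_off_countable hr0 hrr'.le
      countable_empty ((hSd m j β).continuousOn.mono ?_) ?_).symm
    · rintro z ⟨h1, h2⟩
      rw [mem_closedBall_iff_norm] at h1
      rw [mem_ball_iff_norm, not_lt] at h2
      exact hann z h2 h1
    · rintro z ⟨⟨h1, h2⟩, -⟩
      rw [mem_ball_iff_norm] at h1
      rw [mem_closedBall_iff_norm, not_le] at h2
      exact (hSd m j β).differentiableAt (hUo.mem_nhds (hann z h2.le h1.le))
  have hinner : ∀ z ∈ Metric.sphere c r, ∀ m j β, (S z * (const e * Q)) m j β =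
      (2 * (Real.pi : ℂ) * Complex.I) • S z m j β - ∮ w in C(c, r'), (w - z)⁻¹ • S w m j β := by
    intro z hz m j β
    have hzb : z ∈ Metric.ball c r' := by
      rw [mem_sphere_iff_norm] at hz
      rw [mem_ball_iff_norm, hz]; exact hrr'
    have hne : ∀ w ∈ Metric.sphere c r', w - z ≠ 0 := fun w hw h0 => by
      rw [sub_eq_zero] at h0
      rw [h0, mem_sphere_iff_norm] at hw
      rw [mem_ball_iff_norm] at hzb
      exact hzb.ne hw
    have hcinv : ContinuousOn (fun w : ℂ => (w - z)⁻¹) (Metric.sphere c r') :=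
      (continuousOn_id.sub continuousOn_const).inv₀ hne
    have j1 : CircleIntegrable (fun w => (w - z)⁻¹ • S z m j β) c r' :=
      (hcinv.smul continuousOn_const).circleIntegrable hr0'.le
    have j2 : CircleIntegrable (fun w => (w - z)⁻¹ • S w m j β) c r' :=
      (hcinv.smul ((hSd m j β).continuousOn.mono hsph')).circleIntegrable hr0'.le
    rw [← mul_assoc, (mul_circleIntegral c r' m j β (S z * const e) S Q hi' hQ').2,
      ← circleIntegral.integral_sub_inv_of_mem_ball hzb, ← circleIntegral.integral_smul_const,
      ← circleIntegral.integral_sub j1 j2]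
    refine circleIntegral.integral_congr hr0'.le fun w hw => ?_
    have h3 := sol_sub_sol (hsph z hz) (hsph' w hw)
    have h4 : S z m j β - S w m j β = (w - z) • (S z * const e * S w) m j β :=
      congrArg (fun p : Jet B => p m j β) h3
    rw [← smul_sub, h4, smul_smul, inv_mul_cancel₀ (hne w hw), one_smul]
  have hmain : Q * (const e * Q) = (2 * (Real.pi : ℂ) * Complex.I) • Q := by
    ext m j β
    rw [(circleIntegral_mul c r m j β S Q (const e * Q) hi (fun _ _ _ => rfl)).2,
      circleIntegral.integral_congr hr0.le (fun z hz => hinner z hz m j β)]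
    have hd := differentiableOn_cauchyTransform hr0' (hi' m j β)
    have hsub : Metric.closedBall c r ⊆ Metric.ball c r' := Metric.closedBall_subset_ball hrr'
    have hcont := hd.continuousOn.mono hsub
    -- Cauchy's theorem for the Cauchy transform over the outer circle, which is holomorphic near
    -- the closed inner disc even though `S` need not be.
    have hz0 : ∮ z in C(c, r), (∮ w in C(c, r'), (w - z)⁻¹ • S w m j β) = 0 :=
      Complex.circleIntegral_eq_zero_of_differentiable_on_off_countable hr0.le countable_empty
        hcont fun z hz => hd.differentiableAt
          (Metric.isOpen_ball.mem_nhds (hsub (Metric.ball_subset_closedBall hz.1)))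
    have k1 : CircleIntegrable (fun z => (2 * (Real.pi : ℂ) * Complex.I) • S z m j β) c r :=
      (((hSd m j β).continuousOn.mono hsph).const_smul _).circleIntegrable hr0.le
    rw [circleIntegral.integral_sub k1
      ((hcont.mono Metric.sphere_subset_closedBall).circleIntegrable hr0.le), hz0, sub_zero,
      circleIntegral.integral_smul]
    rfl
  have h1 : projJet e a P γ₁ γ₂ t τ = (2 * (Real.pi : ℂ) * Complex.I)⁻¹ • Q := rfl
  rw [h1, mul_smul_comm, mul_smul_comm, smul_mul_assoc, hmain, smul_smul _ _ Q,
    inv_mul_cancel₀ Complex.two_pi_I_ne_zero, one_smul]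

/-- On the translated circle `z - a(τ)` no longer depends on `τ`. What remains is a continuous
function of `t` and the angle on a compact set, hence a bound uniform over all real `τ`. -/
theorem exists_resolvent_bound : ∃ M > 0, ∀ t ∈ Icc (0 : ℝ) 1, ∀ τ z,
    z ∈ Metric.sphere ((a τ + (γ₁ t + γ₂ t) / 2 : ℝ) : ℂ) ((γ₂ t - γ₁ t) / 2) →
    ‖Ring.inverse (symJet e a P t τ z 0 0 0)‖ ≤ M := by
  set p : ℝ × ℝ → B := fun x =>
    circleMap (((γ₁ x.1 + γ₂ x.1) / 2 : ℝ) : ℂ) ((γ₂ x.1 - γ₁ x.1) / 2) x.2 • e - P x.1 with hp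
  have hγ₁ : ContinuousOn (fun x : ℝ × ℝ => γ₁ x.1) (Icc (0 : ℝ) 1 ×ˢ Icc 0 (2 * Real.pi)) :=
    G.cont₁.comp continuousOn_fst fun x hx => hx.1
  have hγ₂ : ContinuousOn (fun x : ℝ × ℝ => γ₂ x.1) (Icc (0 : ℝ) 1 ×ˢ Icc 0 (2 * Real.pi)) :=
    G.cont₂.comp continuousOn_fst fun x hx => hx.1
  have hPc : ContinuousOn (fun x : ℝ × ℝ => P x.1) (Icc (0 : ℝ) 1 ×ˢ Icc 0 (2 * Real.pi)) :=
    G.smooth.continuousOn.comp continuousOn_fst fun x hx => hx.1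
  have hpc : ContinuousOn p (Icc (0 : ℝ) 1 ×ˢ Icc 0 (2 * Real.pi)) := by
    have h1 : ContinuousOn (fun x : ℝ × ℝ => (((γ₁ x.1 + γ₂ x.1) / 2 : ℝ) : ℂ))
        (Icc (0 : ℝ) 1 ×ˢ Icc 0 (2 * Real.pi)) :=
      Complex.continuous_ofReal.comp_continuousOn ((hγ₁.add hγ₂).div_const 2)
    have h2 : ContinuousOn (fun x : ℝ × ℝ => (((γ₂ x.1 - γ₁ x.1) / 2 : ℝ) : ℂ))
        (Icc (0 : ℝ) 1 ×ˢ Icc 0 (2 * Real.pi)) :=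
      Complex.continuous_ofReal.comp_continuousOn ((hγ₂.sub hγ₁).div_const 2)
    have h3 : Continuous (fun x : ℝ × ℝ => Complex.exp (x.2 * Complex.I)) := by fun_prop
    exact ((h1.add (h2.mul h3.continuousOn)).smul continuousOn_const).sub hPc
  have hzsym : ∀ t τ : ℝ, ∀ θ, symJet e a P t τ
      (circleMap ((a τ + (γ₁ t + γ₂ t) / 2 : ℝ) : ℂ) ((γ₂ t - γ₁ t) / 2) θ) 0 0 0 = p (t, θ) := by
    intro t τ θ
    rw [symJet_zero]
    simp only [hp, circleMap]
    congr 2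
    push_cast; ring
  have hunit : ∀ x ∈ Icc (0 : ℝ) 1 ×ˢ Icc 0 (2 * Real.pi), IsUnit (p x) := by
    rintro ⟨t, θ⟩ ⟨ht, -⟩
    rw [← hzsym t 0 θ]
    exact (mem_unitSet.1 (G.sphere_subset ha 0 ht
      (circleMap_mem_sphere _ (by linarith [G.lt t ht]) θ))).2
  have hinv : ContinuousOn (fun x => Ring.inverse (p x)) (Icc (0 : ℝ) 1 ×ˢ Icc 0 (2 * Real.pi)) := by
    intro x hx
    obtain ⟨u, hu⟩ := hunit x hx
    have h1 := NormedRing.inverse_continuousAt u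
    rw [hu] at h1
    exact h1.comp_continuousWithinAt (hpc x hx)
  obtain ⟨M, hM⟩ := (isCompact_Icc.prod isCompact_Icc).exists_bound_of_continuousOn hinv
  refine ⟨max M 1, by positivity, fun t ht τ z hz => ?_⟩
  have hr : 0 ≤ (γ₂ t - γ₁ t) / 2 := by linarith [G.lt t ht]
  rw [← abs_of_nonneg hr, ← image_circleMap_Ioc] at hz
  obtain ⟨θ, hθ, rfl⟩ := hz
  rw [hzsym]
  exact (hM (t, θ) ⟨ht, hθ.1.le, hθ.2⟩).trans (le_max_left _ _)

/-- Because `γ₁` and `γ₂` are merely continuous, the moving contour cannot be differentiated; near a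
given point it is replaced by a fixed one. -/
theorem exists_fixed_contour {t₀ : ℝ} (τ₀ : ℝ) (ht₀ : t₀ ∈ Icc (0 : ℝ) 1) : ∃ δ > 0,
    ∀ t ∈ Icc (0 : ℝ) 1, ∀ τ : ℝ, |t - t₀| < δ → |τ - τ₀| < δ →
    (∀ θ, (t, τ, circleMap ((a τ₀ + (γ₁ t₀ + γ₂ t₀) / 2 : ℝ) : ℂ) ((γ₂ t₀ - γ₁ t₀) / 2) θ)
      ∈ unitSet e a P) ∧
    ∀ m j β, projJet e a P γ₁ γ₂ t τ m j β = (2 * (Real.pi : ℂ) * Complex.I)⁻¹ •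
      ∮ z in C(((a τ₀ + (γ₁ t₀ + γ₂ t₀) / 2 : ℝ) : ℂ), (γ₂ t₀ - γ₁ t₀) / 2),
        solJet e a P t τ z m j β := by
  obtain ⟨δ, hδ, h⟩ := G.exists_delta_circle ha τ₀ ht₀
  refine ⟨δ, hδ, fun t ht τ h1 h2 => ⟨fun θ => by simpa using h t ht τ h1 h2 0 (by simp) θ,
    fun m j β => ?_⟩⟩
  rw [projJet, circleIntegral_eq_of_forall_mem (G.isOpen_slice ha ht)
    (differentiableOn_solJet t τ m j β) (h t ht τ h1 h2)]

/-- On the frozen contour only the integrand depends on `(t, τ)`, and its derivatives are the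
neighbouring entries of `solJet`. -/
theorem projJet_regularity {t₀ : ℝ} (τ₀ : ℝ) (ht₀ : t₀ ∈ Icc (0 : ℝ) 1) (m j β : ℕ) :
    HasDerivWithinAt (fun t => projJet e a P γ₁ γ₂ t τ₀ m j β)
      (projJet e a P γ₁ γ₂ t₀ τ₀ m (j + 1) β) (Icc 0 1) t₀ ∧
    HasDerivAt (fun τ => projJet e a P γ₁ γ₂ t₀ τ m j β)
      (projJet e a P γ₁ γ₂ t₀ τ₀ m j (β + 1)) τ₀ ∧
    ContinuousWithinAt (fun x : ℝ × ℝ => projJet e a P γ₁ γ₂ x.1 x.2 m j β)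
      (Icc 0 1 ×ˢ univ) (t₀, τ₀) := by
  obtain ⟨δ, hδ, h⟩ := G.exists_fixed_contour ha τ₀ ht₀
  set c : ℂ := ((a τ₀ + (γ₁ t₀ + γ₂ t₀) / 2 : ℝ) : ℂ) with hc
  set r : ℝ := (γ₂ t₀ - γ₁ t₀) / 2 with hr
  set κ : ℂ := (2 * (Real.pi : ℂ) * Complex.I)⁻¹ with hκ
  have hpi : (0 : ℝ) ≤ 2 * Real.pi := by positivity
  set W : Set (ℝ × ℝ) := (Icc 0 1 ∩ Metric.ball t₀ δ) ×ˢ Metric.ball τ₀ δ with hW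
  set g : ℕ → ℕ → ℝ × ℝ → ℝ → B := fun j β x θ =>
    (circleMap 0 r θ * Complex.I) • solJet e a P x.1 x.2 (circleMap c r θ) m j β with hg
  have hgc : ∀ j β, ContinuousOn (Function.uncurry (g j β)) (W ×ˢ Icc 0 (2 * Real.pi)) := by
    intro j β
    have h1 : ContinuousOn (fun y : (ℝ × ℝ) × ℝ =>
        solJet e a P y.1.1 y.1.2 (circleMap c r y.2) m j β) (W ×ˢ Icc 0 (2 * Real.pi)) := by
      refine (contDiffOn_solJet (e := e) ha G.smooth m j β).continuousOn.comp
        (f := fun y : (ℝ × ℝ) × ℝ => (y.1.1, y.1.2, circleMap c r y.2)) ?_ ?_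
      · simp only [circleMap]; fun_prop
      · rintro ⟨⟨t, τ⟩, θ⟩ ⟨⟨⟨h1, h2⟩, h3⟩, -⟩
        exact (h t h1 τ h2 h3).1 θ
    refine ContinuousOn.smul ?_ h1
    simp only [circleMap]; fun_prop
  have hproj : ∀ j β, ∀ x ∈ W, projJet e a P γ₁ γ₂ x.1 x.2 m j β
      = κ • ∫ θ in (0 : ℝ)..(2 * Real.pi), g j β x θ := by
    rintro j β ⟨t, τ⟩ ⟨⟨h1, h2⟩, h3⟩
    rw [(h t h1 τ h2 h3).2 m j β, circleIntegral]
    simp only [deriv_circleMap, hg]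
  have hx₀ : (t₀, τ₀) ∈ W := ⟨⟨ht₀, Metric.mem_ball_self hδ⟩, Metric.mem_ball_self hδ⟩
  have hgθ : ∀ j β, ∀ x ∈ W, ContinuousOn (g j β x) (Icc 0 (2 * Real.pi)) := fun j β x hx =>
    (hgc j β).comp (f := fun θ => (x, θ)) (by fun_prop) fun θ hθ => ⟨hx, hθ⟩
  refine ⟨?_, ?_, ?_⟩
  · have h1 : HasDerivWithinAt (fun t => ∫ θ in (0 : ℝ)..(2 * Real.pi), g j β (t, τ₀) θ)
        (∫ θ in (0 : ℝ)..(2 * Real.pi), g (j + 1) β (t₀, τ₀) θ) (Icc 0 1 ∩ Metric.ball t₀ δ) t₀ := by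
      refine hasDerivWithinAt_intervalIntegral ((convex_Icc _ _).inter (convex_ball _ _)) hx₀.1 hpi
        (fun t ht => hgθ j β _ ⟨ht, hx₀.2⟩) (fun t ht θ _ => ?_)
        (g' := fun t θ => g (j + 1) β (t, τ₀) θ)
        ((hgc (j + 1) β).comp (f := fun y : ℝ × ℝ => ((y.1, τ₀), y.2)) (by fun_prop)
          fun y hy => ⟨⟨hy.1, hx₀.2⟩, hy.2⟩)
      exact ((hasDerivWithinAt_solJet_time ha G.smooth
        ((h t ht.1 τ₀ ht.2 (by simpa)).1 θ) m j β).fun_const_smul _).mono inter_subset_left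
    have h2 : Icc 0 1 ∩ Metric.ball t₀ δ ∈ 𝓝[Icc 0 1] t₀ :=
      inter_mem_nhdsWithin _ (Metric.ball_mem_nhds t₀ hδ)
    have h3 : ∀ j β, ∀ t ∈ Icc 0 1 ∩ Metric.ball t₀ δ, projJet e a P γ₁ γ₂ t τ₀ m j β
        = κ • ∫ θ in (0 : ℝ)..(2 * Real.pi), g j β (t, τ₀) θ :=
      fun j β t ht => hproj j β (t, τ₀) ⟨ht, hx₀.2⟩
    have h4 : HasDerivWithinAt (fun t => κ • ∫ θ in (0 : ℝ)..(2 * Real.pi), g j β (t, τ₀) θ)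
        (projJet e a P γ₁ γ₂ t₀ τ₀ m (j + 1) β) (Icc 0 1) t₀ := by
      rw [h3 (j + 1) β t₀ hx₀.1]
      exact (h1.mono_of_mem_nhdsWithin h2).fun_const_smul κ
    exact h4.congr_of_eventuallyEq (Filter.eventually_of_mem h2 (h3 j β)) (h3 j β t₀ hx₀.1)
  · have h1 : HasDerivWithinAt (fun τ => ∫ θ in (0 : ℝ)..(2 * Real.pi), g j β (t₀, τ) θ)
        (∫ θ in (0 : ℝ)..(2 * Real.pi), g j (β + 1) (t₀, τ₀) θ) (Metric.ball τ₀ δ) τ₀ := by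
      refine hasDerivWithinAt_intervalIntegral (convex_ball _ _) hx₀.2 hpi
        (fun τ hτ => hgθ j β _ ⟨hx₀.1, hτ⟩) (fun τ hτ θ _ => ?_)
        (g' := fun τ θ => g j (β + 1) (t₀, τ) θ)
        ((hgc j (β + 1)).comp (f := fun y : ℝ × ℝ => ((t₀, y.1), y.2)) (by fun_prop)
          fun y hy => ⟨⟨hx₀.1, hy.1⟩, hy.2⟩)
      exact ((hasDerivAt_solJet_freq ha G.smooth
        ((h t₀ ht₀ τ (by simpa) hτ).1 θ) m j β).hasDerivWithinAt.fun_const_smul _)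
    have h2 : Metric.ball τ₀ δ ∈ 𝓝 τ₀ := Metric.ball_mem_nhds τ₀ hδ
    have h3 : ∀ j β, ∀ τ ∈ Metric.ball τ₀ δ, projJet e a P γ₁ γ₂ t₀ τ m j β
        = κ • ∫ θ in (0 : ℝ)..(2 * Real.pi), g j β (t₀, τ) θ :=
      fun j β τ hτ => hproj j β (t₀, τ) ⟨hx₀.1, hτ⟩
    have h4 : HasDerivAt (fun τ => κ • ∫ θ in (0 : ℝ)..(2 * Real.pi), g j β (t₀, τ) θ)
        (projJet e a P γ₁ γ₂ t₀ τ₀ m j (β + 1)) τ₀ := by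
      rw [h3 j (β + 1) τ₀ hx₀.2]
      exact (h1.hasDerivAt h2).fun_const_smul κ
    exact h4.congr_of_eventuallyEq (Filter.eventually_of_mem h2 (h3 j β))
  · have h1 : ContinuousWithinAt (fun x => κ • ∫ θ in (0 : ℝ)..(2 * Real.pi), g j β x θ) W
        (t₀, τ₀) := (continuousOn_intervalIntegral hpi (hgc j β)).const_smul κ (t₀, τ₀) hx₀
    have h2 : W ∈ 𝓝[Icc 0 1 ×ˢ univ] (t₀, τ₀) := by
      rw [nhdsWithin_prod_eq, nhdsWithin_univ]
      exact Filter.prod_mem_prod (inter_mem_nhdsWithin _ (Metric.ball_mem_nhds t₀ hδ))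
        (Metric.ball_mem_nhds τ₀ hδ)
    exact (h1.mono_of_mem_nhdsWithin h2).congr_of_eventuallyEq
      (Filter.eventually_of_mem h2 (hproj j β)) (hproj j β (t₀, τ₀) hx₀)

theorem contDiffOn_projJet (m j β : ℕ) :
    ContDiffOn ℝ ∞ (fun x : ℝ × ℝ => projJet e a P γ₁ γ₂ x.1 x.2 m j β) (Icc 0 1 ×ˢ univ) :=
  contDiffOn_of_partials (convex_Icc 0 1) (uniqueDiffOn_Icc one_pos)
    (F := fun j β t τ => projJet e a P γ₁ γ₂ t τ m j β)
    (fun j β _ ht τ => (G.projJet_regularity ha τ ht m j β).1)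
    (fun j β _ ht τ => (G.projJet_regularity ha τ ht m j β).2.1)
    (fun j β x hx => (G.projJet_regularity ha x.2 hx.1 m j β).2.2) j β

end SpectralGap

end Projector

/-! ### From jets to operator-valued symbols -/

section Translation

open Jet

variable {B : Type*} [NormedRing B] [NormedAlgebra ℂ B]
variable {E F G : Type*} [NormedAddCommGroup E] [NormedSpace ℂ E]
  [NormedAddCommGroup F] [NormedSpace ℂ F] [NormedAddCommGroup G] [NormedSpace ℂ G]

/-- A field of jets on a relatively open subset of `[0,1] × ℝ` whose entries are the successive
derivatives of each other. -/
structure IsJetField (V : Set (ℝ × ℝ)) (p : ℝ → ℝ → Jet B) : Prop where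
  subset : ∀ x ∈ V, x.1 ∈ Icc (0 : ℝ) 1
  nhds : ∀ x ∈ V, ∀ᶠ y in 𝓝[Icc 0 1 ×ˢ univ] x, y ∈ V
  time : ∀ t τ, (t, τ) ∈ V → ∀ m j β,
    HasDerivWithinAt (fun t' => p t' τ m j β) (p t τ m (j + 1) β) (Icc 0 1) t
  freq : ∀ t τ, (t, τ) ∈ V → ∀ m j β,
    HasDerivAt (fun τ' => p t τ' m j β) (p t τ m j (β + 1)) τ

namespace IsJetField

variable {V : Set (ℝ × ℝ)} {p : ℝ → ℝ → Jet B}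

theorem iteratedDeriv_eq (hp : IsJetField V p) (L : B →L[ℂ] E →L[ℂ] F) {f : ℝ → ℝ → E →L[ℂ] F}
    {k : ℕ} (hf : ∀ t τ, (t, τ) ∈ V → f t τ = L (p t τ k 0 0)) (β : ℕ) {t τ : ℝ}
    (h : (t, τ) ∈ V) : iteratedDeriv β (f t) τ = L (p t τ k 0 β) := by
  refine iteratedDeriv_eq_of_chain (V := {τ | (t, τ) ∈ V}) (F := fun β τ => L (p t τ k 0 β))
    (fun τ hτ => ?_) (fun τ hτ => hf t τ hτ) (fun β τ hτ => ?_) β h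
  · have h1 : Filter.Tendsto (fun τ' : ℝ => (t, τ')) (𝓝[univ] τ) (𝓝[Icc 0 1 ×ˢ univ] (t, τ)) :=
      (Continuous.continuousWithinAt (by fun_prop)).tendsto_nhdsWithin
        (fun y _ => ⟨hp.subset (t, τ) hτ, mem_univ y⟩)
    rw [nhdsWithin_univ] at h1
    exact h1.eventually (hp.nhds _ hτ)
  · exact (L.restrictScalars ℝ).hasFDerivAt.comp_hasDerivAt τ (hp.freq t τ hτ k 0 β)

theorem iteratedDerivWithin_eq (hp : IsJetField V p) (L : B →L[ℂ] E →L[ℂ] F)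
    {f : ℝ → ℝ → E →L[ℂ] F} {k : ℕ} (hf : ∀ t τ, (t, τ) ∈ V → f t τ = L (p t τ k 0 0))
    (j β : ℕ) {t τ : ℝ} (h : (t, τ) ∈ V) :
    iteratedDerivWithin j (fun t' => iteratedDeriv β (f t') τ) (Icc 0 1) t
      = L (p t τ k j β) := by
  refine iteratedDerivWithin_eq_of_chain (V := {t | (t, τ) ∈ V})
    (F := fun j t => L (p t τ k j β)) (uniqueDiffOn_Icc one_pos) (fun t ht => hp.subset _ ht)
    (fun t ht => ?_) (fun t ht => hp.iteratedDeriv_eq L hf β ht) (fun j t ht => ?_) j h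
  · have h1 : Filter.Tendsto (fun t' : ℝ => (t', τ)) (𝓝[Icc 0 1] t) (𝓝[Icc 0 1 ×ˢ univ] (t, τ)) :=
      (Continuous.continuousWithinAt (by fun_prop)).tendsto_nhdsWithin
        (fun y hy => ⟨hy, mem_univ τ⟩)
    exact h1.eventually (hp.nhds _ ht)
  · exact (L.restrictScalars ℝ).hasFDerivAt.comp_hasDerivWithinAt t (hp.time t τ ht k j β)

end IsJetField

/-- The maps `Φ₁`, `Φ₂`, `Φ` place the three operator spaces inside `B` compatibly with composition.
The binomials of the jet product then cancel against the factorials `k!`, leaving the `1/α!` of the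
symbol product. -/
theorem mul_entry_eq_symbolProd (Φ₁ : (F →L[ℂ] G) →ₗ[ℂ] B) (Φ₂ : (E →L[ℂ] F) →ₗ[ℂ] B)
    (Φ : (E →L[ℂ] G) →ₗ[ℂ] B) (hΦ : ∀ u v, Φ (u.comp v) = Φ₁ u * Φ₂ v)
    {p : ℕ → ℝ → ℝ → F →L[ℂ] G} {q : ℕ → ℝ → ℝ → E →L[ℂ] F} {p' q' : Jet B} {t τ : ℝ}
    (hp : ∀ k α, ((k ! : ℕ) : ℂ)⁻¹ • p' k 0 α = Φ₁ (iteratedDeriv α (fun τ' => p k t τ') τ))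
    (hq : ∀ k α, ((k ! : ℕ) : ℂ)⁻¹ • q' k α 0
      = Φ₂ (iteratedDerivWithin α (fun t' => q k t' τ) (Icc 0 1) t)) (m : ℕ) :
    Φ (symbolProd p q m t τ) = ((m ! : ℕ) : ℂ)⁻¹ • (p' * q') m 0 0 := by
  rw [mul_apply_entry_zero, symbolProd, map_sum, Finset.smul_sum]
  refine Finset.sum_congr rfl fun x hx => ?_
  rw [map_sum, Finset.smul_sum, Finset.smul_sum]
  refine Finset.sum_congr rfl fun y hy => ?_
  rw [Finset.HasAntidiagonal.mem_antidiagonal] at hx hy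
  rw [map_smul, hΦ, ← hp, ← hq, smul_mul_smul_comm, ← Nat.cast_smul_eq_nsmul ℂ,
    ← Nat.cast_smul_eq_nsmul ℂ, smul_smul, smul_smul, smul_smul, smul_smul]
  congr 1
  have e1 : ((x.1 + x.2).choose x.1 : ℂ) * (x.1)! * (x.2)! = (x.1 + x.2)! := by
    have := Nat.choose_mul_factorial_mul_factorial (Nat.le_add_right x.1 x.2)
    rw [Nat.add_sub_cancel_left] at this
    exact_mod_cast this
  have e2 : ((y.1 + y.2).choose y.1 : ℂ) * (y.1)! * (y.2)! = (y.1 + y.2)! := by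
    have := Nat.choose_mul_factorial_mul_factorial (Nat.le_add_right y.1 y.2)
    rw [Nat.add_sub_cancel_left] at this
    exact_mod_cast this
  rw [hx] at e1
  rw [hy] at e2
  have n0 : ∀ n : ℕ, ((n ! : ℕ) : ℂ) ≠ 0 := fun n => by exact_mod_cast n.factorial_ne_zero
  rw [← e1, ← e2]
  have c1 : (m.choose x.1 : ℂ) ≠ 0 := by
    intro h; rw [h, zero_mul, zero_mul] at e1; exact n0 m e1.symm
  have c2 : (x.2.choose y.1 : ℂ) ≠ 0 := by
    intro h; rw [h, zero_mul, zero_mul] at e2; exact n0 x.2 e2.symm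
  have := n0 x.1
  have := n0 y.1
  have := n0 y.2
  field_simp

/-- A formal symbol with the jets `p'`, in the coordinates given by `L`. -/
def HasJets (V : Set (ℝ × ℝ)) (L : B →L[ℂ] E →L[ℂ] F) (p' : ℝ → ℝ → Jet B)
    (p : ℕ → ℝ → ℝ → E →L[ℂ] F) : Prop :=
  ∀ k t τ, (t, τ) ∈ V → p k t τ = ((k ! : ℕ) : ℂ)⁻¹ • L (p' t τ k 0 0)

theorem HasJets.iteratedDerivWithin_eq {V : Set (ℝ × ℝ)} {L : B →L[ℂ] E →L[ℂ] F}
    {p' : ℝ → ℝ → Jet B} {p : ℕ → ℝ → ℝ → E →L[ℂ] F} (h : HasJets V L p' p)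
    (hp' : IsJetField V p') (k j β : ℕ) {t τ : ℝ} (hx : (t, τ) ∈ V) :
    iteratedDerivWithin j (fun t' => iteratedDeriv β (p k t') τ) (Icc 0 1) t
      = ((k ! : ℕ) : ℂ)⁻¹ • L (p' t τ k j β) :=
  hp'.iteratedDerivWithin_eq (((k ! : ℕ) : ℂ)⁻¹ • L) (h k) j β hx

theorem HasJets.symbolProd_eq {V : Set (ℝ × ℝ)}
    {L₁ : B →L[ℂ] F →L[ℂ] G} {L₂ : B →L[ℂ] E →L[ℂ] F} {p' q' : ℝ → ℝ → Jet B}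
    {p : ℕ → ℝ → ℝ → F →L[ℂ] G} {q : ℕ → ℝ → ℝ → E →L[ℂ] F}
    (hp : HasJets V L₁ p' p) (hq : HasJets V L₂ q' q)
    (hp' : IsJetField V p') (hq' : IsJetField V q')
    (Φ₁ : (F →L[ℂ] G) →ₗ[ℂ] B) (Φ₂ : (E →L[ℂ] F) →ₗ[ℂ] B) (Φ : (E →L[ℂ] G) →ₗ[ℂ] B)
    (h₁ : ∀ b, Φ₁ (L₁ b) = b) (h₂ : ∀ b, Φ₂ (L₂ b) = b)
    (hΦ : ∀ u v, Φ (u.comp v) = Φ₁ u * Φ₂ v) (m : ℕ) {t τ : ℝ} (hx : (t, τ) ∈ V) :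
    Φ (symbolProd p q m t τ) = ((m ! : ℕ) : ℂ)⁻¹ • (p' t τ * q' t τ) m 0 0 := by
  refine mul_entry_eq_symbolProd Φ₁ Φ₂ Φ hΦ (fun k α => ?_) (fun k α => ?_) m
  · have := hp.iteratedDerivWithin_eq hp' k 0 α hx
    rw [iteratedDerivWithin_zero] at this
    change iteratedDeriv α (fun τ' => p k t τ') τ = _ at this
    rw [this, map_smul, h₁]
  · have := hq.iteratedDerivWithin_eq hq' k α 0 hx
    simp only [iteratedDeriv_zero] at this
    rw [this, map_smul, h₂]

end Translation

/-! ### The symbol, its inverse and the projector as jet fields -/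

section JetFields

open Jet

variable {B : Type*} [NormedRing B] [NormedAlgebra ℂ B] [CompleteSpace B]
variable {e : B} {a : ℝ → ℝ} {P : ℝ → B} {γ₁ γ₂ : ℝ → ℝ}

theorem isJetField_symJet (ha : ContDiff ℝ ∞ a) (hP : ContDiffOn ℝ ∞ P (Icc 0 1)) (z : ℂ) :
    IsJetField (Icc 0 1 ×ˢ univ) (fun t τ => symJet e a P t τ z) where
  subset _ hx := hx.1
  nhds _ _ := self_mem_nhdsWithin
  time _ τ h := hasDerivWithinAt_symJet_time hP h.1 τ z
  freq t τ _ := hasDerivAt_symJet_freq ha t τ z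

theorem hamJet_eq_neg_symJet (t τ : ℝ) : hamJet e a P t τ = -symJet e a P t τ 0 := by
  rw [symJet, zero_smul, zero_sub, neg_neg]

theorem IsJetField.neg {V : Set (ℝ × ℝ)} {p : ℝ → ℝ → Jet B} (hp : IsJetField V p) :
    IsJetField V (fun t τ => -p t τ) where
  subset := hp.subset
  nhds := hp.nhds
  time t τ h m j β := (hp.time t τ h m j β).neg
  freq t τ h m j β := (hp.freq t τ h m j β).neg

theorem IsJetField.const_mul {V : Set (ℝ × ℝ)} {p : ℝ → ℝ → Jet B} (hp : IsJetField V p) (b : B) :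
    IsJetField V (fun t τ => const b * p t τ) where
  subset := hp.subset
  nhds := hp.nhds
  time t τ h m j β := by simpa only [const_mul_apply] using (hp.time t τ h m j β).const_mul b
  freq t τ h m j β := by simpa only [const_mul_apply] using (hp.freq t τ h m j β).const_mul b

theorem IsJetField.mono {V W : Set (ℝ × ℝ)} {p : ℝ → ℝ → Jet B} (hp : IsJetField V p)
    (hW : W ⊆ V) (hn : ∀ x ∈ W, ∀ᶠ y in 𝓝[Icc 0 1 ×ˢ univ] x, y ∈ W) : IsJetField W p where
  subset x hx := hp.subset x (hW hx)
  nhds := hn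
  time t τ h := hp.time t τ (hW h)
  freq t τ h := hp.freq t τ (hW h)

theorem isJetField_hamJet (ha : ContDiff ℝ ∞ a) (hP : ContDiffOn ℝ ∞ P (Icc 0 1)) :
    IsJetField (Icc 0 1 ×ˢ univ) (hamJet e a P) := by
  have h : hamJet e a P = fun t τ => -symJet e a P t τ 0 := by
    ext1 t; ext1 τ; exact hamJet_eq_neg_symJet t τ
  rw [h]
  exact (isJetField_symJet ha hP 0).neg

theorem isJetField_solJet (ha : ContDiff ℝ ∞ a) (hP : ContDiffOn ℝ ∞ P (Icc 0 1)) (z : ℂ) :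
    IsJetField {x | (x.1, x.2, z) ∈ unitSet e a P} (fun t τ => solJet e a P t τ z) where
  subset _ hx := hx.1
  nhds x hx := by
    have h1 : Filter.Tendsto (fun y : ℝ × ℝ => (y.1, y.2, z)) (𝓝[Icc 0 1 ×ˢ univ] x)
        (𝓝[{x | x.1 ∈ Icc (0 : ℝ) 1}] (x.1, x.2, z)) :=
      (Continuous.continuousWithinAt (by fun_prop)).tendsto_nhdsWithin (fun y hy => hy.1)
    exact h1.eventually (eventually_mem_unitSet ha hP hx)
  time _ _ h := hasDerivWithinAt_solJet_time ha hP h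
  freq _ _ h := hasDerivAt_solJet_freq ha hP h

theorem SpectralGap.isJetField_projJet (G : SpectralGap e P γ₁ γ₂) (ha : ContDiff ℝ ∞ a) :
    IsJetField (Icc 0 1 ×ˢ univ) (projJet e a P γ₁ γ₂) where
  subset _ hx := hx.1
  nhds _ _ := self_mem_nhdsWithin
  time _ τ h m j β := (G.projJet_regularity ha τ h.1 m j β).1
  freq _ τ h m j β := (G.projJet_regularity ha τ h.1 m j β).2.1

end JetFields

theorem ContDiffOn.complex_clm_comp {X Y Z : Type*} [NormedAddCommGroup X] [NormedSpace ℂ X]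
    [NormedAddCommGroup Y] [NormedSpace ℂ Y] [NormedAddCommGroup Z] [NormedSpace ℝ Z]
    (L : X →L[ℂ] Y) {f : Z → X} {s : Set Z} {n : WithTop ℕ∞} (hf : ContDiffOn ℝ n f s) :
    ContDiffOn ℝ n (fun z => L (f z)) s :=
  (L.restrictScalars ℝ).contDiff.comp_contDiffOn hf

theorem DifferentiableOn.const_clm_comp {X Y Z : Type*} [NormedAddCommGroup X] [NormedSpace ℂ X]
    [NormedAddCommGroup Y] [NormedSpace ℂ Y] [NormedAddCommGroup Z] [NormedSpace ℂ Z]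
    (L : X →L[ℂ] Y) {f : Z → X} {s : Set Z} (hf : DifferentiableOn ℂ f s) :
    DifferentiableOn ℂ (fun z => L (f z)) s :=
  L.differentiable.comp_differentiableOn hf

/-! ### Transport to the algebra of bounded operators on `H` -/

section Operators

open Jet

variable {H D : Type*} [NormedAddCommGroup H] [InnerProductSpace ℂ H] [CompleteSpace H]
  [NormedAddCommGroup D] [NormedSpace ℂ D]
variable (Λ : D ≃L[ℂ] H) (ι : D →L[ℂ] H) (a : ℝ → ℝ) (P : ℝ → D →L[ℂ] H)

/-- Transport of an operator `D → H` to an operator on `H`. -/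
def toEnd (Λ : D ≃L[ℂ] H) (T : D →L[ℂ] H) : H →L[ℂ] H := T.comp (Λ.symm : H →L[ℂ] D)

theorem isUnit_toEnd (T : D →L[ℂ] H) : IsUnit (toEnd Λ T) ↔ Function.Bijective T := by
  rw [ContinuousLinearMap.isUnit_iff_bijective]
  exact Function.Bijective.of_comp_iff T Λ.symm.bijective

theorem mem_ellipticSet_iff {x : ℝ × ℝ × ℂ} :
    x ∈ ellipticSet ι a P ↔ x ∈ unitSet (toEnd Λ ι) a (fun t => toEnd Λ (P t)) := by
  have h : (x.2.2 - (a x.2.1 : ℂ)) • toEnd Λ ι - toEnd Λ (P x.1)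
      = toEnd Λ ((x.2.2 - (a x.2.1 : ℂ)) • ι - P x.1) := by
    ext v; simp [toEnd]
  simp only [ellipticSet, unitSet, mem_ofPred_eq, operatorSpectrum, not_not, h, isUnit_toEnd]

theorem hasJets_sym (z : ℂ) (V : Set (ℝ × ℝ)) :
    HasJets V (ContinuousLinearMap.precomp H (Λ : D →L[ℂ] H))
      (fun t τ => symJet (toEnd Λ ι) a (fun t => toEnd Λ (P t)) t τ z)
      (principalSymbol fun t' τ' => z • ι - hamiltonSymbol ι a P t' τ') := by
  intro k t τ _
  rcases Nat.eq_zero_or_pos k with rfl | hk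
  · beta_reduce
    rw [symJet_zero]
    ext v
    simp [principalSymbol, hamiltonSymbol, toEnd, sub_smul, sub_sub]
  · ext v
    simp [principalSymbol, hk.ne', symJet, hamJet, tauJet, timeJet, const]

theorem hasJets_ham (V : Set (ℝ × ℝ)) :
    HasJets V (ContinuousLinearMap.precomp H (Λ : D →L[ℂ] H))
      (hamJet (toEnd Λ ι) a (fun t => toEnd Λ (P t))) (principalSymbol (hamiltonSymbol ι a P)) := by
  intro k t τ hx
  have h := hasJets_sym Λ ι a P 0 V k t τ hx
  have h1 : principalSymbol (hamiltonSymbol ι a P) k t τ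
      = -principalSymbol (fun t' τ' => (0 : ℂ) • ι - hamiltonSymbol ι a P t' τ') k t τ := by
    unfold principalSymbol; split_ifs <;> simp
  rw [h1, h, hamJet_eq_neg_symJet, Jet.neg_apply, map_neg, smul_neg]

/-- The passage from the entries of a jet to the coefficient of `h^j`, for operators `H → D`. -/
def liftCoeff (j : ℕ) : (H →L[ℂ] H) →L[ℂ] (H →L[ℂ] D) :=
  ((j ! : ℕ) : ℂ)⁻¹ • ContinuousLinearMap.postcomp H (Λ.symm : H →L[ℂ] D)

/-- The operators in the parametrix given by the jets of the inverse symbol. -/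
def parametrix (j : ℕ) (t τ : ℝ) (z : ℂ) : H →L[ℂ] D :=
  liftCoeff Λ j (solJet (toEnd Λ ι) a (fun t => toEnd Λ (P t)) t τ z j 0 0)

variable {Λ ι a P}

theorem toEnd_precomp (b : H →L[ℂ] H) :
    ContinuousLinearMap.precomp H (Λ.symm : H →L[ℂ] D)
      (ContinuousLinearMap.precomp H (Λ : D →L[ℂ] H) b) = b := by
  ext v; simp

theorem postcomp_postcomp_symm (b : H →L[ℂ] H) :
    ContinuousLinearMap.postcomp H (Λ : D →L[ℂ] H)
      (ContinuousLinearMap.postcomp H (Λ.symm : H →L[ℂ] D) b) = b := by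
  ext v; simp

theorem one_entry_zero (m : ℕ) :
    ((m ! : ℕ) : ℂ)⁻¹ • (1 : Jet (H →L[ℂ] H)) m 0 0 = if m = 0 then 1 else 0 := by
  rcases Nat.eq_zero_or_pos m with rfl | hm
  · simp [Jet.one_def, const]
  · simp [Jet.one_def, const, hm.ne']

theorem symbolProd_comp_right {V : Set (ℝ × ℝ)} {p' q' : ℝ → ℝ → Jet (H →L[ℂ] H)}
    {p : ℕ → ℝ → ℝ → D →L[ℂ] H} {q : ℕ → ℝ → ℝ → H →L[ℂ] D}
    (hp : HasJets V (ContinuousLinearMap.precomp H (Λ : D →L[ℂ] H)) p' p)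
    (hq : HasJets V (ContinuousLinearMap.postcomp H (Λ.symm : H →L[ℂ] D)) q' q)
    (hp' : IsJetField V p') (hq' : IsJetField V q') (m : ℕ) {t τ : ℝ} (hx : (t, τ) ∈ V) :
    symbolProd p q m t τ = ((m ! : ℕ) : ℂ)⁻¹ • (p' t τ * q' t τ) m 0 0 :=
  hp.symbolProd_eq hq hp' hq' (ContinuousLinearMap.precomp H (Λ.symm : H →L[ℂ] D)).toLinearMap
    (ContinuousLinearMap.postcomp H (Λ : D →L[ℂ] H)).toLinearMap LinearMap.id
    toEnd_precomp postcomp_postcomp_symm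
    (fun u v => by ext w; simp) m hx

theorem symbolProd_comp_left {V : Set (ℝ × ℝ)} {p' q' : ℝ → ℝ → Jet (H →L[ℂ] H)}
    {p : ℕ → ℝ → ℝ → H →L[ℂ] D} {q : ℕ → ℝ → ℝ → D →L[ℂ] H}
    (hp : HasJets V (ContinuousLinearMap.postcomp H (Λ.symm : H →L[ℂ] D)) p' p)
    (hq : HasJets V (ContinuousLinearMap.precomp H (Λ : D →L[ℂ] H)) q' q)
    (hp' : IsJetField V p') (hq' : IsJetField V q') (m : ℕ) {t τ : ℝ} (hx : (t, τ) ∈ V) :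
    ((Λ : D →L[ℂ] H).comp (symbolProd p q m t τ)).comp (Λ.symm : H →L[ℂ] D)
      = ((m ! : ℕ) : ℂ)⁻¹ • (p' t τ * q' t τ) m 0 0 :=
  hp.symbolProd_eq hq hp' hq' (ContinuousLinearMap.postcomp H (Λ : D →L[ℂ] H)).toLinearMap
    (ContinuousLinearMap.precomp H (Λ.symm : H →L[ℂ] D)).toLinearMap
    ((ContinuousLinearMap.precomp H (Λ.symm : H →L[ℂ] D)).comp
      (ContinuousLinearMap.postcomp D (Λ : D →L[ℂ] H))).toLinearMap
    postcomp_postcomp_symm toEnd_precomp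
    (fun u v => by ext w; simp) m hx

theorem eq_of_conj_eq {u v : D →L[ℂ] D}
    (h : ((Λ : D →L[ℂ] H).comp u).comp (Λ.symm : H →L[ℂ] D)
      = ((Λ : D →L[ℂ] H).comp v).comp (Λ.symm : H →L[ℂ] D)) : u = v := by
  ext w
  have := congr($h (Λ w))
  simpa using this

theorem isParametrix_parametrix (ha : ContDiff ℝ ∞ a)
    (hP : ContDiffOn ℝ ∞ (fun t => toEnd Λ (P t)) (Icc 0 1)) :
    IsParametrix ι a P (parametrix Λ ι a P) := by
  have hset : ellipticSet ι a P = unitSet (toEnd Λ ι) a (fun t => toEnd Λ (P t)) :=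
    Set.ext fun x => mem_ellipticSet_iff Λ ι a P
  have hS : ∀ z, HasJets {x | (x.1, x.2, z) ∈ unitSet (toEnd Λ ι) a (fun t => toEnd Λ (P t))}
      (ContinuousLinearMap.postcomp H (Λ.symm : H →L[ℂ] D))
      (fun t τ => solJet (toEnd Λ ι) a (fun t => toEnd Λ (P t)) t τ z)
      (fun j t' τ' => parametrix Λ ι a P j t' τ' z) := fun z k t τ _ => rfl
  refine ⟨fun j => ?_, fun j t τ => ?_, fun t τ z hx m => ?_, fun t τ z hx m => ?_⟩
  · rw [hset]
    exact ContDiffOn.complex_clm_comp (liftCoeff Λ j) (contDiffOn_solJet ha hP j 0 0)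
  · rw [hset]
    exact DifferentiableOn.const_clm_comp (liftCoeff Λ j) (differentiableOn_solJet t τ j 0 0)
  · rw [hset] at hx
    have hsol := isJetField_solJet (e := toEnd Λ ι) ha hP z
    rw [symbolProd_comp_right (hasJets_sym Λ ι a P z _) (hS z)
      ((isJetField_symJet ha hP z).mono (fun x hx => ⟨hx.1, mem_univ _⟩) hsol.nhds) hsol m hx,
      sym_mul_sol hx, one_entry_zero]
    rfl
  · rw [hset] at hx
    have hsol := isJetField_solJet (e := toEnd Λ ι) ha hP z
    refine eq_of_conj_eq (Λ := Λ) ?_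
    rw [symbolProd_comp_left (hS z) (hasJets_sym Λ ι a P z _) hsol
      ((isJetField_symJet ha hP z).mono (fun x hx => ⟨hx.1, mem_univ _⟩) hsol.nhds) m hx,
      sol_mul_sym hx, one_entry_zero]
    split_ifs
    · ext w; simp
    · simp

end Operators

/-! ### Uniqueness of the parametrix -/

section Uniqueness

theorem symbolProd_principalSymbol {E F G : Type*} [NormedAddCommGroup E] [NormedSpace ℂ E]
    [NormedAddCommGroup F] [NormedSpace ℂ F] [NormedAddCommGroup G] [NormedSpace ℂ G]
    (p : ℝ → ℝ → F →L[ℂ] G) (q : ℕ → ℝ → ℝ → E →L[ℂ] F) (m : ℕ) (t τ : ℝ) :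
    symbolProd (principalSymbol p) q m t τ = ∑ x ∈ Finset.HasAntidiagonal.antidiagonal m,
      (((x.1 ! : ℕ) : ℂ)⁻¹ * (Complex.I⁻¹) ^ x.1) •
        (iteratedDeriv x.1 (p t) τ).comp
          (iteratedDerivWithin x.1 (fun t' => q x.2 t' τ) (Icc 0 1) t) := by
  refine Finset.sum_congr rfl fun x _ => ?_
  rw [Finset.sum_eq_single (0, x.2)]
  · simp [principalSymbol]
  · intro y hy hne
    have h0 : y.1 ≠ 0 := by
      rintro h
      rw [Finset.HasAntidiagonal.mem_antidiagonal, h, zero_add] at hy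
      exact hne (Prod.ext h hy)
    simp [principalSymbol, h0]
  · intro h
    simp [Finset.HasAntidiagonal.mem_antidiagonal] at h

variable {H D : Type*} [NormedAddCommGroup H] [InnerProductSpace ℂ H]
  [NormedAddCommGroup D] [NormedSpace ℂ D]
  {ι : D →L[ℂ] H} {a : ℝ → ℝ} {P : ℝ → D →L[ℂ] H}

/-- In the coefficient of `h^j` of the right inverse equation, `S_j` appears only under the
injective operator `z - a(τ) - P(t)`; the other terms are `t`-derivatives of earlier coefficients.
These agree near `t` by relative openness, so their derivatives agree. -/
theorem IsParametrix.eq_of_isParametrix {S S' : ℕ → ℝ → ℝ → ℂ → H →L[ℂ] D}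
    (hS : IsParametrix ι a P S) (hS' : IsParametrix ι a P S')
    (hopen : ∀ t τ z, (t, τ, z) ∈ ellipticSet ι a P →
      ∀ᶠ t' in 𝓝[Icc 0 1] t, (t', τ, z) ∈ ellipticSet ι a P) (j : ℕ) (t τ : ℝ) (z : ℂ)
    (h : (t, τ, z) ∈ ellipticSet ι a P) : S' j t τ z = S j t τ z := by
  induction j using Nat.strong_induction_on generalizing t with
  | _ j ih =>
    have h1 := (hS'.right_inverse t τ z h j).trans (hS.right_inverse t τ z h j).symm
    rw [symbolProd_principalSymbol, symbolProd_principalSymbol] at h1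
    have hmem : (0, j) ∈ Finset.HasAntidiagonal.antidiagonal j := by
      simp [Finset.HasAntidiagonal.mem_antidiagonal]
    rw [← Finset.add_sum_erase _ _ hmem, ← Finset.add_sum_erase _ _ hmem] at h1
    have h2 : ∀ x ∈ (Finset.HasAntidiagonal.antidiagonal j).erase (0, j),
        iteratedDerivWithin x.1 (fun t' => S' x.2 t' τ z) (Icc 0 1) t
          = iteratedDerivWithin x.1 (fun t' => S x.2 t' τ z) (Icc 0 1) t := by
      intro x hx
      rw [Finset.mem_erase, Finset.HasAntidiagonal.mem_antidiagonal] at hx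
      have hlt : x.2 < j := by
        rcases Nat.eq_zero_or_pos x.1 with h0 | h0
        · exact absurd (Prod.ext h0 (by simpa [h0] using hx.2)) hx.1
        · omega
      have h3 : (fun t' => S' x.2 t' τ z) =ᶠ[𝓝[Icc 0 1] t] fun t' => S x.2 t' τ z :=
        (hopen t τ z h).mono fun t' ht' => ih x.2 hlt t' ht'
      rw [iteratedDerivWithin_eq_iteratedFDerivWithin, iteratedDerivWithin_eq_iteratedFDerivWithin,
        h3.iteratedFDerivWithin_eq (ih x.2 hlt t h)]
    rw [Finset.sum_congr rfl fun x hx => by rw [h2 x hx]] at h1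
    have h4 := add_right_cancel h1
    simp only [Nat.factorial_zero, Nat.cast_one, inv_one, pow_zero, mul_one, one_smul,
      iteratedDeriv_zero, iteratedDerivWithin_zero] at h4
    have hinj : Function.Injective (z • ι - hamiltonSymbol ι a P t τ) := by
      have h5 : Function.Bijective ((z - (a τ : ℂ)) • ι - P t) := not_not.1 h.2
      rw [hamiltonSymbol, ← sub_sub, ← sub_smul]
      exact h5.1
    ext v
    exact hinj congr($h4 v)

end Uniqueness

/-! ### Gevrey bounds and projector identities for an arbitrary parametrix -/

section Operators

open Jet

variable {H D : Type*} [NormedAddCommGroup H] [InnerProductSpace ℂ H] [CompleteSpace H]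
  [NormedAddCommGroup D] [NormedSpace ℂ D] [CompleteSpace D]
variable {Λ : D ≃L[ℂ] H} {ι : D →L[ℂ] H} {a : ℝ → ℝ} {P : ℝ → D →L[ℂ] H} {γ₁ γ₂ : ℝ → ℝ}

theorem eventually_mem_ellipticSet (ha : ContDiff ℝ ∞ a)
    (hP : ContDiffOn ℝ ∞ (fun t => toEnd Λ (P t)) (Icc 0 1)) (t τ : ℝ) (z : ℂ)
    (h : (t, τ, z) ∈ ellipticSet ι a P) :
    ∀ᶠ t' in 𝓝[Icc 0 1] t, (t', τ, z) ∈ ellipticSet ι a P := by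
  have h1 : Filter.Tendsto (fun t' : ℝ => (t', τ, z)) (𝓝[Icc 0 1] t)
      (𝓝[{x | x.1 ∈ Icc (0 : ℝ) 1}] (t, τ, z)) :=
    ((Continuous.prodMk_left (τ, z)).continuousWithinAt).tendsto_nhdsWithin (fun y hy => hy)
  simp only [mem_ellipticSet_iff Λ] at h ⊢
  exact h1.eventually (eventually_mem_unitSet ha hP h)

theorem norm_liftCoeff_le (j : ℕ) (b : H →L[ℂ] H) :
    ‖liftCoeff Λ j b‖ ≤ ‖(Λ.symm : H →L[ℂ] D)‖ * ((j ! : ℝ)⁻¹ * ‖b‖) := by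
  have h1 : liftCoeff Λ j b = ((j ! : ℕ) : ℂ)⁻¹ • (Λ.symm : H →L[ℂ] D).comp b := rfl
  rw [h1, norm_smul, norm_inv, Complex.norm_natCast, mul_left_comm]
  gcongr
  exact ContinuousLinearMap.opNorm_comp_le _ _

theorem exists_norm_liftCoeff_le {s σ C₀ C₁ R M : ℝ} (hs : 1 ≤ s)
    (hσ : 1 ≤ σ) (hC₀ : 0 < C₀) (hC₁ : 0 < C₁) (hR : 0 < R) (hM : 0 < M)
    (hP : ∀ k : ℕ, ∀ t ∈ Icc (0 : ℝ) 1,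
      ‖iteratedDerivWithin k (fun t => toEnd Λ (P t)) (Icc 0 1) t‖ ≤ C₀ ^ (k + 1) * (k ! : ℝ) ^ s)
    (hab : ∀ n : ℕ, 1 ≤ n → ∀ τ, |iteratedDeriv n a τ| ≤ C₁ * R ^ n * (n ! : ℝ) ^ σ) :
    ∃ C > 0, ∃ ρ ≥ 1, ∀ t τ z, (t, τ, z) ∈ unitSet (toEnd Λ ι) a (fun t => toEnd Λ (P t)) →
      ‖Ring.inverse (symJet (toEnd Λ ι) a (fun t => toEnd Λ (P t)) t τ z 0 0 0)‖ ≤ M →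
      ∀ k j β : ℕ, ‖liftCoeff Λ k (solJet (toEnd Λ ι) a (fun t => toEnd Λ (P t)) t τ z k j β)‖
        ≤ C * ρ ^ (j + β + k) * (j ! : ℝ) ^ s * (β ! : ℝ) ^ σ * (k ! : ℝ) ^ (s + σ - 1) := by
  obtain ⟨ρ, hρ, h⟩ := exists_norm_solJet_le (e := toEnd Λ ι) (a := a) hs hσ hC₀ hC₁ hR hM.le hP
  obtain ⟨r, hr, h'⟩ := exists_gevrey_bound hs hσ hρ
  refine ⟨(‖(Λ.symm : H →L[ℂ] D)‖ + 1) * M, by positivity, r, hr, fun t τ z hx hinv k j β => ?_⟩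
  have h1 := h t τ z hx hinv (fun n hn => hab n hn τ) k j β
  calc _ ≤ ‖(Λ.symm : H →L[ℂ] D)‖ * ((k ! : ℝ)⁻¹ *
        ‖solJet (toEnd Λ ι) a (fun t => toEnd Λ (P t)) t τ z k j β‖) := norm_liftCoeff_le _ _
    _ ≤ (‖(Λ.symm : H →L[ℂ] D)‖ + 1) * ((k ! : ℝ)⁻¹ *
        (M * (((j + k)! : ℝ) ^ s * ((β + k)! : ℝ) ^ σ * ρ ^ (2 * k + j + β)))) := by
        gcongr
        linarith
    _ = (‖(Λ.symm : H →L[ℂ] D)‖ + 1) * M * ((k ! : ℝ)⁻¹ *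
        (((j + k)! : ℝ) ^ s * ((β + k)! : ℝ) ^ σ * ρ ^ (2 * k + j + β))) := by ring
    _ ≤ (‖(Λ.symm : H →L[ℂ] D)‖ + 1) * M *
        (r ^ (j + β + k) * (j ! : ℝ) ^ s * (β ! : ℝ) ^ σ * (k ! : ℝ) ^ (s + σ - 1)) :=
        mul_le_mul_of_nonneg_left (h' k j β) (by positivity)
    _ = _ := by ring

theorem exists_norm_inverse_le_of_isCompact {B : Type*} [NormedRing B] [NormedAlgebra ℂ B]
    [CompleteSpace B] {e : B} {P : ℝ → B} (ha : ContDiff ℝ ∞ a)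
    (hP : ContDiffOn ℝ ∞ P (Icc 0 1)) {K : Set (ℝ × ℝ × ℂ)} (hK : IsCompact K)
    (hKs : K ⊆ unitSet e a P) :
    ∃ M > 0, ∀ x ∈ K, ‖Ring.inverse (symJet e a P x.1 x.2.1 x.2.2 0 0 0)‖ ≤ M := by
  have h1 : ContinuousOn (fun x : ℝ × ℝ × ℂ =>
      Ring.inverse (symJet e a P x.1 x.2.1 x.2.2 0 0 0)) K := by
    intro x hx
    obtain ⟨u, hu⟩ := (mem_unitSet.1 (hKs hx)).2
    have h2 := NormedRing.inverse_continuousAt u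
    rw [hu] at h2
    exact ContinuousAt.comp_continuousWithinAt
      (f := fun x : ℝ × ℝ × ℂ => symJet e a P x.1 x.2.1 x.2.2 0 0 0) h2
      (((contDiffOn_symJet ha hP 0 0 0).continuousOn x (hKs hx).1).mono fun y hy => (hKs hy).1)
  obtain ⟨M, hM⟩ := hK.exists_bound_of_continuousOn h1
  exact ⟨max M 1, by positivity, fun x hx => (hM x hx).trans (le_max_left _ _)⟩

section Agreement

variable {S : ℕ → ℝ → ℝ → ℂ → H →L[ℂ] D}
  (hS : ∀ j t τ z, (t, τ, z) ∈ ellipticSet ι a P → S j t τ z = parametrix Λ ι a P j t τ z)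
include hS

theorem isFormalGevrey_of_eq_parametrix {s σ C₀ C₁ R : ℝ} (hs : 1 ≤ s)
    (hσ : 1 ≤ σ) (hC₀ : 0 < C₀) (hC₁ : 0 < C₁) (hR : 0 < R) (ha : ContDiff ℝ ∞ a)
    (hPs : ContDiffOn ℝ ∞ (fun t => toEnd Λ (P t)) (Icc 0 1))
    (hP : ∀ k : ℕ, ∀ t ∈ Icc (0 : ℝ) 1,
      ‖iteratedDerivWithin k (fun t => toEnd Λ (P t)) (Icc 0 1) t‖ ≤ C₀ ^ (k + 1) * (k ! : ℝ) ^ s)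
    (hab : ∀ n : ℕ, 1 ≤ n → ∀ τ, |iteratedDeriv n a τ| ≤ C₁ * R ^ n * (n ! : ℝ) ^ σ) :
    IsFormalGevrey s σ (ellipticSet ι a P) S := by
  intro K hK hKc
  have hK' : K ⊆ unitSet (toEnd Λ ι) a (fun t => toEnd Λ (P t)) := fun x hx =>
    (mem_ellipticSet_iff Λ ι a P).1 (hK hx)
  obtain ⟨M, hM, hMK⟩ := exists_norm_inverse_le_of_isCompact ha hPs hKc hK'
  obtain ⟨C, hC, ρ, hρ, h⟩ := exists_norm_liftCoeff_le (Λ := Λ) (ι := ι) (a := a) (P := P)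
    hs hσ hC₀ hC₁ hR hM hP hab
  refine ⟨C, hC, ρ, by linarith, fun α β k t τ z hx => ?_⟩
  have hj : HasJets {x | (x.1, x.2, z) ∈ unitSet (toEnd Λ ι) a (fun t => toEnd Λ (P t))}
      (ContinuousLinearMap.postcomp H (Λ.symm : H →L[ℂ] D))
      (fun t τ => solJet (toEnd Λ ι) a (fun t => toEnd Λ (P t)) t τ z)
      (fun j t' τ' => S j t' τ' z) := fun k t τ hx =>
    hS k t τ z ((mem_ellipticSet_iff Λ ι a P).2 hx)
  have h1 := hj.iteratedDerivWithin_eq (isJetField_solJet ha hPs z) k α β (hK' hx)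
  have h2 := h t τ z (hK' hx) (hMK (t, τ, z) hx) k α β
  refine le_trans (le_of_eq ?_) h2
  refine congrArg norm ?_
  exact h1

variable (G : SpectralGap (toEnd Λ ι) (fun t => toEnd Λ (P t)) γ₁ γ₂) (ha : ContDiff ℝ ∞ a)
include G ha

theorem projectorCoeff_eq (j : ℕ) {t : ℝ} (ht : t ∈ Icc (0 : ℝ) 1) (τ : ℝ) :
    projectorCoeff a γ₁ γ₂ S j t τ
      = liftCoeff Λ j (projJet (toEnd Λ ι) a (fun t => toEnd Λ (P t)) γ₁ γ₂ t τ j 0 0) := by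
  rw [projectorCoeff, projJet, map_smul,
    ← (liftCoeff Λ j).circleIntegral_comp_comm (G.circleIntegrable_sol ha τ ht j 0 0)]
  congr 1
  refine circleIntegral.integral_congr (by linarith [G.lt t ht]) fun z hz => ?_
  exact hS j t τ z ((mem_ellipticSet_iff Λ ι a P).2 (G.sphere_subset ha τ ht hz))

theorem contDiffOn_projectorCoeff (j : ℕ) :
    ContDiffOn ℝ ∞ (fun x : ℝ × ℝ => projectorCoeff a γ₁ γ₂ S j x.1 x.2) (Icc 0 1 ×ˢ univ) :=
  (ContDiffOn.complex_clm_comp (liftCoeff Λ j) (G.contDiffOn_projJet ha j 0 0)).congr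
    fun x hx => projectorCoeff_eq hS G ha j hx.1 x.2

theorem hasJets_projectorCoeff :
    HasJets (Icc 0 1 ×ˢ univ) (ContinuousLinearMap.postcomp H (Λ.symm : H →L[ℂ] D))
      (projJet (toEnd Λ ι) a (fun t => toEnd Λ (P t)) γ₁ γ₂) (projectorCoeff a γ₁ γ₂ S) :=
  fun k _ τ hx => projectorCoeff_eq hS G ha k hx.1 τ

theorem isFormalProjector_projectorCoeff :
    IsFormalProjector ι (projectorCoeff a γ₁ γ₂ S) := by
  intro m t ht τ
  have hQ := hasJets_projectorCoeff hS G ha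
  have hf := G.isJetField_projJet ha
  -- The copy of `Π` regarded as an operator on `H` has jets `e Π`, so the claim is the identity `Π
  -- e Π = Π` of jets.
  have hQ' : HasJets (Icc 0 1 ×ˢ univ) (ContinuousLinearMap.id ℂ (H →L[ℂ] H))
      (fun t τ => const (toEnd Λ ι) * projJet (toEnd Λ ι) a (fun t => toEnd Λ (P t)) γ₁ γ₂ t τ)
      (fun j t' τ' => ι.comp (projectorCoeff a γ₁ γ₂ S j t' τ')) := by
    intro k t τ hx
    beta_reduce
    rw [hQ k t τ hx]
    rw [const_mul_apply]
    ext v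
    simp [toEnd]
  have hx : (t, τ) ∈ Icc (0 : ℝ) 1 ×ˢ (univ : Set ℝ) := ⟨ht, mem_univ τ⟩
  have h1 := hQ.symbolProd_eq hQ' hf (hf.const_mul (toEnd Λ ι))
    (ContinuousLinearMap.postcomp H (Λ : D →L[ℂ] H)).toLinearMap LinearMap.id
    (ContinuousLinearMap.postcomp H (Λ : D →L[ℂ] H)).toLinearMap
    postcomp_postcomp_symm (fun b => rfl) (fun u v => by ext w; simp) m hx
  rw [G.proj_mul_const_mul_proj ha τ ht] at h1
  have h2 := hQ m t τ hx
  ext v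
  apply Λ.injective
  have h3 := congr($h1 v)
  rw [h2]
  simpa using h3

/-- Composition with `ι` on either side corresponds to a factor `e`, which is the form in which the
jets commute. -/
theorem formallyCommutes_projectorCoeff :
    FormallyCommutes ι a P (projectorCoeff a γ₁ γ₂ S) := by
  intro m t ht τ
  have hQ := hasJets_projectorCoeff hS G ha
  have hf := G.isJetField_projJet ha
  have hx : (t, τ) ∈ Icc (0 : ℝ) 1 ×ˢ (univ : Set ℝ) := ⟨ht, mem_univ τ⟩
  have hham := isJetField_hamJet (e := toEnd Λ ι) ha G.smooth
  have h1 := symbolProd_comp_right (hasJets_ham Λ ι a P _) hQ hham hf m hx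
  have h2 := symbolProd_comp_left hQ (hasJets_ham Λ ι a P _) hf hham m hx
  have h3 := congr($(G.ham_mul_proj_mul_const ha τ ht) m 0 0)
  rw [mul_const_apply, mul_assoc, const_mul_apply] at h3
  ext v
  have h4 := congr(((m ! : ℕ) : ℂ)⁻¹ • $h3 (Λ v))
  have h5 := congr(ι (Λ.symm ($h2 (Λ v))))
  rw [h1]
  simp [toEnd] at h4 h5 ⊢
  rw [h4, h5]

theorem exists_norm_projectorCoeff_le {s σ C₀ C₁ R : ℝ} (hs : 1 ≤ s)
    (hσ : 1 ≤ σ) (hC₀ : 0 < C₀) (hC₁ : 0 < C₁) (hR : 0 < R)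
    (hP : ∀ k : ℕ, ∀ t ∈ Icc (0 : ℝ) 1,
      ‖iteratedDerivWithin k (fun t => toEnd Λ (P t)) (Icc 0 1) t‖ ≤ C₀ ^ (k + 1) * (k ! : ℝ) ^ s)
    (hab : ∀ n : ℕ, 1 ≤ n → ∀ τ, |iteratedDeriv n a τ| ≤ C₁ * R ^ n * (n ! : ℝ) ^ σ) :
    ∃ C > 0, ∀ j : ℕ, ∀ t ∈ Icc (0 : ℝ) 1, ∀ τ : ℝ,
      ‖projectorCoeff a γ₁ γ₂ S j t τ‖ ≤ C ^ (j + 1) * (j ! : ℝ) ^ (s + σ - 1) := by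
  obtain ⟨M, hM, hMr⟩ := G.exists_resolvent_bound ha
  obtain ⟨C, hC, ρ, hρ, h⟩ := exists_norm_liftCoeff_le (Λ := Λ) (ι := ι) (a := a) (P := P)
    hs hσ hC₀ hC₁ hR hM hP hab
  obtain ⟨r, hr⟩ := isCompact_Icc.exists_bound_of_continuousOn
    ((G.cont₂.sub G.cont₁).div_const 2)
  have hr0 : 0 ≤ r := (norm_nonneg _).trans (hr 0 (by simp))
  refine ⟨(r * C + 1) * ρ, by positivity, fun j t ht τ => ?_⟩
  have h1 : ‖projectorCoeff a γ₁ γ₂ S j t τ‖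
      ≤ (γ₂ t - γ₁ t) / 2 * (C * ρ ^ j * (j ! : ℝ) ^ (s + σ - 1)) := by
    refine circleIntegral.norm_two_pi_i_inv_smul_integral_le_of_norm_le_const
      (by linarith [G.lt t ht]) fun z hz => ?_
    have hmem := G.sphere_subset ha τ ht hz
    rw [hS j t τ z ((mem_ellipticSet_iff Λ ι a P).2 hmem)]
    simpa [parametrix] using h t τ z hmem (hMr t ht τ z hz) j 0 0
  have hj : (0 : ℝ) ≤ (j ! : ℝ) ^ (s + σ - 1) := by positivity
  have hrC : r * C ≤ (r * C + 1) ^ (j + 1) := by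
    have h2 : (1 : ℝ) ≤ r * C + 1 := by nlinarith
    exact le_trans (by linarith) (le_self_pow₀ h2 (Nat.succ_ne_zero j))
  calc _ ≤ (γ₂ t - γ₁ t) / 2 * (C * ρ ^ j * (j ! : ℝ) ^ (s + σ - 1)) := h1
    _ ≤ r * (C * ρ ^ j * (j ! : ℝ) ^ (s + σ - 1)) := by
        gcongr
        exact (le_abs_self _).trans (hr t ht)
    _ = (r * C) * ρ ^ j * (j ! : ℝ) ^ (s + σ - 1) := by ring
    _ ≤ (r * C + 1) ^ (j + 1) * ρ ^ (j + 1) * (j ! : ℝ) ^ (s + σ - 1) := by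
        gcongr
        exact Nat.le_succ j
    _ = _ := by rw [mul_pow]

end Agreement

end Operators

/-! ### Nonreal points lie in the resolvent set -/

section SelfAdjoint

variable {H D : Type*} [NormedAddCommGroup H] [InnerProductSpace ℂ H] [CompleteSpace H]
  [NormedAddCommGroup D] [NormedSpace ℂ D]
  {ι : D →L[ℂ] H} {hι : Function.Injective ι} {T : D →L[ℂ] H}

theorem operatorWithDomain_apply (u : D) (h : ι u ∈ (operatorWithDomain ι hι T).domain) :
    operatorWithDomain ι hι T ⟨ι u, h⟩ = T u := by
  change T ((LinearEquiv.ofInjective (ι : D →ₗ[ℂ] H) hι).symm ⟨ι u, h⟩) = T u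
  congr 1
  rw [LinearEquiv.symm_apply_eq]
  rfl

theorem inner_apply_eq_of_isSelfAdjoint (hT : IsSelfAdjoint (operatorWithDomain ι hι T))
    (u v : D) : inner ℂ (T u) (ι v) = inner ℂ (ι u) (T v) := by
  have h1 := LinearPMap.adjoint_isFormalAdjoint hT.dense_domain
  rw [LinearPMap.isSelfAdjoint_def.1 hT] at h1
  have h2 := h1 ⟨ι u, LinearMap.mem_range_self _ u⟩ ⟨ι v, LinearMap.mem_range_self _ v⟩
  have hu := operatorWithDomain_apply (hι := hι) (T := T) u (LinearMap.mem_range_self _ u)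
  have hv := operatorWithDomain_apply (hι := hι) (T := T) v (LinearMap.mem_range_self _ v)
  exact (congrArg (fun w => inner ℂ w (ι v)) hu).symm.trans
    (h2.trans (congrArg (fun w => inner ℂ (ι u) w) hv))

/-- The hypothesis places `y` in the domain of the adjoint, which is the domain of `T`; symmetry and
density then identify the image. -/
theorem exists_of_forall_inner_eq (hT : IsSelfAdjoint (operatorWithDomain ι hι T)) {w y : H}
    (h : ∀ v, inner ℂ w (ι v) = inner ℂ y (T v)) : ∃ u, ι u = y ∧ T u = w := by
  have h1 : y ∈ (operatorWithDomain ι hι T).adjoint.domain := by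
    refine LinearPMap.mem_adjoint_domain_of_exists y ⟨w, ?_⟩
    rintro ⟨_, v, rfl⟩
    exact (h v).trans (congrArg _ (operatorWithDomain_apply v _).symm)
  rw [LinearPMap.isSelfAdjoint_def.1 hT] at h1
  obtain ⟨u, hu⟩ := h1
  have hu' : ι u = y := hu
  refine ⟨u, hu', ?_⟩
  have hd : Dense ((operatorWithDomain ι hι T).domain : Set H) := hT.dense_domain
  refine hd.eq_of_inner_left ℂ ?_
  rintro _ ⟨v, rfl⟩
  change inner ℂ (T u) (ι v) = inner ℂ w (ι v)
  rw [h, inner_apply_eq_of_isSelfAdjoint hT, hu']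

/-- By symmetry `⟨u, T u⟩` is real, so the imaginary part of `⟨u, (z - T) u⟩` is `Im z ‖u‖²`;
Cauchy–Schwarz concludes. -/
theorem norm_le_of_isSelfAdjoint (hT : IsSelfAdjoint (operatorWithDomain ι hι T)) (z : ℂ) (u : D) :
    |z.im| * ‖ι u‖ ≤ ‖(z • ι - T) u‖ := by
  have h1 : (inner ℂ (ι u) (T u)).im = 0 := by
    have h2 := inner_apply_eq_of_isSelfAdjoint hT u u
    rw [← inner_conj_symm] at h2
    exact Complex.conj_eq_iff_im.1 h2
  have h3 : (inner ℂ (ι u) ((z • ι - T) u)).im = z.im * (‖ι u‖ * ‖ι u‖) := by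
    have h4 : inner ℂ (ι u) ((z • ι - T) u) = z * inner ℂ (ι u) (ι u) - inner ℂ (ι u) (T u) := by
      simp
    rw [h4, Complex.sub_im, h1, inner_self_eq_norm_sq_to_K]
    simp [Complex.mul_im, sq, ← Complex.ofReal_mul]
  have h5 : |z.im| * (‖ι u‖ * ‖ι u‖) ≤ ‖ι u‖ * ‖(z • ι - T) u‖ := by
    calc |z.im| * (‖ι u‖ * ‖ι u‖) = |(inner ℂ (ι u) ((z • ι - T) u)).im| := by
          rw [h3, abs_mul, abs_of_nonneg (mul_nonneg (norm_nonneg _) (norm_nonneg _))]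
      _ ≤ ‖inner ℂ (ι u) ((z • ι - T) u)‖ := Complex.abs_im_le_norm _
      _ ≤ _ := norm_inner_le_norm _ _
  rcases (norm_nonneg (ι u)).eq_or_lt with h0 | h0
  · rw [← h0, mul_zero]; exact norm_nonneg _
  · exact le_of_mul_le_mul_left (by linarith) h0

/-- Nonreal numbers do not belong to the spectrum of a self-adjoint operator. -/
theorem bijective_of_isSelfAdjoint (hT : IsSelfAdjoint (operatorWithDomain ι hι T)) {z : ℂ}
    (hz : z.im ≠ 0) : Function.Bijective (z • ι - T) := by
  have hinj : ∀ w : ℂ, w.im ≠ 0 → ∀ u, (w • ι - T) u = 0 → u = 0 := fun w hw u hu => by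
    have h1 := norm_le_of_isSelfAdjoint hT w u
    rw [hu, norm_zero] at h1
    have h2 : ‖ι u‖ = 0 := by
      by_contra h
      have : 0 < |w.im| * ‖ι u‖ :=
        mul_pos (abs_pos.2 hw) (lt_of_le_of_ne (norm_nonneg _) (Ne.symm h))
      linarith
    exact hι ((norm_eq_zero.1 h2).trans (map_zero ι).symm)
  refine ⟨(injective_iff_map_eq_zero _).2 (hinj z hz), ?_⟩
  have hz' : 0 < |z.im| := abs_pos.2 hz
  set K : Submodule ℂ H := LinearMap.range ((z • ι - T : D →L[ℂ] H) : D →ₗ[ℂ] H) with hK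
  -- The lower bound makes preimages of a convergent sequence Cauchy in `H`. Their limit is in the
  -- domain because symmetry passes to the limit.
  have hclosed : IsClosed (K : Set H) := by
    refine IsSeqClosed.isClosed fun f x hf hfx => ?_
    choose u hu using hf
    have hu' : ∀ n, (z • ι - T) (u n) = f n := hu
    have hc : CauchySeq fun n => ι (u n) := by
      rw [Metric.cauchySeq_iff]
      intro ε hε
      obtain ⟨N, hN⟩ := Metric.cauchySeq_iff.1 hfx.cauchySeq (|z.im| * ε) (mul_pos hz' hε)
      refine ⟨N, fun m hm n hn => ?_⟩
      have h1 := hN m hm n hn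
      have h2 := norm_le_of_isSelfAdjoint hT z (u m - u n)
      rw [map_sub, map_sub, hu', hu', ← dist_eq_norm, ← dist_eq_norm] at h2
      exact lt_of_mul_lt_mul_left (h2.trans_lt h1) hz'.le
    obtain ⟨y, hy⟩ := cauchySeq_tendsto_of_complete hc
    have hTu : Filter.Tendsto (fun n => T (u n)) Filter.atTop (𝓝 (z • y - x)) := by
      refine ((hy.const_smul z).sub hfx).congr fun n => ?_
      rw [← hu']; simp
    obtain ⟨v, hv, hTv⟩ := exists_of_forall_inner_eq hT (w := z • y - x) (y := y) fun v => by
      refine tendsto_nhds_unique (hTu.inner (tendsto_const_nhds (x := ι v))) ?_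
      simp only [inner_apply_eq_of_isSelfAdjoint hT]
      exact hy.inner tendsto_const_nhds
    exact ⟨v, by simp [hv, hTv]⟩
  -- A vector orthogonal to the range is in the domain and satisfies `T u = z̄ u`; it vanishes since
  -- `z̄` is nonreal too.
  have hperp : Kᗮ = ⊥ := by
    rw [Submodule.eq_bot_iff]
    intro y hy
    obtain ⟨u, hu, hTu⟩ := exists_of_forall_inner_eq hT (w := (starRingEnd ℂ) z • y) (y := y)
      fun v => by
        have h1 := (Submodule.mem_orthogonal' K y).1 hy _ (LinearMap.mem_range_self _ v)
        simp only [ContinuousLinearMap.coe_coe, sub_apply,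
          smul_apply, inner_sub_right, inner_smul_right] at h1
        rw [inner_smul_left, Complex.conj_conj]
        exact sub_eq_zero.1 h1
    have h2 : u = 0 := hinj ((starRingEnd ℂ) z) (by simpa using hz) u (by simp [hu, hTu])
    rw [← hu, h2, map_zero]
  have htop : K = ⊤ := by
    rw [← hclosed.submodule_topologicalClosure_eq]
    exact (Submodule.topologicalClosure_eq_top_iff).2 hperp
  intro y
  have : y ∈ K := htop ▸ Submodule.mem_top
  exact this

end SelfAdjoint

/-! ### Gevrey data and the linear case `a(τ) = τ` -/

theorem iteratedDerivWithin_complex_clm_comp {X Y : Type*} [NormedAddCommGroup X]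
    [NormedSpace ℂ X] [NormedAddCommGroup Y] [NormedSpace ℂ Y] (L : X →L[ℂ] Y) {f : ℝ → X}
    {s : Set ℝ} (hs : UniqueDiffOn ℝ s) (hf : ContDiffOn ℝ ∞ f s) (k : ℕ) {t : ℝ} (ht : t ∈ s) :
    iteratedDerivWithin k (fun t => L (f t)) s t = L (iteratedDerivWithin k f s t) :=
  iteratedDerivWithin_eq_of_chain (V := s) (F := fun k t => L (iteratedDerivWithin k f s t))
    hs subset_rfl (fun _ _ => self_mem_nhdsWithin) (fun t _ => by simp)
    (fun j t ht => (L.restrictScalars ℝ).hasFDerivAt.comp_hasDerivWithinAt t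
      (hf.hasDerivWithinAt_iteratedDerivWithin hs j ht)) k ht

theorem IsGevreyFamily.clm_comp {X Y : Type*} [NormedAddCommGroup X]
    [NormedSpace ℂ X] [NormedAddCommGroup Y] [NormedSpace ℂ Y] (L : X →L[ℂ] Y) {s : ℝ} {P : ℝ → X}
    (hP : IsGevreyFamily s P) : IsGevreyFamily s fun t => L (P t) := by
  obtain ⟨h1, C, hC, h2⟩ := hP
  refine ⟨h1.complex_clm_comp L, C * max ‖L‖ 1, by positivity, fun k t ht => ?_⟩
  rw [iteratedDerivWithin_complex_clm_comp L (uniqueDiffOn_Icc one_pos) h1 k ht]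
  calc _ ≤ ‖L‖ * ‖iteratedDerivWithin k P (Icc 0 1) t‖ := L.le_opNorm _
    _ ≤ max ‖L‖ 1 ^ (k + 1) * (C ^ (k + 1) * (k ! : ℝ) ^ s) := by
        gcongr
        · exact (le_max_left _ _).trans (le_self_pow₀ (le_max_right _ _) (Nat.succ_ne_zero k))
        · exact h2 k t ht
    _ = _ := by rw [mul_pow]; ring

theorem IsGevrey.exists_bound_of_hasCompactSupport {σ : ℝ} {a : ℝ → ℝ} (ha : IsGevrey σ a)
    (hc : HasCompactSupport a) : ∃ C > 0, ∃ R > 0, ∀ n : ℕ, ∀ τ,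
      |iteratedDeriv n a τ| ≤ C * R ^ n * (n ! : ℝ) ^ σ := by
  obtain ⟨C, hC, R, hR, h⟩ := ha.2 _ hc
  refine ⟨C, hC, R, hR, fun n τ => ?_⟩
  by_cases hτ : τ ∈ tsupport a
  · exact h n τ hτ
  · have h0 : iteratedFDeriv ℝ n a τ = 0 :=
      Function.notMem_support.1 fun h' => hτ (support_iteratedFDeriv_subset n h')
    have h1 : iteratedDeriv n a τ = 0 := by simp [iteratedDeriv, h0]
    rw [h1, abs_zero]
    positivity

theorem iteratedDeriv_succ_id (n : ℕ) (τ : ℝ) :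
    iteratedDeriv (n + 1) (fun τ : ℝ => τ) τ = if n = 0 then 1 else 0 := by
  rw [iteratedDeriv_succ']
  simp [iteratedDeriv_const]

section LinearFrequency

open Jet

variable {B : Type*} [NormedRing B] [NormedAlgebra ℂ B] {e : B} {P : ℝ → B}

/-- The derivatives of `τ` of positive order are constant, so passing to another `τ` only changes
the multiple of `e`, which `z` can absorb. -/
theorem symJet_id (t τ : ℝ) (z : ℂ) :
    symJet e (fun τ => τ) P t τ z = symJet e (fun τ => τ) P t 0 (z - τ) := by
  have h : tauJet e (fun τ => τ) τ = tauJet e (fun τ => τ) 0 + (τ : ℂ) • const e := by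
    ext m j β
    rw [Jet.add_apply, Jet.smul_apply]
    rcases β with _ | β
    · by_cases hmj : m = 0 ∧ j = 0
      · simp [tauJet, const, hmj]
      · simp [tauJet, const, hmj]
    · simp [tauJet, const, iteratedDeriv_succ_id]
  rw [symJet, symJet, hamJet, hamJet, h, sub_smul]
  abel

theorem projJet_id (γ₁ γ₂ : ℝ → ℝ) (t τ : ℝ) :
    projJet e (fun τ => τ) P γ₁ γ₂ t τ = projJet e (fun τ => τ) P γ₁ γ₂ t 0 := by
  ext m j β
  have h : ∀ z : ℂ, solJet e (fun τ => τ) P t τ z = solJet e (fun τ => τ) P t 0 (z - τ) :=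
    fun z => by rw [solJet, symJet_id, solJet]
  simp only [projJet, h, circleIntegral, deriv_circleMap]
  congr 2
  ext θ
  simp only [circleMap]
  congr 3
  push_cast
  ring

end LinearFrequency

/-! ### Assembly of the two cases -/

section Final

variable {H D : Type*} [NormedAddCommGroup H] [InnerProductSpace ℂ H] [CompleteSpace H]
  [NormedAddCommGroup D] [NormedSpace ℂ D] [CompleteSpace D]
variable {Λ : D ≃L[ℂ] H} {ι : D →L[ℂ] H} {a : ℝ → ℝ} {P : ℝ → D →L[ℂ] H} {γ₁ γ₂ : ℝ → ℝ}

/-- The formal functional calculus for `a(τ) + P(t)`, when the derivatives of `a` of positive order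
satisfy global Gevrey bounds. -/
theorem parametrix_and_projector (G : SpectralGap (toEnd Λ ι) (fun t => toEnd Λ (P t)) γ₁ γ₂)
    {s σ C₁ R : ℝ} (hs : 1 ≤ s) (hP : IsGevreyFamily s fun t => toEnd Λ (P t)) (hσ : 1 ≤ σ)
    (ha : ContDiff ℝ ∞ a) (hC₁ : 0 < C₁) (hR : 0 < R)
    (hab : ∀ n : ℕ, 1 ≤ n → ∀ τ, |iteratedDeriv n a τ| ≤ C₁ * R ^ n * (n ! : ℝ) ^ σ) :
    (∃ S, IsParametrix ι a P S) ∧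
      ∀ S, IsParametrix ι a P S →
        (∀ S', IsParametrix ι a P S' → ∀ j t τ z, (t, τ, z) ∈ ellipticSet ι a P →
          S' j t τ z = S j t τ z) ∧
        IsFormalGevrey s σ (ellipticSet ι a P) S ∧
        (∀ j, ContDiffOn ℝ ∞ (fun x : ℝ × ℝ => projectorCoeff a γ₁ γ₂ S j x.1 x.2)
          (Icc 0 1 ×ˢ univ)) ∧
        IsFormalProjector ι (projectorCoeff a γ₁ γ₂ S) ∧
        FormallyCommutes ι a P (projectorCoeff a γ₁ γ₂ S) ∧
        ∃ C > 0, ∀ j : ℕ, ∀ t ∈ Icc (0 : ℝ) 1, ∀ τ : ℝ,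
          ‖projectorCoeff a γ₁ γ₂ S j t τ‖ ≤ C ^ (j + 1) * (j ! : ℝ) ^ (s + σ - 1) := by
  obtain ⟨hPs, C₀, hC₀, hPb⟩ := hP
  have hpar := isParametrix_parametrix (Λ := Λ) (ι := ι) (P := P) ha G.smooth
  have hopen := eventually_mem_ellipticSet (Λ := Λ) (ι := ι) (P := P) ha G.smooth
  refine ⟨⟨_, hpar⟩, fun S hS => ?_⟩
  have heq := hpar.eq_of_isParametrix hS hopen
  exact ⟨fun S' hS' => hS.eq_of_isParametrix hS' hopen,
    isFormalGevrey_of_eq_parametrix heq hs hσ hC₀ hC₁ hR ha G.smooth hPb hab,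
    contDiffOn_projectorCoeff heq G ha, isFormalProjector_projectorCoeff heq G ha,
    formallyCommutes_projectorCoeff heq G ha,
    exists_norm_projectorCoeff_le heq G ha hs hσ hC₀ hC₁ hR hPb hab⟩

theorem projectorCoeff_id (G : SpectralGap (toEnd Λ ι) (fun t => toEnd Λ (P t)) γ₁ γ₂)
    {S : ℕ → ℝ → ℝ → ℂ → H →L[ℂ] D} (hS : IsParametrix ι (fun τ => τ) P S) (j : ℕ) {t : ℝ}
    (ht : t ∈ Icc (0 : ℝ) 1) (τ : ℝ) :
    projectorCoeff (fun τ => τ) γ₁ γ₂ S j t τ = projectorCoeff (fun τ => τ) γ₁ γ₂ S j t 0 := by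
  have ha : ContDiff ℝ ∞ fun τ : ℝ => τ := contDiff_id
  have heq := (isParametrix_parametrix (Λ := Λ) (ι := ι) (P := P) ha G.smooth).eq_of_isParametrix hS
    (eventually_mem_ellipticSet ha G.smooth)
  rw [projectorCoeff_eq heq G ha j ht, projectorCoeff_eq heq G ha j ht, projJet_id]

end Final

end

theorem mainTheorem3
    {H D : Type*} [NormedAddCommGroup H] [InnerProductSpace ℂ H] [CompleteSpace H]
    [NormedAddCommGroup D] [NormedSpace ℂ D] [CompleteSpace D]
    (ι : D →L[ℂ] H) (hι : Function.Injective ι) (hdense : DenseRange ι)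
    (P : ℝ → D →L[ℂ] H)
    (hsa : ∀ t ∈ Icc (0 : ℝ) 1, IsSelfAdjoint (operatorWithDomain ι hι (P t)))
    (s : ℝ) (hs : 1 ≤ s) (hP : IsGevreyFamily s P)
    (γ₁ γ₂ : ℝ → ℝ) (hγ₁ : ContinuousOn γ₁ (Icc 0 1)) (hγ₂ : ContinuousOn γ₂ (Icc 0 1))
    (hlt : ∀ t ∈ Icc (0 : ℝ) 1, γ₁ t < γ₂ t)
    (hgap₁ : ∀ t ∈ Icc (0 : ℝ) 1, (γ₁ t : ℂ) ∉ operatorSpectrum ι (P t))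
    (hgap₂ : ∀ t ∈ Icc (0 : ℝ) 1, (γ₂ t : ℂ) ∉ operatorSpectrum ι (P t)) :
    -- the frequency-filtered case `a(hD_t) + P(t)`
    (∀ σ : ℝ, 1 < σ → ∀ a : ℝ → ℝ, IsGevrey σ a → HasCompactSupport a →
      (∃ S, IsParametrix ι a P S) ∧
      ∀ S, IsParametrix ι a P S →
        (∀ S', IsParametrix ι a P S' → ∀ j t τ z, (t, τ, z) ∈ ellipticSet ι a P →
          S' j t τ z = S j t τ z) ∧
        IsFormalGevrey s σ (ellipticSet ι a P) S ∧
        (∀ j, ContDiffOn ℝ ∞ (fun x : ℝ × ℝ => projectorCoeff a γ₁ γ₂ S j x.1 x.2)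
          (Icc 0 1 ×ˢ univ)) ∧
        IsFormalProjector ι (projectorCoeff a γ₁ γ₂ S) ∧
        FormallyCommutes ι a P (projectorCoeff a γ₁ γ₂ S) ∧
        ∃ C > 0, ∀ j : ℕ, ∀ t ∈ Icc (0 : ℝ) 1, ∀ τ : ℝ,
          ‖projectorCoeff a γ₁ γ₂ S j t τ‖ ≤ C ^ (j + 1) * (j ! : ℝ) ^ (s + σ - 1)) ∧
    -- the case `hD_t + P(t)`
    ((∃ S, IsParametrix ι (fun τ => τ) P S) ∧
      ∀ S, IsParametrix ι (fun τ => τ) P S →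
        (∀ S', IsParametrix ι (fun τ => τ) P S' → ∀ j t τ z,
          (t, τ, z) ∈ ellipticSet ι (fun τ => τ) P → S' j t τ z = S j t τ z) ∧
        IsFormalGevrey s 1 (ellipticSet ι (fun τ => τ) P) S ∧
        (∀ j, ContDiffOn ℝ ∞ (fun x : ℝ × ℝ => projectorCoeff (fun τ => τ) γ₁ γ₂ S j x.1 x.2)
          (Icc 0 1 ×ˢ univ)) ∧
        IsFormalProjector ι (projectorCoeff (fun τ => τ) γ₁ γ₂ S) ∧
        FormallyCommutes ι (fun τ => τ) P (projectorCoeff (fun τ => τ) γ₁ γ₂ S) ∧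
        (∀ j, ∀ t ∈ Icc (0 : ℝ) 1, ∀ τ : ℝ,
          projectorCoeff (fun τ => τ) γ₁ γ₂ S j t τ =
            projectorCoeff (fun τ => τ) γ₁ γ₂ S j t 0) ∧
        ∃ C > 0, ∀ j : ℕ, ∀ t ∈ Icc (0 : ℝ) 1,
          ‖projectorCoeff (fun τ => τ) γ₁ γ₂ S j t 0‖ ≤ C ^ (j + 1) * (j ! : ℝ) ^ s) := by
  have hbij : Function.Bijective ((γ₁ 0 : ℂ) • ι - P 0) := not_not.1 (hgap₁ 0 (by simp))
  -- The gap point at `t = 0` supplies an isomorphism `D ≃ H`; it is kept fixed for all `t`.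
  set Λ : D ≃L[ℂ] H := ContinuousLinearEquiv.ofBijective ((γ₁ 0 : ℂ) • ι - P 0)
    (LinearMap.ker_eq_bot.2 hbij.1) (LinearMap.range_eq_top.2 hbij.2)
  have hP' : IsGevreyFamily s fun t => toEnd Λ (P t) :=
    hP.clm_comp (ContinuousLinearMap.precomp H (Λ.symm : H →L[ℂ] D))
  have hunit : ∀ (t : ℝ) (z : ℂ), Function.Bijective (z • ι - P t) →
      IsUnit (z • toEnd Λ ι - toEnd Λ (P t)) := fun t z h => by
    have h1 : z • toEnd Λ ι - toEnd Λ (P t) = toEnd Λ (z • ι - P t) := by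
      ext v; simp [toEnd]
    rw [h1, isUnit_toEnd]
    exact h
  have G : SpectralGap (toEnd Λ ι) (fun t => toEnd Λ (P t)) γ₁ γ₂ :=
    { smooth := hP'.1
      nonreal := fun t ht z hz => hunit t z (bijective_of_isSelfAdjoint (hsa t ht) hz)
      cont₁ := hγ₁
      cont₂ := hγ₂
      lt := hlt
      gap₁ := fun t ht => hunit t _ (not_not.1 (hgap₁ t ht))
      gap₂ := fun t ht => hunit t _ (not_not.1 (hgap₂ t ht)) }
  refine ⟨fun σ hσ a ha hc => ?_, ?_⟩
  · obtain ⟨C₁, hC₁, R, hR, hab⟩ := ha.exists_bound_of_hasCompactSupport hc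
    exact parametrix_and_projector G hs hP' hσ.le ha.1 hC₁ hR fun n _ => hab n
  · have hab : ∀ n : ℕ, 1 ≤ n → ∀ τ : ℝ, |iteratedDeriv n (fun τ : ℝ => τ) τ|
        ≤ 1 * 1 ^ n * (n ! : ℝ) ^ (1 : ℝ) := by
      intro n hn τ
      obtain ⟨n, rfl⟩ := Nat.exists_eq_add_of_le' hn
      have h1 : (1 : ℝ) ≤ ((n + 1)! : ℕ) := by exact_mod_cast Nat.succ_le_of_lt (Nat.factorial_pos _)
      rw [iteratedDeriv_succ_id, one_pow, one_mul, one_mul, Real.rpow_one]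
      split_ifs
      · simpa using h1
      · simp
    obtain ⟨hex, hall⟩ := parametrix_and_projector (a := fun τ => τ) G hs hP' le_rfl
      contDiff_id one_pos one_pos hab
    refine ⟨hex, fun S hS => ?_⟩
    obtain ⟨h1, h2, h3, h4, h5, C, hC, h6⟩ := hall S hS
    refine ⟨h1, h2, h3, h4, h5, fun j t ht τ => projectorCoeff_id G hS j ht τ, C, hC,
      fun j t ht => ?_⟩
    simpa only [add_sub_cancel_right] using h6 j t ht 0
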